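/- For $0<q<1$ and $b>0$ put $(0,b]_q=\{q^jb\mid j\in\mathbb N\}$ ($0\in\mathbb N$) and $[a,b]_q=(0,b]_q\setminus(0,qa]_q$; put $(0,b]_1=(0,b]$ and $[a,b]_1=[a,b]$. Let $$H=\Big\{(q,t,a)\;\Big|\;0<q\le 1,\ t\in(0,q]_q,\ a\in\big[\sqrt{t/q},\sqrt{q/t}\,\big]_q\Big\}\subseteq\mathbb R^3,$$ with the subspace topology and the projection $(q,t,a)\mapsto q$ onto $(0,1]$. Let $H^{(1)}=\{t+t^{-1}-qa^2-q^{-1}a^{-2}\ne0\}$, $H^{(-1)}=\{t+t^{-1}-q^{-1}a^2-qa^{-2}\neq0\}$ (open subsets of $H$), and let $\theta:H^{(1)}\to H^{(-1)}$ be the homeomorphism $(q,t,a)\mapsto(q,t,qa)$. Let $C_0(G)=C_0(H)\rtimes_\theta\mathbb Z$ be the crossed product by this partial automorphism: the universal C$^*$-envelope of the $^*$-algebra of finite sums $\sum_k s^kf_k$, $f_k\in C_0(H^{(k)})$, $H^{(k)}$ being the domain of $\theta^k$, with $$(s^kf)(s^lg)=s^{k+l}\theta^l(f\theta^{-l}(g)),\qquad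 (s^kf)^*=s^{-k}\theta^{-k}(\bar f),\qquad \theta^k(f)=f\circ\theta^k .$$ It is a $C_0((0,1])$-algebra, $\varphi\in C_0((0,1])$ acting by $\varphi\cdot s^kf=s^k(\varphi(q)f)$. Let $I=H\times S^1$, and write again $\theta$ for the partial homeomorphism $(q,t,a,z)\mapsto(q,t,qa,z)$ from $I^{(1)}=H^{(1)}\times S^1$ onto $I^{(-1)}=H^{(-1)}\times S^1$; for $F$ supported in $I^{(1)}$ let $\theta^{-1}(F)=F\circ\theta^{-1}$ on $I^{(-1)}$, extended by $0$ to $I$. Let $Q(q,t,a,z)=q$ and $Z(q,t,a,z)=z$. For $f\in C_c(I)$ and $0<q<1$ put $$\psi(f)(q)=\frac{(1-q)^2}{2\pi}\sum_{(t,a):\,(q,t,a)\in H}(t^{-1}-t)\,a^2\int_0^{2\pi}f(q,t,a,e^{i\vartheta})\,d\vartheta,$$ $$\psi(f)(1)=\frac1{2\pi}\int_0^{2\pi}\!\int_0^1\!\int_{\sqrt t}^{1/\sqrt t}f(1,t,a,e^{i\vartheta})(t^{-2}-1)\,a\;da\,dt\,d\vartheta .$$ Then the completion $\mathscr I$ of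 $C_c(I)$ for the inner product $\langle f,g\rangle=\psi(\bar fg)$ is a Hilbert $C_0((0,1])$-module, and there is a field of faithful representations $\pi$ of $C_0(G)$ on $\mathscr I$ such that $$\pi(f)h=fh,\qquad \pi(sg)h=Q^{-1}Z\,\theta^{-1}(gh)$$ for all $f\in C_0(H)$, $g\in C_0(H^{(1)})$, $h\in C_c(I)$ (the right-hand sides being again in $C_c(I)$). Here a field of faithful representations is a nondegenerate $C_0((0,1])$-linear $^*$-homomorphism $\pi$ from $C_0(G)$ into the multiplier algebra of $\mathcal K(\mathscr I)$ (the adjointable operators on $\mathscr I$) such that for every $q\in(0,1]$ the induced representation of the fibre $C_0(G)_q=C_0(G)/\overline{C_0((0,1]\setminus\{q\})\,C_0(G)}$ on the localisation $\mathscr I_q$ is faithful. -/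

import Mathlib

open scoped ZeroAtInfty ENNReal CompactlySupported
open MeasureTheory

set_option linter.unusedSectionVars false

namespace PartialCrossedProduct

section Basic

variable {X : Type} [TopologicalSpace X]

/-- Iterates `e ^ n`, `n ≥ 0`, of a partial homeomorphism, on their natural domains. -/
def natPow (e : OpenPartialHomeomorph X X) : ℕ → OpenPartialHomeomorph X X
  | 0 => OpenPartialHomeomorph.refl X
  | n + 1 => (natPow e n).trans e

/-- `e ^ k` for `k : ℤ`; the set `H^{(k)}` is `(zPow e k).source`. -/
def zPow (e : OpenPartialHomeomorph X X) : ℤ → OpenPartialHomeomorph X X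
  | Int.ofNat n => natPow e n
  | Int.negSucc n => (natPow e (n + 1)).symm

theorem zPow_neg (e : OpenPartialHomeomorph X X) (k : ℤ) : zPow e (-k) = (zPow e k).symm := by
  rcases k with (_ | n) | n
  · exact (OpenPartialHomeomorph.refl_symm (X := X)).symm
  · rfl
  · exact ((natPow e (n + 1)).symm_symm).symm

theorem zPow_neg_target (e : OpenPartialHomeomorph X X) (k : ℤ) :
    (zPow e (-k)).target = (zPow e k).source := by
  rw [zPow_neg]; rfl

theorem zPow_target (e : OpenPartialHomeomorph X X) (k : ℤ) :
    (zPow e k).target = (zPow e (-k)).source := by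
  rw [zPow_neg]; rfl

theorem zPow_neg_apply (e : OpenPartialHomeomorph X X) (k : ℤ) {x : X}
    (hx : x ∈ (zPow e k).source) : zPow e (-k) (zPow e k x) = x := by
  rw [zPow_neg]; exact (zPow e k).left_inv hx

theorem zPow_mem (e : OpenPartialHomeomorph X X) (k : ℤ) {x : X}
    (hx : x ∈ (zPow e k).source) : zPow e k x ∈ (zPow e (-k)).source := by
  rw [← zPow_target]; exact (zPow e k).map_source hx

/-- The relation `x ∈ dom (e ^ k)` and `e ^ k x = y`. -/
def Rel (e : OpenPartialHomeomorph X X) (k : ℤ) (x y : X) : Prop :=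
  x ∈ (zPow e k).source ∧ zPow e k x = y

theorem Rel.symm {e : OpenPartialHomeomorph X X} {k : ℤ} {x y : X} (h : Rel e k x y) :
    Rel e (-k) y x := by
  obtain ⟨h1, rfl⟩ := h
  exact ⟨zPow_mem e k h1, zPow_neg_apply e k h1⟩

theorem rel_natPow_succ (e : OpenPartialHomeomorph X X) (n : ℕ) (x z : X) :
    Rel e (n + 1) x z ↔ ∃ y, Rel e n x y ∧ y ∈ e.source ∧ e y = z := by
  change (x ∈ (natPow e (n + 1)).source ∧ natPow e (n + 1) x = z) ↔
    ∃ y, (x ∈ (natPow e n).source ∧ natPow e n x = y) ∧ y ∈ e.source ∧ e y = z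
  simp only [natPow, OpenPartialHomeomorph.trans_source, Set.mem_inter_iff, Set.mem_preimage,
    OpenPartialHomeomorph.coe_trans, Function.comp_apply]
  constructor
  · rintro ⟨⟨h1, h2⟩, h3⟩
    exact ⟨_, ⟨h1, rfl⟩, h2, h3⟩
  · rintro ⟨y, ⟨h1, rfl⟩, h2, h3⟩
    exact ⟨⟨h1, h2⟩, h3⟩

theorem rel_zero (e : OpenPartialHomeomorph X X) (x z : X) : Rel e 0 x z ↔ x = z :=
  ⟨fun h => h.2, fun h => ⟨trivial, h⟩⟩

theorem rel_one (e : OpenPartialHomeomorph X X) (x z : X) :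
    Rel e 1 x z ↔ x ∈ e.source ∧ e x = z := by
  have := rel_natPow_succ e 0 x z
  simp only [Nat.cast_zero, zero_add, rel_zero] at this
  rw [this]; exact ⟨by rintro ⟨y, rfl, h⟩; exact h, fun h => ⟨x, rfl, h⟩⟩

theorem Rel.inj_left {e : OpenPartialHomeomorph X X} {k : ℤ} {x x' y : X} (h : Rel e k x y)
    (h' : Rel e k x' y) : x = x' := by
  have h1 := h.symm.2
  have h2 := h'.symm.2
  rw [← h1, ← h2]

theorem Rel.unique {e : OpenPartialHomeomorph X X} {k : ℤ} {x y y' : X} (h : Rel e k x y)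
    (h' : Rel e k x y') : y = y' := h.2.symm.trans h'.2

theorem rel_natPow_succ' (e : OpenPartialHomeomorph X X) (n : ℕ) (x z : X) :
    Rel e (n + 1) x z ↔ ∃ y, Rel e 1 x y ∧ Rel e n y z := by
  induction n generalizing z with
  | zero => simp [rel_zero]
  | succ n ih =>
    rw [rel_natPow_succ]
    push_cast
    simp only [ih, rel_natPow_succ]
    constructor
    · rintro ⟨y, ⟨w, h1, h2⟩, h3⟩
      exact ⟨w, h1, y, h2, h3⟩
    · rintro ⟨w, h1, y, h2, h3⟩
      exact ⟨y, ⟨w, h1, h2⟩, h3⟩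

theorem Rel.add_one {e : OpenPartialHomeomorph X X} {k : ℤ} {x y z : X} (h : Rel e k x y)
    (h' : Rel e 1 y z) : Rel e (k + 1) x z := by
  rcases k with n | n
  · rw [rel_one] at h'
    exact (rel_natPow_succ e n x z).2 ⟨y, h, h'⟩
  · have h2 := h.symm
    rw [show -(Int.negSucc n) = ((n : ℤ) + 1) by simp [Int.negSucc_eq], rel_natPow_succ'] at h2
    obtain ⟨w, hw, hw2⟩ := h2
    rw [hw.unique h'] at hw2
    rw [show Int.negSucc n + 1 = -(n : ℤ) by simp [Int.negSucc_eq]]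
    exact hw2.symm

theorem Rel.add_neg_one {e : OpenPartialHomeomorph X X} {k : ℤ} {x y z : X} (h : Rel e k x y)
    (h' : Rel e 1 z y) : Rel e (k - 1) x z := by
  rcases k with (_ | n) | n
  · have hxy : x = y := (rel_zero e x y).1 h
    subst hxy
    exact h'.symm
  · obtain ⟨w, hw, hw2⟩ := (rel_natPow_succ e n x y).1 h
    rw [← rel_one] at hw2
    rw [hw2.inj_left h'] at hw
    have h3 : Int.ofNat (n + 1) - 1 = (n : ℤ) := by simp
    rw [h3]; exact hw
  · have h2 := h.symm
    rw [show -(Int.negSucc n) = ((n + 1 : ℕ) : ℤ) by simp [Int.negSucc_eq]] at h2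
    have h3 := ((rel_natPow_succ' e (n + 1) z x).2 ⟨y, h', h2⟩).symm
    have h4 : Int.negSucc n - 1 = -(((n + 1 : ℕ) : ℤ) + 1) := by
      simp only [Int.negSucc_eq]; push_cast; ring
    rw [h4]; exact h3

theorem Rel.add {e : OpenPartialHomeomorph X X} {k l : ℤ} {x y z : X} (h : Rel e k x y)
    (h' : Rel e l y z) : Rel e (k + l) x z := by
  rcases Int.eq_nat_or_neg l with ⟨n, rfl | rfl⟩
  · induction n generalizing z with
    | zero =>
      have := (rel_zero e y z).1 h'
      subst this; simpa using h
    | succ n ih =>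
      push_cast at h'
      obtain ⟨w, hw, hw2⟩ := (rel_natPow_succ e n y z).1 h'
      rw [← rel_one] at hw2
      have := (ih hw).add_one hw2
      rw [show k + ((n + 1 : ℕ) : ℤ) = k + n + 1 by push_cast; ring]; exact this
  · induction n generalizing z with
    | zero =>
      have := (rel_zero e y z).1 h'
      subst this; simpa using h
    | succ n ih =>
      have h2 := h'.symm
      rw [neg_neg] at h2
      push_cast at h2
      obtain ⟨w, hw, hw2⟩ := (rel_natPow_succ' e n z y).1 h2
      have := (ih hw2.symm).add_neg_one hw
      rw [show k + -((n + 1 : ℕ) : ℤ) = k + -n - 1 by push_cast; ring]; exact this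

/-- `N_k`, identified with the ideal `C₀(H^{(k)})` of `C₀(H)` via `s^k f ↔ f`. -/
def N (e : OpenPartialHomeomorph X X) (k : ℤ) : Submodule ℂ C₀(X, ℂ) where
  carrier := {f | ∀ x, x ∉ (zPow e k).source → f x = 0}
  add_mem' := fun {f g} hf hg x hx => by simp [hf x hx, hg x hx]
  zero_mem' := fun x _ => rfl
  smul_mem' := fun c f hf x hx => by simp [hf x hx]


theorem isCompact_le_norm (f : C₀(X, ℂ)) {ε : ℝ} (hε : 0 < ε) : IsCompact {y | ε ≤ ‖f y‖} := by
  have h := f.zero_at_infty'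
  have h2 : ∀ᶠ y in Filter.cocompact X, ‖f y‖ < ε := by
    have := (tendsto_zero_iff_norm_tendsto_zero.1 h).eventually (gt_mem_nhds hε)
    exact this
  obtain ⟨K, hK, hK2⟩ := Filter.mem_cocompact.1 h2
  refine hK.of_isClosed_subset ?_ fun y hy => ?_
  · exact isClosed_le continuous_const (f.continuous.norm)
  · by_contra hyK
    exact absurd (show ‖f y‖ < ε from hK2 hyK) (not_lt.2 hy)

open Classical in
theorem isCompact_le_norm_pull (e : OpenPartialHomeomorph X X) (f : C₀(X, ℂ))
    (hf : ∀ x, x ∉ e.target → f x = 0) {ε : ℝ} (hε : 0 < ε) :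
    IsCompact {x | ε ≤ ‖(if x ∈ e.source then f (e x) else 0 : ℂ)‖} := by
  have h : {x | ε ≤ ‖(if x ∈ e.source then f (e x) else 0 : ℂ)‖} =
      e.symm '' {y | ε ≤ ‖f y‖} := by
    ext x
    simp only [Set.mem_ofPred_eq, Set.mem_image]
    constructor
    · intro hx
      by_cases hs : x ∈ e.source
      · rw [if_pos hs] at hx
        exact ⟨e x, hx, e.left_inv hs⟩
      · rw [if_neg hs, norm_zero] at hx
        exact absurd hx (not_le.2 hε)
    · rintro ⟨y, hy, rfl⟩
      have hyt : y ∈ e.target := by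
        by_contra hyt
        rw [hf y hyt, norm_zero] at hy
        exact absurd hy (not_le.2 hε)
      rw [if_pos (e.map_target hyt), e.right_inv hyt]
      exact hy
  rw [h]
  refine (isCompact_le_norm f hε).image_of_continuousOn (e.continuousOn_symm.mono fun y hy => ?_)
  by_contra hyt
  simp only [Set.mem_ofPred_eq] at hy
  rw [hf y hyt, norm_zero] at hy
  exact absurd hy (not_le.2 hε)

variable [T2Space X]

open Classical in
/-- For `f ∈ C₀(e.target)`, the function `f ∘ e` on `e.source` extended by zero. -/
noncomputable def pull (e : OpenPartialHomeomorph X X) (f : C₀(X, ℂ))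
    (hf : ∀ x, x ∉ e.target → f x = 0) : C₀(X, ℂ) where
  toFun x := if x ∈ e.source then f (e x) else 0
  continuous_toFun := by
    rw [continuous_iff_continuousAt]
    intro x
    by_cases hx : x ∈ e.source
    · have h1 : ContinuousAt (fun x => f (e x)) x :=
        f.continuous.continuousAt.comp (e.continuousAt hx)
      refine h1.congr ?_
      filter_upwards [e.open_source.mem_nhds hx] with y hy
      rw [if_pos hy]
    · rw [ContinuousAt, if_neg hx, tendsto_zero_iff_norm_tendsto_zero, Metric.tendsto_nhds]
      intro ε hε
      have h2 := (isCompact_le_norm_pull e f hf hε).isClosed.isOpen_compl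
      filter_upwards [h2.mem_nhds (x := x) (by simp [hx, hε])] with y hy
      rw [Real.dist_0_eq_abs, abs_norm]
      simpa using hy
  zero_at_infty' := by
    rw [tendsto_zero_iff_norm_tendsto_zero, Metric.tendsto_nhds]
    intro ε hε
    filter_upwards [(isCompact_le_norm_pull e f hf hε).compl_mem_cocompact] with y hy
    rw [Real.dist_0_eq_abs, abs_norm]
    simpa using hy

open Classical in
theorem pull_apply (e : OpenPartialHomeomorph X X) (f : C₀(X, ℂ))
    (hf : ∀ x, x ∉ e.target → f x = 0) (x : X) :
    pull e f hf x = if x ∈ e.source then f (e x) else 0 := rfl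

/-- `θ^k : C₀(H^{(-k)}) → C₀(H^{(k)})`, `f ↦ f ∘ θ^k`. -/
noncomputable def shift (e : OpenPartialHomeomorph X X) (k : ℤ) (f : C₀(X, ℂ))
    (hf : f ∈ N e (-k)) : C₀(X, ℂ) :=
  pull (zPow e k) f fun x hx => hf x (by rwa [zPow_target] at hx)

open Classical in
theorem shift_apply (e : OpenPartialHomeomorph X X) (k : ℤ) (f : C₀(X, ℂ))
    (hf : f ∈ N e (-k)) (x : X) :
    shift e k f hf x = if x ∈ (zPow e k).source then f (zPow e k x) else 0 := rfl

theorem shift_mem (e : OpenPartialHomeomorph X X) (k : ℤ) (f : C₀(X, ℂ))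
    (hf : f ∈ N e (-k)) : shift e k f hf ∈ N e k := fun x hx => by
  rw [shift_apply, if_neg hx]

theorem mul_shift_mem {e : OpenPartialHomeomorph X X} {k l : ℤ} (f : N e k) (g : N e l) :
    (f : C₀(X, ℂ)) * shift e (-l) g (by rw [neg_neg]; exact g.2) ∈ N e (-l) := fun x hx => by
  rw [ZeroAtInftyContinuousMap.mul_apply, shift_mem e (-l) _ _ x hx, mul_zero]

/-- The product `(s^k f)(s^l g) = s^{k+l} θ^l(f θ^{-l}(g))`. -/
noncomputable def mulN {e : OpenPartialHomeomorph X X} {k l : ℤ} (f : N e k) (g : N e l) :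
    N e (k + l) :=
  ⟨shift e l (f * shift e (-l) g (by rw [neg_neg]; exact g.2)) (mul_shift_mem f g), fun x hx => by
    rw [shift_apply]
    split_ifs with h
    · by_cases h2 : zPow e l x ∈ (zPow e k).source
      · have h3 : Rel e l x (zPow e l x) := ⟨h, rfl⟩
        have h4 := h3.add (⟨h2, rfl⟩ : Rel e k _ _)
        rw [add_comm] at h4
        exact absurd h4.1 hx
      · rw [ZeroAtInftyContinuousMap.mul_apply, f.2 _ h2, zero_mul]
    · rfl⟩

open Classical in
theorem mulN_apply {e : OpenPartialHomeomorph X X} {k l : ℤ} (f : N e k) (g : N e l) (x : X) :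
    (mulN f g : C₀(X, ℂ)) x =
      if x ∈ (zPow e l).source then (f : C₀(X, ℂ)) (zPow e l x) * (g : C₀(X, ℂ)) x else 0 := by
  change shift e l _ (mul_shift_mem f g) x = _
  rw [shift_apply]
  split_ifs with h
  · rw [ZeroAtInftyContinuousMap.mul_apply, shift_apply, if_pos (zPow_mem e l h),
      zPow_neg_apply e l h]
  · rfl

/-- The involution `(s^k f)^* = s^{-k} θ^{-k}(f^*)`. -/
noncomputable def starN {e : OpenPartialHomeomorph X X} {k : ℤ} (f : N e k) : N e (-k) :=
  ⟨shift e (-k) (star (f : C₀(X, ℂ))) (fun x hx => by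
    rw [neg_neg] at hx
    rw [ZeroAtInftyContinuousMap.star_apply, f.2 x hx, star_zero]), shift_mem _ _ _ _⟩

open Classical in
theorem starN_apply {e : OpenPartialHomeomorph X X} {k : ℤ} (f : N e k) (x : X) :
    (starN f : C₀(X, ℂ)) x =
      if x ∈ (zPow e (-k)).source then star ((f : C₀(X, ℂ)) (zPow e (-k) x)) else 0 := rfl

/-- The element `f = s^0 f` of `N_0`. -/
noncomputable def toN0 (e : OpenPartialHomeomorph X X) (f : C₀(X, ℂ)) : N e 0 :=
  ⟨f, fun _ hx => absurd trivial hx⟩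

/-- The element `g` of `N_1`, for `g ∈ C₀(H^{(1)})`. -/
noncomputable def toN1 (e : OpenPartialHomeomorph X X) (g : C₀(X, ℂ)) (hg : ∀ x, x ∉ e.source → g x = 0) :
    N e 1 :=
  ⟨g, fun x hx => hg x fun h => hx ((rel_one e x (e x)).2 ⟨h, rfl⟩).1⟩

/-- Bounded operators on the separable infinite dimensional Hilbert space `ℓ²(ℕ)`. -/
abbrev Bop : Type := lp (fun _ : ℕ => ℂ) 2 →L[ℂ] lp (fun _ : ℕ => ℂ) 2

/-- A (possibly degenerate) `*`-representation on `ℓ²(ℕ)` of the `*`-algebra `⊕_k N_k`. Every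
`*`-representation on a separable Hilbert space is, up to adding a zero representation,
unitarily equivalent to such a one. -/
structure Rep (e : OpenPartialHomeomorph X X) where
  toFun : ∀ k : ℤ, N e k →ₗ[ℂ] Bop
  map_mul : ∀ (k l : ℤ) (f : N e k) (g : N e l), toFun k f * toFun l g = toFun (k + l) (mulN f g)
  map_star : ∀ (k : ℤ) (f : N e k), star (toFun k f) = toFun (-k) (starN f)

theorem Rep.congr {e : OpenPartialHomeomorph X X} (ρ : Rep e) {k l : ℤ} (h : k = l) (f : N e k)
    (g : N e l) (hfg : ∀ x, (f : C₀(X, ℂ)) x = (g : C₀(X, ℂ)) x) : ρ.toFun k f = ρ.toFun l g := by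
  subst h
  have : f = g := Subtype.ext (ZeroAtInftyContinuousMap.ext hfg)
  rw [this]

/-- The restriction of a representation to `C₀(H) = N_0`. -/
noncomputable def Rep.zeroHom {e : OpenPartialHomeomorph X X} (ρ : Rep e) :
    C₀(X, ℂ) →⋆ₙₐ[ℂ] Bop where
  toFun f := ρ.toFun 0 (toN0 e f)
  map_smul' c f := (ρ.toFun 0).map_smul c (toN0 e f)
  map_zero' := (ρ.toFun 0).map_zero
  map_add' f g := (ρ.toFun 0).map_add (toN0 e f) (toN0 e g)
  map_mul' f g := by
    rw [ρ.map_mul]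
    refine ρ.congr (by norm_num) _ _ fun x => ?_
    rw [mulN_apply]
    exact (if_pos trivial).symm
  map_star' f := by
    rw [ρ.map_star]
    refine ρ.congr (by norm_num) _ _ fun x => ?_
    rw [starN_apply]
    exact (if_pos trivial).symm

theorem mulN_starN_apply {e : OpenPartialHomeomorph X X} {k : ℤ} (f g : N e k) (x : X) :
    (mulN (starN f) g : C₀(X, ℂ)) x = star ((f : C₀(X, ℂ)) x) * (g : C₀(X, ℂ)) x := by
  rw [mulN_apply]
  split_ifs with h
  · rw [starN_apply, if_pos (zPow_mem e k h), zPow_neg_apply e k h]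
  · rw [g.2 x h, mul_zero]

theorem Rep.norm_le {e : OpenPartialHomeomorph X X} (ρ : Rep e) (k : ℤ) (f : N e k) :
    ‖ρ.toFun k f‖ ≤ ‖f‖ := by
  have h1 : star (ρ.toFun k f) * ρ.toFun k f =
      ρ.zeroHom (star (f : C₀(X, ℂ)) * (f : C₀(X, ℂ))) := by
    rw [ρ.map_star, ρ.map_mul]
    exact ρ.congr (neg_add_cancel k) _ _ fun x => mulN_starN_apply f f x
  have h2 : ‖ρ.toFun k f‖ * ‖ρ.toFun k f‖ ≤ ‖(f : C₀(X, ℂ))‖ * ‖(f : C₀(X, ℂ))‖ := by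
    rw [← CStarRing.norm_star_mul_self, h1, ← CStarRing.norm_star_mul_self]
    exact NonUnitalStarAlgHom.norm_apply_le _ _
  exact nonneg_le_nonneg_of_sq_le_sq (norm_nonneg (f : C₀(X, ℂ))) h2

/-- Bounded families of operators indexed by all representations of `⊕_k N_k`. -/
def Amb (e : OpenPartialHomeomorph X X) : Type := lp (fun _ : Rep e => Bop) ∞

noncomputable instance (e : OpenPartialHomeomorph X X) : NonUnitalCStarAlgebra (Amb e) :=
  inferInstanceAs (NonUnitalCStarAlgebra (lp (fun _ : Rep e => Bop) ∞))

/-- The image `(ρ(s^k f))_ρ` of `s^k f ∈ N_k`. -/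
noncomputable def symAmb (e : OpenPartialHomeomorph X X) (k : ℤ) : N e k →ₗ[ℂ] Amb e where
  toFun f := (⟨fun ρ => ρ.toFun k f, memℓp_infty ⟨‖f‖, by
    rintro _ ⟨ρ, rfl⟩; exact ρ.norm_le k f⟩⟩ : lp (fun _ : Rep e => Bop) ∞)
  map_add' f g := Subtype.ext (funext fun ρ => (ρ.toFun k).map_add f g)
  map_smul' c f := Subtype.ext (funext fun ρ => (ρ.toFun k).map_smul c f)

/-- The C*-algebra generated by the elements `(ρ(s^k f))_ρ`. -/
noncomputable def crossedSubalgebra (e : OpenPartialHomeomorph X X) :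
    NonUnitalStarSubalgebra ℂ (Amb e) :=
  (NonUnitalStarAlgebra.adjoin ℂ (⋃ k : ℤ, Set.range (symAmb e k))).topologicalClosure

/-- The crossed product `C₀(H) ⋊ ℤ`: the universal C*-envelope of `⊕_k N_k`, i.e. the completion
for the norm `sup_ρ ‖ρ(x)‖`, `ρ` running over all `*`-representations of `⊕_k N_k`. -/
def CrossedProduct (e : OpenPartialHomeomorph X X) : Type := crossedSubalgebra e

noncomputable instance (e : OpenPartialHomeomorph X X) :
    NonUnitalCStarAlgebra (CrossedProduct e) :=
  NonUnitalStarSubalgebra.nonUnitalCStarAlgebra (crossedSubalgebra e)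
    (h_closed := NonUnitalStarSubalgebra.isClosed_topologicalClosure _)

/-- The element `s^k f` of the crossed product. -/
noncomputable def sym (e : OpenPartialHomeomorph X X) (k : ℤ) :
    N e k →ₗ[ℂ] CrossedProduct e where
  toFun f := (⟨symAmb e k f, NonUnitalStarSubalgebra.le_topologicalClosure _
    (NonUnitalStarAlgebra.subset_adjoin _ _ (Set.mem_iUnion.2 ⟨k, f, rfl⟩))⟩ : crossedSubalgebra e)
  map_add' f g := Subtype.ext ((symAmb e k).map_add f g)
  map_smul' c f := Subtype.ext ((symAmb e k).map_smul c f)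

theorem sym_mul (e : OpenPartialHomeomorph X X) (k l : ℤ) (f : N e k) (g : N e l) :
    sym e k f * sym e l g = sym e (k + l) (mulN f g) :=
  Subtype.ext (Subtype.ext (funext fun ρ => ρ.map_mul k l f g))

theorem star_sym (e : OpenPartialHomeomorph X X) (k : ℤ) (f : N e k) :
    star (sym e k f) = sym e (-k) (starN f) :=
  Subtype.ext (Subtype.ext (funext fun ρ => ρ.map_star k f))

/-- The algebraic direct sum `⊕_k N_k`. -/
def SymAlg (e : OpenPartialHomeomorph X X) : Type := Π₀ k : ℤ, N e k

noncomputable instance (e : OpenPartialHomeomorph X X) : AddCommMonoid (SymAlg e) :=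
  inferInstanceAs (AddCommMonoid (Π₀ k : ℤ, N e k))

noncomputable instance (e : OpenPartialHomeomorph X X) : Module ℂ (SymAlg e) :=
  inferInstanceAs (Module ℂ (Π₀ k : ℤ, N e k))

noncomputable instance (e : OpenPartialHomeomorph X X) : AddCommGroup (SymAlg e) :=
  Module.addCommMonoidToAddCommGroup ℂ

/-- The element `s^k f` of `⊕_k N_k`. -/
noncomputable def SymAlg.single {e : OpenPartialHomeomorph X X} (k : ℤ) (f : N e k) : SymAlg e :=
  DFinsupp.single k f

/-- The linear map from `⊕_k N_k` to the crossed product. -/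
noncomputable def symSum (e : OpenPartialHomeomorph X X) :
    SymAlg e →ₗ[ℂ] CrossedProduct e :=
  (DFinsupp.lsum ℂ fun k => sym e k : (Π₀ k : ℤ, N e k) →ₗ[ℂ] CrossedProduct e)

theorem symSum_single (e : OpenPartialHomeomorph X X) (k : ℤ) (f : N e k) :
    symSum e (SymAlg.single k f) = sym e k f :=
  DFinsupp.lsum_single _ _ _ _

theorem dfinsupp_induction {e : OpenPartialHomeomorph X X} {P : (SymAlg e) → Prop}
    (x : SymAlg e) (zero : P 0) (add : ∀ x y, P x → P y → P (x + y))
    (single : ∀ k f, P (SymAlg.single k f)) : P x := by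
  induction x using DFinsupp.induction with
  | h0 => exact zero
  | ha i b f _ _ hf => exact add _ _ (single i b) hf

theorem symSum_mul (e : OpenPartialHomeomorph X X) (x y : SymAlg e) :
    ∃ z, symSum e z = symSum e x * symSum e y := by
  induction x using dfinsupp_induction with
  | zero => exact ⟨0, by rw [map_zero, zero_mul]⟩
  | add x x' hx hx' =>
    obtain ⟨z, hz⟩ := hx
    obtain ⟨z', hz'⟩ := hx'
    exact ⟨z + z', by rw [map_add, map_add, hz, hz', add_mul]⟩
  | single k f =>
    induction y using dfinsupp_induction with
    | zero => exact ⟨0, by rw [map_zero, mul_zero]⟩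
    | add x x' hx hx' =>
      obtain ⟨z, hz⟩ := hx
      obtain ⟨z', hz'⟩ := hx'
      exact ⟨z + z', by rw [map_add, map_add, hz, hz', mul_add]⟩
    | single l g =>
      exact ⟨SymAlg.single (k + l) (mulN f g), by
        rw [symSum_single, symSum_single, symSum_single, sym_mul]⟩

theorem symSum_star (e : OpenPartialHomeomorph X X) (x : SymAlg e) :
    ∃ z, symSum e z = star (symSum e x) := by
  induction x using dfinsupp_induction with
  | zero => exact ⟨0, by rw [map_zero, star_zero]⟩
  | add x x' hx hx' =>
    obtain ⟨z, hz⟩ := hx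
    obtain ⟨z', hz'⟩ := hx'
    exact ⟨z + z', by rw [map_add, map_add, hz, hz', star_add]⟩
  | single k f =>
    exact ⟨SymAlg.single (-k) (starN f), by rw [symSum_single, symSum_single, star_sym]⟩

theorem denseRange_symSum (e : OpenPartialHomeomorph X X) : DenseRange (symSum e) := by
  have key : ∀ a ∈ NonUnitalStarAlgebra.adjoin ℂ (⋃ k : ℤ, Set.range (symAmb e k)),
      ∃ x, (show crossedSubalgebra e from symSum e x).1 = a := by
    intro a ha
    induction ha using NonUnitalStarAlgebra.adjoin_induction with
    | mem a ha =>
      obtain ⟨k, f, rfl⟩ := Set.mem_iUnion.1 ha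
      exact ⟨SymAlg.single k f, by rw [symSum_single]; rfl⟩
    | add a b _ _ ha hb =>
      obtain ⟨x, rfl⟩ := ha
      obtain ⟨y, rfl⟩ := hb
      exact ⟨x + y, by rw [map_add]; rfl⟩
    | zero => exact ⟨0, by rw [map_zero]; rfl⟩
    | mul a b _ _ ha hb =>
      obtain ⟨x, rfl⟩ := ha
      obtain ⟨y, rfl⟩ := hb
      obtain ⟨z, hz⟩ := symSum_mul e x y
      exact ⟨z, by rw [hz]; rfl⟩
    | smul c a _ ha =>
      obtain ⟨x, rfl⟩ := ha
      exact ⟨c • x, by rw [map_smul]; rfl⟩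
    | star a _ ha =>
      obtain ⟨x, rfl⟩ := ha
      obtain ⟨z, hz⟩ := symSum_star e x
      exact ⟨z, by rw [hz]; rfl⟩
  intro y
  refine Metric.mem_closure_iff.2 fun ε hε => ?_
  obtain ⟨a, ha, hy⟩ := Metric.mem_closure_iff.1 (show (show crossedSubalgebra e from y).1 ∈
    closure ((NonUnitalStarAlgebra.adjoin ℂ (⋃ k : ℤ, Set.range (symAmb e k)) : Set (Amb e)))
    from (show crossedSubalgebra e from y).2) ε hε
  obtain ⟨x, rfl⟩ := key a ha
  exact ⟨_, ⟨x, rfl⟩, hy⟩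

/-- Multiplication by a bounded continuous function on `N_k`. -/
noncomputable def bmul {e : OpenPartialHomeomorph X X} (c : BoundedContinuousFunction X ℂ)
    (k : ℤ) : N e k →ₗ[ℂ] N e k where
  toFun f := ⟨⟨⟨fun x => c x * (f : C₀(X, ℂ)) x, by fun_prop⟩, by
    refine squeeze_zero_norm (a := fun x => ‖c‖ * ‖(f : C₀(X, ℂ)) x‖) (fun x => ?_) ?_
    · simp only [norm_mul]
      exact mul_le_mul_of_nonneg_right (c.norm_coe_le_norm x) (norm_nonneg _)
    · have := (tendsto_zero_iff_norm_tendsto_zero.1 (f : C₀(X, ℂ)).zero_at_infty').const_mul ‖c‖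
      simpa using this⟩, fun x hx => by
      change c x * (f : C₀(X, ℂ)) x = 0
      rw [f.2 x hx, mul_zero]⟩
  map_add' f g := Subtype.ext (ZeroAtInftyContinuousMap.ext fun x => mul_add _ _ _)
  map_smul' a f := Subtype.ext (ZeroAtInftyContinuousMap.ext fun x => mul_left_comm _ _ _)

/-- The bounded function `φ ∘ p` for `φ ∈ C₀(Y)`. -/
noncomputable def baseFun {Y : Type} [TopologicalSpace Y] (p : C(X, Y)) (φ : C₀(Y, ℂ)) :
    BoundedContinuousFunction X ℂ :=
  φ.toBCF.compContinuous p

/-- The map `Σ s^k f_k ↦ Σ s^k ((φ ∘ p) f_k)` on `⊕_k N_k`. -/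
noncomputable def bmulSum {e : OpenPartialHomeomorph X X} (c : BoundedContinuousFunction X ℂ) :
    SymAlg e →ₗ[ℂ] SymAlg e :=
  (DFinsupp.mapRange.linearMap fun k => bmul c k : (Π₀ k : ℤ, N e k) →ₗ[ℂ] (Π₀ k : ℤ, N e k))

theorem bmul_apply {e : OpenPartialHomeomorph X X} (c : BoundedContinuousFunction X ℂ) {k : ℤ}
    (f : N e k) (x : X) : (bmul c k f : C₀(X, ℂ)) x = c x * (f : C₀(X, ℂ)) x := rfl

theorem bmulSum_single {e : OpenPartialHomeomorph X X} (c : BoundedContinuousFunction X ℂ)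
    (k : ℤ) (f : N e k) : bmulSum c (SymAlg.single k f) = SymAlg.single k (bmul c k f) :=
  DFinsupp.mapRange_single (hf := fun k => (bmul c k).map_zero)

theorem Rel.inv {e : OpenPartialHomeomorph X X} {Z : Type} {c : X → Z}
    (hc : ∀ x ∈ e.source, c (e x) = c x) {k : ℤ} {x y : X} (h : Rel e k x y) : c y = c x := by
  have key : ∀ (n : ℕ) (x y : X), Rel e n x y → c y = c x := by
    intro n
    induction n with
    | zero => intro x y h; rw [(rel_zero e x y).1 h]
    | succ n ih =>
      intro x y h
      obtain ⟨w, hw, hw1, rfl⟩ := (rel_natPow_succ e n x y).1 h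
      rw [hc w hw1, ih x w hw]
  rcases Int.eq_nat_or_neg k with ⟨n, rfl | rfl⟩
  · exact key n x y h
  · have := h.symm
    rw [neg_neg] at this
    exact (key n y x this).symm

/-- The representation of `⊕_k N_k` given by `ρ`. -/
noncomputable def Rep.sum {e : OpenPartialHomeomorph X X} (ρ : Rep e) : SymAlg e →ₗ[ℂ] Bop :=
  (DFinsupp.lsum ℂ fun k => ρ.toFun k : (Π₀ k : ℤ, N e k) →ₗ[ℂ] Bop)

theorem Rep.sum_single {e : OpenPartialHomeomorph X X} (ρ : Rep e) (k : ℤ) (f : N e k) :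
    ρ.sum (SymAlg.single k f) = ρ.toFun k f :=
  DFinsupp.lsum_single _ _ _ _

/-- The component of an element of the crossed product in the representation `ρ`. -/
noncomputable def Rep.eval {e : OpenPartialHomeomorph X X} (ρ : Rep e) (a : CrossedProduct e) :
    Bop :=
  (show lp (fun _ : Rep e => Bop) ∞ from (show crossedSubalgebra e from a).1).1 ρ

theorem Rep.eval_symSum {e : OpenPartialHomeomorph X X} (ρ : Rep e) (x : SymAlg e) :
    ρ.eval (symSum e x) = ρ.sum x := by
  induction x using dfinsupp_induction with
  | zero => rw [map_zero, map_zero]; rfl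
  | add x y hx hy => rw [map_add, map_add, ← hx, ← hy]; rfl
  | single k f => rw [symSum_single, Rep.sum_single]; rfl

theorem norm_le_of_eval {e : OpenPartialHomeomorph X X} (a : CrossedProduct e) {C : ℝ}
    (hC : 0 ≤ C) (h : ∀ ρ : Rep e, ‖ρ.eval a‖ ≤ C) : ‖a‖ ≤ C :=
  lp.norm_le_of_forall_le (E := fun _ : Rep e => Bop) hC h

theorem Rep.norm_eval_le {e : OpenPartialHomeomorph X X} (ρ : Rep e) (a : CrossedProduct e) :
    ‖ρ.eval a‖ ≤ ‖a‖ :=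
  lp.norm_apply_le_norm (E := fun _ : Rep e => Bop) ENNReal.top_ne_zero _ ρ

theorem Rep.bmul_identity {e : OpenPartialHomeomorph X X} (ρ : Rep e)
    (c d : BoundedContinuousFunction X ℂ) (hc : ∀ x ∈ e.source, c (e x) = c x)
    (hd : ∀ x ∈ e.source, d (e x) = d x) (M : ℂ)
    (hcd : ∀ x, star (c x) * c x + star (d x) * d x = M) (x y : SymAlg e) :
    star (ρ.sum (bmulSum c x)) * ρ.sum (bmulSum c y) +
      star (ρ.sum (bmulSum d x)) * ρ.sum (bmulSum d y) = M • (star (ρ.sum x) * ρ.sum y) := by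
  induction x using dfinsupp_induction with
  | zero => simp only [map_zero, star_zero, zero_mul, add_zero, smul_zero]
  | add x x' hx hx' =>
    simp only [map_add, star_add, add_mul, smul_add]
    rw [← hx, ← hx']; abel
  | single k f =>
    induction y using dfinsupp_induction with
    | zero => simp only [map_zero, mul_zero, add_zero, smul_zero]
    | add x x' hx hx' =>
      simp only [map_add, mul_add, smul_add]
      rw [← hx, ← hx']; abel
    | single l g =>
      simp only [bmulSum_single, Rep.sum_single, ρ.map_star, ρ.map_mul]
      rw [← map_add, ← map_smul]
      refine ρ.congr rfl _ _ fun x => ?_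
      change (mulN (starN (bmul c k f)) (bmul c l g) : C₀(X, ℂ)) x +
        (mulN (starN (bmul d k f)) (bmul d l g) : C₀(X, ℂ)) x =
        M * (mulN (starN f) g : C₀(X, ℂ)) x
      simp only [mulN_apply, starN_apply, bmul_apply]
      split_ifs with h1 h2
      · have h3 : Rel e (l + -k) x _ := Rel.add ⟨h1, rfl⟩ ⟨h2, rfl⟩
        rw [h3.inv hc, h3.inv hd, ← hcd x, star_mul, star_mul]
        ring
      · simp
      · simp

theorem norm_symSum_bmulSum_le {e : OpenPartialHomeomorph X X}
    (c : BoundedContinuousFunction X ℂ) (hc : ∀ x ∈ e.source, c (e x) = c x) (x : SymAlg e) :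
    ‖symSum e (bmulSum c x)‖ ≤ ‖c‖ * ‖symSum e x‖ := by
  let d : BoundedContinuousFunction X ℂ := BoundedContinuousFunction.ofNormedAddCommGroup
    (fun x => ((Real.sqrt (‖c‖ ^ 2 - ‖c x‖ ^ 2) : ℝ) : ℂ)) (by fun_prop) ‖c‖ (fun x => by
      rw [Complex.norm_real, Real.norm_of_nonneg (Real.sqrt_nonneg _)]
      exact Real.sqrt_le_iff.2 ⟨norm_nonneg _, by nlinarith [sq_nonneg ‖c x‖]⟩)
  have hd : ∀ x ∈ e.source, d (e x) = d x := fun x hx => by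
    change ((Real.sqrt (‖c‖ ^ 2 - ‖c (e x)‖ ^ 2) : ℝ) : ℂ) = _
    rw [hc x hx]; rfl
  have hcd : ∀ x, star (c x) * c x + star (d x) * d x = ((‖c‖ ^ 2 : ℝ) : ℂ) := fun x => by
    have h0 : 0 ≤ ‖c‖ ^ 2 - ‖c x‖ ^ 2 := by
      have := c.norm_coe_le_norm x
      nlinarith [norm_nonneg (c x)]
    have h1 : star (d x) * d x = ((‖c‖ ^ 2 - ‖c x‖ ^ 2 : ℝ) : ℂ) := by
      change star ((Real.sqrt (‖c‖ ^ 2 - ‖c x‖ ^ 2) : ℝ) : ℂ) *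
        ((Real.sqrt (‖c‖ ^ 2 - ‖c x‖ ^ 2) : ℝ) : ℂ) = _
      rw [Complex.star_def, Complex.conj_ofReal, ← Complex.ofReal_mul, Real.mul_self_sqrt h0]
    rw [h1, Complex.star_def, Complex.conj_mul']
    push_cast; ring
  refine norm_le_of_eval _ (by positivity) fun ρ => ?_
  rw [Rep.eval_symSum]
  refine ContinuousLinearMap.opNorm_le_bound _ (by positivity) fun ξ => ?_
  have h1 := ρ.bmul_identity c d hc hd _ hcd x x
  have h2 : ∀ T : Bop, inner ℂ ((star T * T) ξ) ξ = ((‖T ξ‖ ^ 2 : ℝ) : ℂ) := fun T => by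
    rw [ContinuousLinearMap.star_eq_adjoint, mul_apply_eq_comp,
      ContinuousLinearMap.adjoint_inner_left, inner_self_eq_norm_sq_to_K]
    push_cast; rfl
  have h3 := congrArg (fun T : Bop => inner ℂ (T ξ) ξ) h1
  simp only [add_apply, smul_apply, inner_add_left,
    inner_smul_left, h2, Complex.conj_ofReal] at h3
  norm_cast at h3
  have h4 : ‖ρ.sum x ξ‖ ≤ ‖symSum e x‖ * ‖ξ‖ := by
    refine ((ρ.sum x).le_opNorm ξ).trans (mul_le_mul_of_nonneg_right ?_ (norm_nonneg _))
    rw [← Rep.eval_symSum]; exact ρ.norm_eval_le _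
  have h5 : ‖ρ.sum (bmulSum c x) ξ‖ ≤ ‖c‖ * ‖ρ.sum x ξ‖ := by
    refine abs_le_of_sq_le_sq' ?_ (by positivity) |>.2
    rw [mul_pow, ← h3]
    exact le_add_of_nonneg_right (sq_nonneg _)
  calc _ ≤ _ := h5
    _ ≤ _ := by rw [mul_assoc]; exact mul_le_mul_of_nonneg_left h4 (norm_nonneg _)

/-- The action of `C₀(Y)` on the crossed product by central multipliers: `φ` sends `s^k f` to
`s^k ((φ ∘ p) f)`. -/
noncomputable def baseAct (e : OpenPartialHomeomorph X X) {Y : Type} [TopologicalSpace Y]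
    (p : C(X, Y)) (φ : C₀(Y, ℂ)) : CrossedProduct e →L[ℂ] CrossedProduct e :=
  LinearMap.extendOfNorm (symSum e ∘ₗ bmulSum (baseFun p φ)) (symSum e)

theorem baseAct_sym (e : OpenPartialHomeomorph X X) {Y : Type} [TopologicalSpace Y]
    (p : C(X, Y)) (hp : ∀ x ∈ e.source, p (e x) = p x) (φ : C₀(Y, ℂ)) (k : ℤ) (f : N e k) :
    baseAct e p φ (sym e k f) = sym e k (bmul (baseFun p φ) k f) := by
  rw [← symSum_single, baseAct, LinearMap.extendOfNorm_eq (denseRange_symSum e)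
    ⟨_, norm_symSum_bmulSum_le (baseFun p φ) fun x hx => by
      change φ (p (e x)) = φ (p x)
      rw [hp x hx]⟩]
  exact (congrArg (symSum e) (bmulSum_single (baseFun p φ) k f)).trans (symSum_single e k _)

theorem mulN_bmul_right {e : OpenPartialHomeomorph X X} (c : BoundedContinuousFunction X ℂ)
    {k l : ℤ} (f : N e k) (g : N e l) : mulN f (bmul c l g) = bmul c (k + l) (mulN f g) := by
  refine Subtype.ext (ZeroAtInftyContinuousMap.ext fun x => ?_)
  rw [bmul_apply, mulN_apply, mulN_apply, bmul_apply]
  split_ifs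
  · ring
  · rw [mul_zero]

theorem mulN_bmul_left {e : OpenPartialHomeomorph X X} (c : BoundedContinuousFunction X ℂ)
    (hc : ∀ x ∈ e.source, c (e x) = c x) {k l : ℤ} (f : N e k) (g : N e l) :
    mulN (bmul c k f) g = bmul c (k + l) (mulN f g) := by
  refine Subtype.ext (ZeroAtInftyContinuousMap.ext fun x => ?_)
  rw [bmul_apply, mulN_apply, mulN_apply, bmul_apply]
  split_ifs with h
  · rw [(show Rel e l x _ from ⟨h, rfl⟩).inv hc]; ring
  · rw [mul_zero]

theorem crossedProduct_induction {e : OpenPartialHomeomorph X X} {P : CrossedProduct e → Prop}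
    (a : CrossedProduct e) (closed : IsClosed {a | P a}) (zero : P 0)
    (add : ∀ a b, P a → P b → P (a + b)) (gen : ∀ k f, P (sym e k f)) : P a := by
  refine (denseRange_symSum e).induction_on a closed fun x => ?_
  induction x using dfinsupp_induction with
  | zero => rw [map_zero]; exact zero
  | add x y hx hy => rw [map_add]; exact add _ _ hx hy
  | single k f => rw [symSum_single]; exact gen k f

/-- `C₀(Y)` acts by central multipliers. -/
theorem baseAct_mul (e : OpenPartialHomeomorph X X) {Y : Type} [TopologicalSpace Y]
    (p : C(X, Y)) (hp : ∀ x ∈ e.source, p (e x) = p x) (φ : C₀(Y, ℂ)) (a b : CrossedProduct e) :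
    baseAct e p φ (a * b) = baseAct e p φ a * b ∧ baseAct e p φ (a * b) = a * baseAct e p φ b := by
  have hc : ∀ x ∈ e.source, baseFun p φ (e x) = baseFun p φ x := fun x hx => by
    change φ (p (e x)) = φ (p x)
    rw [hp x hx]
  induction a using crossedProduct_induction with
  | closed =>
    refine IsClosed.and (isClosed_eq ?_ ?_) (isClosed_eq ?_ ?_) <;> fun_prop
  | zero => simp only [zero_mul, map_zero, and_self]
  | add a a' h h' =>
    simp only [add_mul, map_add]
    rw [← h.1, ← h'.1, ← h.2, ← h'.2]; exact ⟨rfl, rfl⟩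
  | gen k f =>
    induction b using crossedProduct_induction with
    | closed =>
      refine IsClosed.and (isClosed_eq ?_ ?_) (isClosed_eq ?_ ?_) <;> fun_prop
    | zero => simp only [mul_zero, map_zero, and_self]
    | add a a' h h' =>
      simp only [mul_add, map_add]
      rw [← h.1, ← h'.1, ← h.2, ← h'.2]; exact ⟨rfl, rfl⟩
    | gen l g =>
      rw [sym_mul, baseAct_sym e p hp, baseAct_sym e p hp, baseAct_sym e p hp, sym_mul, sym_mul,
        mulN_bmul_right, mulN_bmul_left _ hc]
      exact ⟨rfl, rfl⟩

end Basic
end PartialCrossedProduct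

namespace HilbertField

section Modules

variable {Y : Type} [TopologicalSpace Y] {K : Y → Type} [∀ y, NormedAddCommGroup (K y)]
  [∀ y, InnerProductSpace ℂ (K y)]

/-- A Hilbert `C₀(Y)`-module, presented as a closed space `E` of bounded families of vectors with
pointwise action of `C₀(Y)` and pointwise inner product
`⟨ξ, η⟩(y) = ⟨ξ_y, η_y⟩`, which has to be `C₀(Y)`-valued. The norm of `E` is
`‖ξ‖ = sup_y ‖ξ_y‖ = ‖⟨ξ, ξ⟩‖^{1/2}` and the localisation of `E` at `y` is the closure of
`{ξ_y | ξ ∈ E}` in `K y`. -/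
structure IsHilbertModule (E : Submodule ℂ (lp K ∞)) : Prop where
  isClosed : IsClosed (E : Set (lp K ∞))
  smul_mem : ∀ (φ : C₀(Y, ℂ)), ∀ ξ ∈ E, ∃ η ∈ E, ∀ y, η y = φ y • ξ y
  inner_mem : ∀ ξ ∈ E, ∀ η ∈ E, ∃ φ : C₀(Y, ℂ), ∀ y, φ y = inner ℂ (ξ y) (η y)

variable (E : Submodule ℂ (lp K ∞))

/-- `S` is the adjoint of `T` as an operator on the Hilbert module `E`. -/
def IsAdjointPair (T S : E →L[ℂ] E) : Prop :=
  ∀ (ξ η : E) (y : Y), inner ℂ ((T ξ).1 y) (η.1 y) = inner ℂ (ξ.1 y) ((S η).1 y)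

/-- `T` is a rank one operator `ζ ↦ ξ ⟨η, ζ⟩`. -/
def IsRankOne (T : E →L[ℂ] E) : Prop :=
  ∃ ξ η : E, ∀ (ζ : E) (y : Y), (T ζ).1 y = inner ℂ (η.1 y) (ζ.1 y) • ξ.1 y

/-- The compact operators `𝓚(E)`: the closed linear span of the rank one operators. -/
noncomputable def compacts : Set (E →L[ℂ] E) :=
  closure (Submodule.span ℂ {T | IsRankOne E T} : Set (E →L[ℂ] E))

variable {A : Type} [NonUnitalCStarAlgebra A]

/-- The kernel `I_y` of the localisation `A → A_y` of a `C₀(Y)`-algebra `A` at `y`: the closed ideal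
of the products `φ a` with `φ ∈ C₀(Y ∖ {y})`. Here `act φ a = φ a`. -/
noncomputable def localIdeal (act : C₀(Y, ℂ) → A → A) (y : Y) : Submodule ℂ A :=
  (Submodule.span ℂ {b | ∃ (φ : C₀(Y, ℂ)) (a : A), φ y = 0 ∧ b = act φ a}).topologicalClosure

/-- `π` is a field of faithful representations of the `C₀(Y)`-algebra `A` on `E`: a nondegenerate
`C₀(Y)`-linear `*`-homomorphism from `A` to the adjointable operators on `E`, which are the
multipliers of `𝓚(E)`, such that for every `y` the induced representation `π_y` of `A_y = A / I_y`
on the localisation of `E` at `y` is (well defined and) injective. -/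
structure IsFieldOfFaithfulReps (act : C₀(Y, ℂ) → A → A) (π : A →ₙₐ[ℂ] (E →L[ℂ] E)) : Prop where
  adjoint : ∀ a, IsAdjointPair E (π a) (π (star a))
  nondegenerate : closure (Submodule.span ℂ {T | ∃ (a : A), ∃ S ∈ compacts E, T = π a * S} :
    Set (E →L[ℂ] E)) = compacts E
  linear : ∀ (φ : C₀(Y, ℂ)) (a : A) (ξ : E) (y : Y),
    (π (act φ a) ξ).1 y = φ y • (π a ξ).1 y
  faithful : ∀ (y : Y) (a : A), a ∈ localIdeal act y ↔ ∀ ξ : E, (π a ξ).1 y = 0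

end Modules

end HilbertField

namespace QTri

/-- `(0, b]_q`. -/
def qIoc (q b : ℝ) : Set ℝ := {x | (q = 1 ∧ 0 < x ∧ x ≤ b) ∨ (q ≠ 1 ∧ ∃ j : ℕ, x = q ^ j * b)}

/-- `[a, b]_q`. -/
def qIcc (q a b : ℝ) : Set ℝ :=
  {x | (q = 1 ∧ a ≤ x ∧ x ≤ b) ∨ (q ≠ 1 ∧ x ∈ qIoc q b ∧ x ∉ qIoc q (q * a))}

/-- The space `H` as a set of triples `(q, t, a)`. -/
def HSet : Set (ℝ × ℝ × ℝ) :=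
  {p | 0 < p.1 ∧ p.1 ≤ 1 ∧ p.2.1 ∈ qIoc p.1 p.1 ∧
    p.2.2 ∈ qIcc p.1 (√(p.2.1 / p.1)) (√(p.1 / p.2.1))}

/-- The locally compact space `H`, with the trace topology. -/
abbrev H : Type := HSet

/-- The base space `(0, 1]`. -/
abbrev Base : Type := Set.Ioc (0 : ℝ) 1

/-- The projection `(q, t, a) ↦ q`. -/
def proj : C(H, Base) where
  toFun p := ⟨p.1.1, p.2.1, p.2.2.1⟩
  continuous_toFun := by fun_prop

theorem q_pos (p : H) : 0 < p.1.1 := p.2.1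

theorem t_pos (p : H) : 0 < p.1.2.1 := by
  obtain ⟨⟨q, t, a⟩, h1, h2, h3, h4⟩ := p
  rcases h3 with ⟨_, h, _⟩ | ⟨_, j, h⟩
  · exact h
  · rw [h]; positivity

theorem a_pos (p : H) : 0 < p.1.2.2 := by
  have ht := t_pos p
  obtain ⟨⟨q, t, a⟩, h1, h2, h3, h4⟩ := p
  simp only at h1 ht h4
  rcases h4 with ⟨_, h, _⟩ | ⟨hq, h, _⟩
  · exact lt_of_lt_of_le (Real.sqrt_pos.2 (by positivity)) h
  · rcases h with ⟨h, _⟩ | ⟨_, j, h⟩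
    · exact absurd h hq
    · change 0 < a
      rw [h]; have := Real.sqrt_pos.2 (show 0 < q / t by positivity); positivity

/-- `H^{(1)}`. -/
def HPlus : Set H :=
  {p | p.1.2.1 + p.1.2.1⁻¹ - p.1.1 * p.1.2.2 ^ 2 - p.1.1⁻¹ * (p.1.2.2 ^ 2)⁻¹ ≠ 0}

/-- `H^{(-1)}`. -/
def HMinus : Set H :=
  {p | p.1.2.1 + p.1.2.1⁻¹ - p.1.1⁻¹ * p.1.2.2 ^ 2 - p.1.1 * (p.1.2.2 ^ 2)⁻¹ ≠ 0}

theorem isOpen_HPlus : IsOpen HPlus := by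
  refine isOpen_ne_fun ?_ continuous_const
  have h1 : ∀ p : H, p.1.1 ≠ 0 := fun p => (q_pos p).ne'
  have h2 : ∀ p : H, p.1.2.1 ≠ 0 := fun p => (t_pos p).ne'
  have h3 : ∀ p : H, p.1.2.2 ^ 2 ≠ 0 := fun p => pow_ne_zero 2 (a_pos p).ne'
  exact (((by fun_prop : Continuous fun p : H => p.1.2.1).add
    (Continuous.inv₀ (by fun_prop) h2)).sub (by fun_prop)).sub
    ((Continuous.inv₀ (by fun_prop) h1).mul (Continuous.inv₀ (by fun_prop) h3))

theorem isOpen_HMinus : IsOpen HMinus := by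
  refine isOpen_ne_fun ?_ continuous_const
  have h1 : ∀ p : H, p.1.1 ≠ 0 := fun p => (q_pos p).ne'
  have h2 : ∀ p : H, p.1.2.1 ≠ 0 := fun p => (t_pos p).ne'
  have h3 : ∀ p : H, p.1.2.2 ^ 2 ≠ 0 := fun p => pow_ne_zero 2 (a_pos p).ne'
  exact (((by fun_prop : Continuous fun p : H => p.1.2.1).add
    (Continuous.inv₀ (by fun_prop) h2)).sub
    ((Continuous.inv₀ (by fun_prop) h1).mul (by fun_prop))).sub
    (Continuous.mul (by fun_prop) (Continuous.inv₀ (by fun_prop) h3))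

theorem plus_mem {p : H} (hp : p ∈ HPlus) : (p.1.1, p.1.2.1, p.1.1 * p.1.2.2) ∈ HSet := by
  have ht := t_pos p
  have ha := a_pos p
  obtain ⟨⟨q, t, a⟩, h1, h2, h3, h4⟩ := p
  simp only [HPlus, Set.mem_ofPred_eq, ne_eq] at hp
  simp only at h1 h2 h3 h4 ht ha
  refine ⟨h1, h2, h3, ?_⟩
  rcases h4 with ⟨rfl, h5, h6⟩ | ⟨hq, h5, h6⟩
  · exact Or.inl ⟨rfl, by simpa using h5, by simpa using h6⟩
  · refine Or.inr ⟨hq, ?_, ?_⟩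
    · rcases h5 with ⟨h, _⟩ | ⟨_, j, hj⟩
      · exact absurd h hq
      · exact Or.inr ⟨hq, j + 1, by simp only at hj ⊢; rw [hj]; ring⟩
    · rintro (⟨h, _⟩ | ⟨_, j, hj⟩)
      · exact absurd h hq
      · simp only at hj
        rcases j with _ | j
        · have h7 : a = √(t / q) := mul_left_cancel₀ h1.ne' (by linarith)
          apply hp
          have h8 : a ^ 2 = t / q := by rw [h7]; exact Real.sq_sqrt (by positivity)
          rw [h8]; field_simp; ring
        · exact h6 (Or.inr ⟨hq, j, mul_left_cancel₀ h1.ne' (by rw [hj]; ring)⟩)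

theorem plus_mem_minus {p : H} (hp : p ∈ HPlus) :
    (⟨_, plus_mem hp⟩ : H) ∈ HMinus := by
  have h1 := q_pos p
  have h2 := a_pos p
  have h3 := t_pos p
  simp only [HPlus, HMinus, Set.mem_ofPred_eq, ne_eq] at hp ⊢
  convert hp using 3
  · field_simp
  · field_simp

theorem minus_mem {p : H} (hp : p ∈ HMinus) : (p.1.1, p.1.2.1, p.1.1⁻¹ * p.1.2.2) ∈ HSet := by
  have ht := t_pos p
  have ha := a_pos p
  obtain ⟨⟨q, t, a⟩, h1, h2, h3, h4⟩ := p
  simp only [HMinus, Set.mem_ofPred_eq, ne_eq] at hp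
  simp only at h1 h2 h3 h4 ht ha
  refine ⟨h1, h2, h3, ?_⟩
  rcases h4 with ⟨rfl, h5, h6⟩ | ⟨hq, h5, h6⟩
  · exact Or.inl ⟨rfl, by simpa using h5, by simpa using h6⟩
  · refine Or.inr ⟨hq, ?_, ?_⟩
    · rcases h5 with ⟨h, _⟩ | ⟨_, j, hj⟩
      · exact absurd h hq
      · rcases j with _ | j
        · exfalso
          apply hp
          have h8 : a ^ 2 = q / t := by
            rw [hj, pow_zero, one_mul]; exact Real.sq_sqrt (by positivity)
          rw [h8]; field_simp; ring
        · exact Or.inr ⟨hq, j, by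
            simp only; rw [hj, pow_succ]; field_simp⟩
    · rintro (⟨h, _⟩ | ⟨_, j, hj⟩)
      · exact absurd h hq
      · simp only at hj
        refine h6 (Or.inr ⟨hq, j + 1, ?_⟩)
        have h9 : a = q * (q⁻¹ * a) := by field_simp
        rw [h9, hj]; ring

theorem minus_mem_plus {p : H} (hp : p ∈ HMinus) :
    (⟨_, minus_mem hp⟩ : H) ∈ HPlus := by
  have h1 := q_pos p
  have h2 := a_pos p
  have h3 := t_pos p
  simp only [HPlus, HMinus, Set.mem_ofPred_eq, ne_eq] at hp ⊢
  convert hp using 3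
  · field_simp
  · field_simp

open Classical in
/-- The partial homeomorphism `θ : H^{(1)} → H^{(-1)}`, `(q, t, a) ↦ (q, t, q a)`, with inverse
`(q, t, a) ↦ (q, t, q⁻¹ a)`. -/
noncomputable def theta : OpenPartialHomeomorph H H where
  toFun p := if h : p ∈ HPlus then ⟨_, plus_mem h⟩ else p
  invFun p := if h : p ∈ HMinus then ⟨_, minus_mem h⟩ else p
  source := HPlus
  target := HMinus
  map_source' p hp := by rw [dif_pos hp]; exact plus_mem_minus hp
  map_target' p hp := by rw [dif_pos hp]; exact minus_mem_plus hp
  left_inv' p hp := by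
    rw [dif_pos hp, dif_pos (plus_mem_minus hp)]
    exact Subtype.ext (Prod.ext rfl (Prod.ext rfl (inv_mul_cancel_left₀ (q_pos p).ne' _)))
  right_inv' p hp := by
    rw [dif_pos hp, dif_pos (minus_mem_plus hp)]
    exact Subtype.ext (Prod.ext rfl (Prod.ext rfl (mul_inv_cancel_left₀ (q_pos p).ne' _)))
  open_source := isOpen_HPlus
  open_target := isOpen_HMinus
  continuousOn_toFun := by
    rw [Topology.IsInducing.subtypeVal.continuousOn_iff]
    have h : Continuous fun p : H => (p.1.1, p.1.2.1, p.1.1 * p.1.2.2) := by fun_prop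
    refine h.continuousOn.congr fun p hp => ?_
    simp only [Function.comp_apply]
    rw [dif_pos hp]
  continuousOn_invFun := by
    rw [Topology.IsInducing.subtypeVal.continuousOn_iff]
    have h : Continuous fun p : H => (p.1.1, p.1.2.1, p.1.1⁻¹ * p.1.2.2) := by
      have h1 : Continuous fun p : H => p.1.1⁻¹ :=
        Continuous.inv₀ (by fun_prop) fun p => (q_pos p).ne'
      fun_prop
    refine h.continuousOn.congr fun p hp => ?_
    simp only [Function.comp_apply]
    rw [dif_pos hp]

theorem proj_theta (p : H) (hp : p ∈ theta.source) : proj (theta p) = proj p := by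
  have : theta p = ⟨_, plus_mem hp⟩ := dif_pos hp
  rw [this]; rfl

noncomputable instance : MeasurableSpace Circle := borel Circle
instance : BorelSpace Circle := ⟨rfl⟩

/-- `I = H × S¹`. -/
abbrev I : Type := H × Circle

/-- The normalised arc length measure `(2π)⁻¹ dθ` on the circle. -/
noncomputable def circleMeasure : Measure Circle :=
  ENNReal.ofReal (2 * Real.pi)⁻¹ •
    (volume.restrict (Set.Ioc 0 (2 * Real.pi))).map fun x : ℝ => Circle.exp x

/-- The set `H_1 = {(t, a) | (1, t, a) ∈ H}`. -/
def HOne : Set (ℝ × ℝ) := {p | ((1 : ℝ), p) ∈ HSet}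

/-- The measure `(t⁻² - 1) a dt da` on `H_1`, as a measure on `H`. -/
noncomputable def muHOne : Measure H :=
  ((Measure.comap Subtype.val volume : Measure HOne).withDensity fun p =>
    ENNReal.ofReal (((p.1.1 ^ 2)⁻¹ - 1) * p.1.2)).map fun p => (⟨((1 : ℝ), p.1), p.2⟩ : H)

/-- The measure on `I` that represents `ψ_q` on `I_q = H_q × S¹`. -/
noncomputable def mu (q : Base) : Measure I :=
  if q.1 = 1 then muHOne.prod circleMeasure
  else Measure.sum fun p : {p : H // proj p = q} =>
    ENNReal.ofReal ((1 - q.1) ^ 2 * ((p.1.1.2.1)⁻¹ - p.1.1.2.1) * p.1.1.2.2 ^ 2) •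
      circleMeasure.map fun z => (p.1, z)

theorem circleMeasure_univ : circleMeasure Set.univ = 1 := by
  have h : Measurable fun x : ℝ => Circle.exp x := Circle.exp.continuous.measurable
  have hpi := Real.pi_pos
  simp only [circleMeasure, Measure.smul_apply, smul_eq_mul]
  rw [Measure.map_apply h MeasurableSet.univ, Set.preimage_univ, Measure.restrict_apply_univ,
    Real.volume_Ioc, ← ENNReal.ofReal_mul (by positivity), sub_zero,
    inv_mul_cancel₀ (by positivity), ENNReal.ofReal_one]

instance : IsProbabilityMeasure circleMeasure := ⟨circleMeasure_univ⟩

theorem mem_HOne (p : ℝ × ℝ) :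
    p ∈ HOne ↔ (0 < p.1 ∧ p.1 ≤ 1) ∧ √p.1 ≤ p.2 ∧ p.2 ≤ √(1 / p.1) := by
  simp [HOne, HSet, qIoc, qIcc]

theorem measurableSet_HOne : MeasurableSet HOne := by
  have h : HOne = {p : ℝ × ℝ | 0 < p.1} ∩ {p | p.1 ≤ 1} ∩ {p | √p.1 ≤ p.2} ∩
      {p | p.2 ≤ √(1 / p.1)} := by
    ext p; rw [mem_HOne]; simp [and_assoc]
  rw [h]
  refine (((measurableSet_lt ?_ ?_).inter (measurableSet_le ?_ ?_)).inter
    (measurableSet_le ?_ ?_)).inter (measurableSet_le ?_ ?_) <;> fun_prop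

/-- The part of `I` on which `t ≥ ε`. -/
def upper (ε : ℝ) : Set I := {x | ε ≤ x.1.1.2.1}

theorem isClosed_upper (ε : ℝ) : IsClosed (upper ε) :=
  isClosed_le continuous_const (by fun_prop)

theorem muHOne_bound {ε : ℝ} (hε : 0 < ε) :
    muHOne {p | ε ≤ p.1.2.1} ≤ ENNReal.ofReal ((ε ^ 2)⁻¹ * √(1 / ε) * √(1 / ε)) := by
  have hs : MeasurableSet {p : H | ε ≤ p.1.2.1} :=
    (isClosed_le continuous_const (by fun_prop)).measurableSet
  have hf : Measurable fun p : HOne => (⟨((1 : ℝ), p.1), p.2⟩ : H) := by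
    refine Measurable.subtype_mk ?_
    fun_prop
  rw [muHOne, Measure.map_apply hf hs, withDensity_apply _ (hf hs)]
  set T : Set HOne := (fun p : HOne => (⟨((1 : ℝ), p.1), p.2⟩ : H)) ⁻¹' {p : H | ε ≤ p.1.2.1}
    with hT
  have key : ∀ p ∈ T, ε ≤ p.1.1 ∧ 0 ≤ p.1.2 ∧ p.1.2 ≤ √(1 / ε) ∧ p.1.1 ≤ 1 := fun p hp => by
    have h1 := (mem_HOne p.1).1 p.2
    have h2 : ε ≤ p.1.1 := hp
    exact ⟨h2, (Real.sqrt_nonneg _).trans h1.2.1, h1.2.2.trans (Real.sqrt_le_sqrt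
      (one_div_le_one_div_of_le hε h2)), h1.1.2⟩
  have h1 : ∫⁻ p in T, ENNReal.ofReal (((p.1.1 ^ 2)⁻¹ - 1) * p.1.2)
      ∂(Measure.comap Subtype.val volume) ≤ ∫⁻ p in T, ENNReal.ofReal ((ε ^ 2)⁻¹ * √(1 / ε))
      ∂(Measure.comap Subtype.val volume) := by
    refine setLIntegral_mono' (hf hs) fun p hp => ENNReal.ofReal_le_ofReal ?_
    obtain ⟨h1, h2, h3, -⟩ := key p hp
    have h4 : (p.1.1 ^ 2)⁻¹ ≤ (ε ^ 2)⁻¹ := inv_anti₀ (by positivity) (by gcongr)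
    exact mul_le_mul (by linarith) h3 h2 (by positivity)
  refine h1.trans ?_
  rw [setLIntegral_const, comap_subtype_coe_apply measurableSet_HOne,
    ENNReal.ofReal_mul (by positivity : 0 ≤ (ε ^ 2)⁻¹ * √(1 / ε))]
  refine mul_le_mul_right ?_ _
  have h2 : Subtype.val '' T ⊆ Set.Icc (0 : ℝ) 1 ×ˢ Set.Icc (0 : ℝ) √(1 / ε) := by
    rintro _ ⟨p, hp, rfl⟩
    obtain ⟨h1, h2, h3, h4⟩ := key p hp
    exact ⟨⟨hε.le.trans h1, h4⟩, h2, h3⟩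
  refine (measure_mono h2).trans ?_
  rw [Measure.volume_eq_prod, Measure.prod_prod, Real.volume_Icc, Real.volume_Icc]
  simp

theorem discrete_bound {ε : ℝ} (hε : 0 < ε) (q : Base) (hq : q.1 ≠ 1) :
    ∑' p : {p : H // proj p = q}, (if ε ≤ p.1.1.2.1 then
      ENNReal.ofReal ((1 - q.1) ^ 2 * ((p.1.1.2.1)⁻¹ - p.1.1.2.1) * p.1.1.2.2 ^ 2) else 0) ≤
    ENNReal.ofReal (Real.log ε ^ 2 * ε⁻¹ * ε⁻¹) := by
  obtain ⟨q, hq0, hq1⟩ := q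
  have hq1' : q < 1 := lt_of_le_of_ne hq1 hq
  simp only at hq hq0 hq1
  have idx : ∀ p : {p : H // proj p = ⟨q, hq0, hq1⟩}, ∃ i j : ℕ, p.1.1.2.1 = q ^ (i + 1) ∧
      p.1.1.2.2 = q ^ j * √(q / p.1.1.2.1) ∧ j ≤ i := by
    rintro ⟨⟨⟨q', t, a⟩, h1, h2, h3, h4⟩, h5⟩
    obtain rfl : q' = q := congrArg Subtype.val h5
    simp only at h1 h2 h3 h4 ⊢
    rcases h3 with ⟨h, _⟩ | ⟨_, i, hi⟩
    · exact absurd h hq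
    rcases h4 with ⟨h, _⟩ | ⟨_, h6, h7⟩
    · exact absurd h hq
    rcases h6 with ⟨h, _⟩ | ⟨_, j, hj⟩
    · exact absurd h hq
    refine ⟨i, j, by rw [hi, pow_succ], hj, ?_⟩
    by_contra hij
    push Not at hij
    obtain ⟨m, rfl⟩ := Nat.exists_eq_add_of_lt hij
    refine h7 (Or.inr ⟨hq, m, ?_⟩)
    have ht : 0 < t := by rw [hi]; positivity
    have h8 : √(t / q') = q' ^ i * √(q' / t) := by
      have h9 : t / q' = (q' ^ i * √(q' / t)) ^ 2 := by
        rw [mul_pow, Real.sq_sqrt (by positivity), hi]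
        field_simp
      rw [h9, Real.sqrt_sq (by positivity)]
    rw [h8, hj]; ring
  choose i j ht ha hij using idx
  have hinj : Function.Injective fun p => (i p, j p) := by
    intro p p' h
    simp only [Prod.mk.injEq] at h
    have h1 : p.1.1.1 = p'.1.1.1 :=
      congrArg Subtype.val (p.2.trans p'.2.symm)
    have h2 : p.1.1.2.1 = p'.1.1.2.1 := by rw [ht, ht, h.1]
    have h3 : p.1.1.2.2 = p'.1.1.2.2 := by rw [ha, ha, h.2, h2]
    exact Subtype.ext (Subtype.ext (Prod.ext h1 (Prod.ext h2 h3)))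
  set N := ⌊-Real.log ε / (1 - q)⌋₊ with hN
  set c := ENNReal.ofReal ((1 - q) ^ 2 * ε⁻¹ * ε⁻¹) with hc
  have hbound : ∀ p : {p : H // proj p = ⟨q, hq0, hq1⟩}, (if ε ≤ p.1.1.2.1 then
      ENNReal.ofReal ((1 - q) ^ 2 * ((p.1.1.2.1)⁻¹ - p.1.1.2.1) * p.1.1.2.2 ^ 2) else 0) ≤
      (fun x : ℕ × ℕ => if x ∈ Finset.range N ×ˢ Finset.range N then c else 0) (i p, j p) := by
    intro p
    split_ifs with h
    · have htp := t_pos p.1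
      have hiN : i p < N := by
        rw [hN, ← Nat.succ_le_iff]
        refine Nat.le_floor ?_
        rw [le_div_iff₀ (by linarith)]
        have h1 : Real.log ε ≤ (i p + 1 : ℕ) * Real.log q := by
          rw [← Real.log_pow, ← ht]; exact Real.log_le_log hε h
        have h2 := Real.log_le_sub_one_of_pos hq0
        have h3 : ((i p + 1 : ℕ) : ℝ) * Real.log q ≤ (i p + 1 : ℕ) * (q - 1) := by gcongr
        push_cast at h1 h3 ⊢
        linarith
      have hmem : (i p, j p) ∈ Finset.range N ×ˢ Finset.range N := by
        simp only [Finset.mem_product, Finset.mem_range]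
        exact ⟨hiN, (hij p).trans_lt hiN⟩
      simp only
      rw [if_pos hmem, hc]
      refine ENNReal.ofReal_le_ofReal ?_
      have h4 : (p.1.1.2.1)⁻¹ - p.1.1.2.1 ≤ ε⁻¹ := by
        have := inv_anti₀ hε h
        linarith
      have h5 : p.1.1.2.2 ^ 2 ≤ ε⁻¹ := by
        rw [ha, mul_pow, Real.sq_sqrt (by positivity)]
        have h6 : (q ^ j p) ^ 2 ≤ 1 := by
          rw [← pow_mul]; exact pow_le_one₀ hq0.le hq1
        have h7 : q / p.1.1.2.1 ≤ ε⁻¹ := by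
          rw [div_eq_mul_inv, ← one_mul ε⁻¹]
          exact mul_le_mul hq1 (inv_anti₀ hε h) (by positivity) zero_le_one
        calc _ ≤ 1 * ε⁻¹ := mul_le_mul h6 h7 (by positivity) zero_le_one
          _ = _ := one_mul _
      have h8 : (1 - q) ^ 2 * ((p.1.1.2.1)⁻¹ - p.1.1.2.1) ≤ (1 - q) ^ 2 * ε⁻¹ := by gcongr
      exact mul_le_mul h8 h5 (by positivity) (by positivity)
    · exact bot_le
  refine (ENNReal.tsum_le_tsum hbound).trans ?_
  refine (ENNReal.tsum_comp_le_tsum_of_injective hinj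
    (fun x : ℕ × ℕ => if x ∈ Finset.range N ×ˢ Finset.range N then c else 0)).trans ?_
  rw [tsum_eq_sum (s := Finset.range N ×ˢ Finset.range N) fun x hx => if_neg hx,
    Finset.sum_congr rfl fun x hx => if_pos hx, Finset.sum_const, Finset.card_product,
    Finset.card_range, nsmul_eq_mul, hc, ← ENNReal.ofReal_natCast,
    ← ENNReal.ofReal_mul (by positivity)]
  rcases Nat.eq_zero_or_pos N with h0 | h0
  · rw [h0]; simp
  refine ENNReal.ofReal_le_ofReal ?_
  have h9 : (N : ℝ) * (1 - q) ≤ -Real.log ε := by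
    rw [← le_div_iff₀ (by linarith)]
    refine Nat.floor_le ?_
    by_contra hneg
    push Not at hneg
    rw [hN, Nat.floor_of_nonpos hneg.le] at h0
    exact lt_irrefl _ h0
  have h10 : 0 ≤ (N : ℝ) * (1 - q) := mul_nonneg (by positivity) (by linarith)
  have h11 : ((N : ℝ) * (1 - q)) ^ 2 ≤ Real.log ε ^ 2 := by nlinarith
  push_cast
  calc (N : ℝ) * N * ((1 - q) ^ 2 * ε⁻¹ * ε⁻¹) = ((N : ℝ) * (1 - q)) ^ 2 * (ε⁻¹ * ε⁻¹) := by ring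
    _ ≤ Real.log ε ^ 2 * (ε⁻¹ * ε⁻¹) := by gcongr
    _ = _ := by ring

theorem mu_upper_bound {ε : ℝ} (hε : 0 < ε) : ∃ C : ℝ, 0 ≤ C ∧ ∀ q, mu q (upper ε) ≤
    ENNReal.ofReal C := by
  refine ⟨(ε ^ 2)⁻¹ * √(1 / ε) * √(1 / ε) + Real.log ε ^ 2 * ε⁻¹ * ε⁻¹, by positivity,
    fun q => ?_⟩
  rw [mu]
  split_ifs with hq
  · have h : upper ε = {p : H | ε ≤ p.1.2.1} ×ˢ Set.univ := by ext; simp [upper]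
    rw [h, Measure.prod_prod, measure_univ, mul_one]
    exact (muHOne_bound hε).trans (ENNReal.ofReal_le_ofReal (by
      have : 0 ≤ Real.log ε ^ 2 * ε⁻¹ * ε⁻¹ := by positivity
      linarith))
  · rw [Measure.sum_apply _ (isClosed_upper ε).measurableSet]
    refine le_trans (ENNReal.tsum_le_tsum fun p => ?_)
      ((discrete_bound hε q hq).trans (ENNReal.ofReal_le_ofReal (by
      have : 0 ≤ (ε ^ 2)⁻¹ * √(1 / ε) * √(1 / ε) := by positivity
      linarith)))
    rw [Measure.smul_apply, smul_eq_mul, Measure.map_apply (by fun_prop)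
      (isClosed_upper ε).measurableSet]
    split_ifs with h
    · exact (mul_le_mul_right prob_le_one _).trans (mul_one _).le
    · have : (fun z : Circle => ((p.1, z) : I)) ⁻¹' upper ε = ∅ := by
        ext z; simp only [upper, Set.mem_preimage, Set.mem_ofPred_eq, Set.mem_empty_iff_false]
        exact ⟨h, False.elim⟩
      rw [this, measure_empty, mul_zero]

/-- The Hilbert space `L²(I_q, ψ_q)`. -/
abbrev L2 (q : Base) : Type := Lp ℂ 2 (mu q)

/-- Bounded families of vectors `ξ_q ∈ L²(I_q, ψ_q)`, with the supremum norm. -/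
abbrev Sections : Type := lp (fun q : Base => L2 q) ∞

theorem eLpNorm_bound (h : C_c(I, ℂ)) : ∃ C : ℝ, 0 ≤ C ∧
    ∀ q, eLpNorm h 2 (mu q) ≤ ENNReal.ofReal C := by
  obtain ⟨ε, hε, hK⟩ := IsCompact.exists_forall_le' (show IsCompact (tsupport h) from h.2)
    (f := fun x : I => x.1.1.2.1) (by fun_prop) (a := 0) fun x _ => t_pos x.1
  obtain ⟨C, hC0, hC⟩ := mu_upper_bound hε
  obtain ⟨M, hM⟩ : ∃ M : ℝ, ∀ x, ‖h x‖ ≤ M := h.2.exists_bound_of_continuous h.continuous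
  have hM0 : 0 ≤ M := (norm_nonneg _).trans (hM (⟨(1, 1, 1), by
    simp [HSet, qIoc, qIcc]⟩, 1))
  refine ⟨M * √C, by positivity, fun q => ?_⟩
  have h1 : eLpNorm h 2 (mu q) ≤ eLpNorm ((upper ε).indicator fun _ => M) 2 (mu q) := by
    refine eLpNorm_mono_real fun x => ?_
    by_cases hx : x ∈ upper ε
    · rw [Set.indicator_of_mem hx]; exact hM x
    · rw [Set.indicator_of_notMem hx]
      have : x ∉ tsupport h := fun hx' => hx (hK x hx')
      rw [image_eq_zero_of_notMem_tsupport this, norm_zero]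
  refine h1.trans ?_
  rw [eLpNorm_indicator_const (isClosed_upper ε).measurableSet two_ne_zero ENNReal.ofNat_ne_top,
    ENNReal.ofReal_mul hM0, Real.enorm_of_nonneg hM0]
  refine mul_le_mul_right ?_ _
  rw [Real.sqrt_eq_rpow, ← ENNReal.ofReal_rpow_of_nonneg hC0 (by norm_num)]
  simp only [ENNReal.toReal_ofNat]
  exact ENNReal.rpow_le_rpow (hC q) (by norm_num)

theorem memLp_of_compact (h : C_c(I, ℂ)) (q : Base) : MemLp h 2 (mu q) := by
  obtain ⟨C, -, hC⟩ := eLpNorm_bound h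
  exact ⟨h.continuous.aestronglyMeasurable, (hC q).trans_lt ENNReal.ofReal_lt_top⟩

/-- The family `(f_q)_q` of restrictions of `f ∈ C_c(I)`. -/
noncomputable def toSections : C_c(I, ℂ) →ₗ[ℂ] Sections where
  toFun h := ⟨fun q => (memLp_of_compact h q).toLp h, memℓp_infty (by
    obtain ⟨C, hC0, hC⟩ := eLpNorm_bound h
    refine ⟨C, ?_⟩
    rintro _ ⟨q, rfl⟩
    simp only [Lp.norm_toLp]
    exact ENNReal.toReal_le_of_le_ofReal hC0 (hC q))⟩
  map_add' f g := Subtype.ext (funext fun q =>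
    MemLp.toLp_add (memLp_of_compact f q) (memLp_of_compact g q))
  map_smul' c f := Subtype.ext (funext fun q =>
    MemLp.toLp_const_smul c (memLp_of_compact f q))

/-- The Hilbert module `𝓘`: the completion of `C_c(I)` for the inner product
`⟨f, g⟩(q) = ψ_q(f̄_q g_q)` and the norm `‖f‖ = sup_q ψ_q(|f_q|²)^{1/2}`, realised as the closure
of `C_c(I)` in the space of bounded families of vectors in the spaces `L²(I_q, ψ_q)`. -/
noncomputable def HilbI : Submodule ℂ Sections :=
  (LinearMap.range toSections).topologicalClosure

/-- The canonical map `C_c(I) → 𝓘`. -/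
noncomputable def toHilbI (h : C_c(I, ℂ)) : HilbI :=
  ⟨toSections h, Submodule.le_topologicalClosure _ ⟨h, rfl⟩⟩

/-- The extension of `θ` to `I^{(1)} = H^{(1)} × S¹`. -/
noncomputable def thetaI : OpenPartialHomeomorph I I :=
  theta.prod (OpenPartialHomeomorph.refl Circle)

open Classical in
/-- `θ⁻¹(F) = F ∘ θ⁻¹` on `I^{(-1)}`, extended by zero to `I`, for `F` vanishing off `I^{(1)}`. -/
noncomputable def thetaInv (F : I → ℂ) (x : I) : ℂ :=
  if x ∈ thetaI.target then F (thetaI.symm x) else 0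

/-- The coordinate function `Q(q, t, a, z) = q`. -/
noncomputable def Qfun (x : I) : ℂ := (x.1.1.1 : ℂ)

/-- The coordinate function `Z(q, t, a, z) = z`. -/
noncomputable def Zfun (x : I) : ℂ := (x.2 : ℂ)

end QTri

/-! For `q < 1` the fibre `H_q` is discrete: its points are `t = q^(j+n+1)`, `a² = q^(j-n)` with `j,
n ∈ ℕ` (`mem_HSet_iff`). As `q → 1` they fill the region `H_1`.

Hilbert module. The point is that `q ↦ ψ(f)(q)` is continuous. Locally in `q < 1` it is a finite sum
of continuous functions. At `q = 1` put `x = -j log q`, `y = -n log q`: the sum becomes a Riemann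
sum over the quadrant with mesh `-log q`, and `(1-q)² / (log q)² → 1`. The limit is the integral of
`(t⁻¹ - t) a² dx dy` with `t = e^{-(x+y)}`, `a = e^{(y-x)/2}`. Since the Jacobian is `t a`, this is
the measure `(t⁻² - 1) a dt da` (`continuous_integral_nu`). Inner products of elements of the
completion are then uniform limits of `C₀` functions.

Representation. Let `s^k f` act on `C_c(I)` by `h ↦ Q^{-k} Z^k θ^{-k}(f h)`. Because `θ^k`
multiplies `a` by `q^k`, it multiplies the weight of a point by `q^{2k}`; the factor `Q^{-k}`
compensates exactly, so this is a `*`-representation on each `L²(I_q)` (`integral_nu_invariant`,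
`inner_opT`). The universal norm dominates it (`PreRep.norm_sum_le`), and it extends to the crossed
product.

Faithfulness on fibres. Applied to a function that does not depend on the circle variable, `s^k f`
produces a multiple of `z^k`, so different degrees are orthogonal. If `Σ s^k f_k` has norm at most
`C` in the fibre at `q`, then every `|f_k|` is at most `C` on `H_q`, because the fibre measure has
full support there (`norm_coeff_le`). A term with `|f_k| ≤ δ` on `H_q` lies within `δ` of the kernel
of localisation (`exists_localIdeal_near`). For a general element `a` killed by `π_q` the number of
terms in an approximating sum is uncontrolled, so Fejér means are used: they are contractive for the
universal norm, being averages of the gauge action, and they cut off at a degree that is fixed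
before the precision is chosen (`mem_localIdeal_of_piL_eq_zero`). -/

/-! ### Separable Hilbert spaces inside `ℓ²(ℕ)` -/

/-- Orthonormal vectors are at distance `√2 > 1`, so the balls of radius `1/2` around them are
disjoint nonempty open sets. -/
theorem Orthonormal.countable_of_separable {E : Type*} [NormedAddCommGroup E]
    [InnerProductSpace ℂ E] [TopologicalSpace.SeparableSpace E] {ι : Type*} {v : ι → E}
    (hv : Orthonormal ℂ v) : Countable ι := by
  have h : Pairwise (Function.onFun Disjoint fun i => Metric.ball (v i) (1 / 2)) := by
    intro i j hij
    refine Metric.ball_disjoint_ball ?_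
    have h1 : ‖v i - v j‖ ^ 2 = 2 := by
      rw [norm_sub_sq (𝕜 := ℂ), hv.1, hv.1, hv.2 hij]; norm_num
    rw [dist_eq_norm]
    nlinarith [norm_nonneg (v i - v j)]
  exact h.countable_of_isOpen_disjoint (fun i => Metric.isOpen_ball)
    fun i => ⟨v i, Metric.mem_ball_self (by norm_num)⟩

/-- A separable Hilbert space embeds isometrically into `ℓ²(ℕ)`. -/
theorem exists_linearIsometry_l2 (E : Type*) [NormedAddCommGroup E]
    [InnerProductSpace ℂ E] [CompleteSpace E] [TopologicalSpace.SeparableSpace E] :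
    Nonempty (E →ₗᵢ[ℂ] lp (fun _ : ℕ => ℂ) 2) := by
  obtain ⟨w, b, -⟩ := exists_hilbertBasis ℂ E
  have : Countable w := b.orthonormal.countable_of_separable
  obtain ⟨i, hi⟩ := exists_injective_nat w
  have h : Orthonormal ℂ fun n : ℕ => (lp.single 2 n (1 : ℂ) : lp (fun _ : ℕ => ℂ) 2) := by
    rw [orthonormal_iff_ite]
    intro m n
    rw [lp.inner_single_left]
    by_cases hmn : m = n
    · subst hmn; simp
    · simp [hmn]
  have h2 := (h.comp i hi).orthogonalFamily
  exact ⟨h2.linearIsometry.comp b.repr.toLinearIsometry⟩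

/-! ### The universal norm dominates representations on separable pre-Hilbert spaces -/

namespace PartialCrossedProduct

variable {X : Type} [TopologicalSpace X] [T2Space X] {e : OpenPartialHomeomorph X X}

/-- A graded family of operators on a vector space `V`, multiplicative like `⊕_k N_k`. -/
structure PreRep (e : OpenPartialHomeomorph X X) (V : Type*) [AddCommGroup V] [Module ℂ V] where
  toFun : ∀ k : ℤ, N e k →ₗ[ℂ] V →ₗ[ℂ] V
  map_mul : ∀ (k l : ℤ) (f : N e k) (g : N e l) (v : V),
    toFun k f (toFun l g v) = toFun (k + l) (mulN f g) v

namespace PreRep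

variable {V : Type*} [AddCommGroup V] [Module ℂ V]

/-- The action of `⊕_k N_k` on `V`. -/
noncomputable def sum (T : PreRep e V) : SymAlg e →ₗ[ℂ] V →ₗ[ℂ] V :=
  (DFinsupp.lsum ℂ fun k => T.toFun k : (Π₀ k : ℤ, N e k) →ₗ[ℂ] V →ₗ[ℂ] V)

theorem sum_single (T : PreRep e V) (k : ℤ) (f : N e k) :
    T.sum (SymAlg.single k f) = T.toFun k f :=
  DFinsupp.lsum_single _ _ _ _

variable {K : Type*} [NormedAddCommGroup K] [InnerProductSpace ℂ K]

/-- The map `j` into a Hilbert space turns `T` into a bounded `*`-representation. -/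
structure IsStar (T : PreRep e V) (j : V →ₗ[ℂ] K) : Prop where
  inner_map : ∀ (k : ℤ) (f : N e k) (v w : V),
    inner ℂ (j (T.toFun k f v)) (j w) = inner ℂ (j v) (j (T.toFun (-k) (starN f) w))
  norm_map : ∀ (k : ℤ) (f : N e k) (v : V), ‖j (T.toFun k f v)‖ ≤ ‖f‖ * ‖j v‖

variable [CompleteSpace K]

/-- The operator on `K` induced by `T.toFun k f`. -/
noncomputable def ext (T : PreRep e V) (j : V →ₗ[ℂ] K) (k : ℤ) (f : N e k) : K →L[ℂ] K :=
  LinearMap.extendOfNorm (j ∘ₗ T.toFun k f) j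

theorem ext_apply {T : PreRep e V} {j : V →ₗ[ℂ] K} (hj : DenseRange j) (hT : T.IsStar j)
    (k : ℤ) (f : N e k) (v : V) : T.ext j k f (j v) = j (T.toFun k f v) :=
  LinearMap.extendOfNorm_eq hj ⟨‖f‖, hT.norm_map k f⟩ v

theorem ext_mul {T : PreRep e V} {j : V →ₗ[ℂ] K} (hj : DenseRange j) (hT : T.IsStar j)
    (k l : ℤ) (f : N e k) (g : N e l) (x : K) :
    T.ext j k f (T.ext j l g x) = T.ext j (k + l) (mulN f g) x := by
  refine hj.induction_on x (isClosed_eq (by fun_prop) (by fun_prop)) fun v => ?_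
  simp only [ext_apply hj hT, T.map_mul]

theorem ext_adjoint {T : PreRep e V} {j : V →ₗ[ℂ] K} (hj : DenseRange j) (hT : T.IsStar j)
    (k : ℤ) (f : N e k) : ContinuousLinearMap.adjoint (T.ext j k f) = T.ext j (-k) (starN f) := by
  symm
  rw [ContinuousLinearMap.eq_adjoint_iff]
  intro x y
  refine hj.induction_on x (isClosed_eq (by fun_prop) (by fun_prop)) fun v => ?_
  refine hj.induction_on y (isClosed_eq (by fun_prop) (by fun_prop)) fun w => ?_
  rw [ext_apply hj hT, ext_apply hj hT, ← inner_conj_symm, ← inner_conj_symm (j v),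
    hT.inner_map]

/-- The representation on `ℓ²(ℕ)` obtained from `T` and an embedding of `K`. -/
noncomputable def toRep (T : PreRep e V) {j : V →ₗ[ℂ] K} (hj : DenseRange j) (hT : T.IsStar j)
    (U : K →ₗᵢ[ℂ] lp (fun _ : ℕ => ℂ) 2) : Rep e where
  toFun k :=
    { toFun := fun f => U.toContinuousLinearMap ∘L T.ext j k f ∘L
        ContinuousLinearMap.adjoint U.toContinuousLinearMap
      map_add' := fun f g => by
        have : T.ext j k (f + g) = T.ext j k f + T.ext j k g := by
          ext x
          refine hj.induction_on x (isClosed_eq (by fun_prop) (by fun_prop)) fun v => ?_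
          simp [ext_apply hj hT]
        rw [this, ContinuousLinearMap.add_comp, ContinuousLinearMap.comp_add]
      map_smul' := fun c f => by
        have : T.ext j k (c • f) = c • T.ext j k f := by
          ext x
          refine hj.induction_on x (isClosed_eq (by fun_prop) (by fun_prop)) fun v => ?_
          simp [ext_apply hj hT]
        rw [this, ContinuousLinearMap.smul_comp, ContinuousLinearMap.comp_smul]; rfl }
  map_mul k l f g := by
    ext1 x
    -- `U* U = 1` makes `S ↦ U S U*` multiplicative. The resulting representation is zero on the
    -- complement of the range of `U`, which is allowed.
    have h : ∀ y, ContinuousLinearMap.adjoint U.toContinuousLinearMap (U y) = y := fun y =>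
      congrArg (fun S : K →L[ℂ] K => S y)
        ((ContinuousLinearMap.isometry_iff_adjoint_comp_self U.toContinuousLinearMap).1
          U.isometry)
    change U (T.ext j k f (ContinuousLinearMap.adjoint U.toContinuousLinearMap
      (U (T.ext j l g _)))) = U (T.ext j (k + l) (mulN f g) _)
    rw [h, ext_mul hj hT]
  map_star k f := by
    change ContinuousLinearMap.adjoint _ = (_ : Bop)
    simp only [LinearMap.coe_mk, AddHom.coe_mk]
    rw [ContinuousLinearMap.adjoint_comp, ContinuousLinearMap.adjoint_comp,
      ContinuousLinearMap.adjoint_adjoint, ext_adjoint hj hT, ContinuousLinearMap.comp_assoc]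

theorem toRep_sum (T : PreRep e V) {j : V →ₗ[ℂ] K} (hj : DenseRange j) (hT : T.IsStar j)
    (U : K →ₗᵢ[ℂ] lp (fun _ : ℕ => ℂ) 2) (x : SymAlg e) (v : V) :
    (T.toRep hj hT U).sum x (U (j v)) = U (j (T.sum x v)) := by
  have h : ∀ y, ContinuousLinearMap.adjoint U.toContinuousLinearMap (U y) = y := fun y =>
    congrArg (fun S : K →L[ℂ] K => S y)
      ((ContinuousLinearMap.isometry_iff_adjoint_comp_self U.toContinuousLinearMap).1
        U.isometry)
  induction x using dfinsupp_induction with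
  | zero => simp
  | add x y hx hy => simp [hx, hy]
  | single k f =>
    rw [Rep.sum_single, sum_single]
    change U (T.ext j k f (ContinuousLinearMap.adjoint U.toContinuousLinearMap (U (j v)))) = _
    rw [h, ext_apply hj hT]

/-- An isometry of `K` into `ℓ²(ℕ)` carries `T` to one of the representations over which the
universal norm is a supremum. -/
theorem norm_sum_le_of_dense [TopologicalSpace.SeparableSpace K] (T : PreRep e V)
    {j : V →ₗ[ℂ] K} (hj : DenseRange j)
    (hT : T.IsStar j) (x : SymAlg e) (v : V) : ‖j (T.sum x v)‖ ≤ ‖symSum e x‖ * ‖j v‖ := by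
  obtain ⟨U⟩ := exists_linearIsometry_l2 K
  rw [← U.norm_map, ← toRep_sum T hj hT U, ← U.norm_map (j v)]
  refine (ContinuousLinearMap.le_opNorm _ _).trans ?_
  rw [← Rep.eval_symSum]
  gcongr
  exact Rep.norm_eval_le _ _

/-- The norm of the crossed product dominates every `*`-representation of `⊕_k N_k` by bounded
operators on a separable pre-Hilbert space. -/
theorem norm_sum_le {L : Type*} [NormedAddCommGroup L] [InnerProductSpace ℂ L] [CompleteSpace L]
    [SecondCountableTopology L] (T : PreRep e V) {j : V →ₗ[ℂ] L}
    (hT : T.IsStar j) (x : SymAlg e) (v : V) : ‖j (T.sum x v)‖ ≤ ‖symSum e x‖ * ‖j v‖ := by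
  -- The operators are only determined on the closure of the range of `j`, so `L` is replaced by it.
  let K := (LinearMap.range j).topologicalClosure
  have : CompleteSpace K := Submodule.topologicalClosure.completeSpace _
  let j' : V →ₗ[ℂ] K := j.codRestrict K fun v => Submodule.le_topologicalClosure _ ⟨v, rfl⟩
  have hj : DenseRange j' := by
    intro y
    refine Metric.mem_closure_iff.2 fun ε hε => ?_
    obtain ⟨_, ⟨v, rfl⟩, hv⟩ := Metric.mem_closure_iff.1 (show (y : L) ∈
      closure (LinearMap.range j : Set L) from y.2) ε hε
    exact ⟨_, ⟨v, rfl⟩, hv⟩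
  exact T.norm_sum_le_of_dense (j := j') hj ⟨fun k f v w => hT.inner_map k f v w,
    fun k f v => hT.norm_map k f v⟩ x v

end PreRep
end PartialCrossedProduct

/-! ### The Fejér kernel -/

/-- The Fourier coefficients `(1 - |k| / n)₊` of the Fejér kernel. -/
noncomputable def fejer (n : ℕ) (k : ℤ) : ℝ :=
  (n : ℝ)⁻¹ * ∑ i ∈ Finset.range n, ∑ j ∈ Finset.range n, if (i : ℤ) + k = j then 1 else 0

theorem sum_ite_add_eq (n i : ℕ) (k : ℤ) :
    (∑ j ∈ Finset.range n, if (i : ℤ) + k = j then (1 : ℝ) else 0) =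
      if 0 ≤ (i : ℤ) + k ∧ (i : ℤ) + k < n then 1 else 0 := by
  split_ifs with h
  · rw [Finset.sum_eq_single ((i : ℤ) + k).toNat]
    · rw [if_pos (by omega)]
    · intro j _ hj; rw [if_neg (by omega)]
    · intro hj; rw [Finset.mem_range] at hj; omega
  · refine Finset.sum_eq_zero fun j hj => if_neg ?_
    rw [Finset.mem_range] at hj; omega

theorem fejer_nonneg (n : ℕ) (k : ℤ) : 0 ≤ fejer n k := by
  unfold fejer; positivity

theorem fejer_le_one (n : ℕ) (k : ℤ) : fejer n k ≤ 1 := by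
  rcases Nat.eq_zero_or_pos n with rfl | hn
  · simp [fejer]
  have hn' : (0 : ℝ) < n := by exact_mod_cast hn
  rw [fejer, inv_mul_le_iff₀ hn', mul_one]
  calc _ ≤ ∑ i ∈ Finset.range n, (1 : ℝ) := by
        refine Finset.sum_le_sum fun i _ => ?_
        rw [sum_ite_add_eq]; split_ifs <;> norm_num
    _ = n := by simp

theorem fejer_eq_zero {n : ℕ} {k : ℤ} (h : (n : ℤ) ≤ |k|) : fejer n k = 0 := by
  rw [fejer, Finset.sum_eq_zero, mul_zero]
  intro i hi
  rw [Finset.mem_range] at hi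
  rw [sum_ite_add_eq, if_neg]
  rcases abs_cases k with h1 | h1 <;> omega

/-- The defect counts the `i < n` for which `i + k` leaves `[0, n)`: these are among the last `k`
indices if `k ≥ 0`, among the first `|k|` if `k ≤ 0`. -/
theorem one_sub_fejer_le {n : ℕ} (hn : 0 < n) (k : ℤ) : 1 - fejer n k ≤ |(k : ℝ)| / n := by
  have hn' : (0 : ℝ) < n := by exact_mod_cast hn
  have h1 : 1 - fejer n k = (∑ i ∈ Finset.range n,
      if 0 ≤ (i : ℤ) + k ∧ (i : ℤ) + k < n then (0 : ℝ) else 1) / n := by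
    have h2 : ∀ i ∈ Finset.range n, (if 0 ≤ (i : ℤ) + k ∧ (i : ℤ) + k < n then (0 : ℝ) else 1) +
        (∑ j ∈ Finset.range n, if (i : ℤ) + k = j then (1 : ℝ) else 0) = 1 := fun i _ => by
      rw [sum_ite_add_eq]; split_ifs <;> norm_num
    rw [fejer, eq_div_iff hn'.ne', sub_mul, one_mul, mul_comm, ← mul_assoc,
      mul_inv_cancel₀ hn'.ne', one_mul, sub_eq_iff_eq_add, ← Finset.sum_add_distrib,
      Finset.sum_congr rfl h2]
    simp
  rw [h1]
  gcongr
  rw [Finset.sum_ite, Finset.sum_const_zero, zero_add, Finset.sum_const, nsmul_eq_mul, mul_one]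
  have h2 : (Finset.filter (fun i : ℕ => ¬ (0 ≤ (i : ℤ) + k ∧ (i : ℤ) + k < n))
      (Finset.range n)).card ≤ k.natAbs := by
    rcases le_total 0 k with h | h
    · calc _ ≤ (Finset.Ico (n - k.natAbs) n).card := by
            refine Finset.card_le_card fun i hi => ?_
            simp only [Finset.mem_filter, Finset.mem_range, Finset.mem_Ico] at hi ⊢
            omega
        _ ≤ _ := by rw [Nat.card_Ico]; omega
    · calc _ ≤ (Finset.range k.natAbs).card := by
            refine Finset.card_le_card fun i hi => ?_
            simp only [Finset.mem_filter, Finset.mem_range] at hi ⊢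
            omega
        _ = _ := Finset.card_range _
  calc _ ≤ ((k.natAbs : ℕ) : ℝ) := by exact_mod_cast h2
    _ = _ := by rw [Nat.cast_natAbs, Int.cast_abs]

theorem tendsto_fejer (k : ℤ) :
    Filter.Tendsto (fun n => fejer n k) Filter.atTop (nhds 1) := by
  have h1 : Filter.Tendsto (fun n : ℕ => 1 - |(k : ℝ)| / n) Filter.atTop (nhds 1) := by
    have := (tendsto_const_div_atTop_nhds_zero_nat |(k : ℝ)|).const_sub 1
    simpa using this
  refine tendsto_of_tendsto_of_tendsto_of_le_of_le' h1 tendsto_const_nhds ?_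
    (Filter.Eventually.of_forall fun n => fejer_le_one n k)
  filter_upwards [Filter.eventually_gt_atTop 0] with n hn
  linarith [one_sub_fejer_le hn k]

/-- The Fejér kernel is a positive function, integrated over roots of unity. -/
theorem fejer_eq_sum {n : ℕ} (m : ℕ) [NeZero m] {k : ℤ} (hk : n + |k| ≤ m) :
    (fejer n k : ℂ) = ∑ r : ZMod m, (((n : ℝ)⁻¹ * (m : ℝ)⁻¹ *
      ‖∑ i ∈ Finset.range n, ((ZMod.toCircle r : Circle) : ℂ) ^ i‖ ^ 2 : ℝ) : ℂ) *
        ((ZMod.toCircle r : Circle) : ℂ) ^ k := by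
  have hm : (m : ℂ) ≠ 0 := by exact_mod_cast NeZero.ne m
  -- Orthogonality of characters on the `m`-th roots of unity; `|l| < m` ensures that `l` is
  -- divisible by `m` only if it is zero.
  have key : ∀ l : ℤ, |l| < m → ∑ r : ZMod m, ((ZMod.toCircle r : Circle) : ℂ) ^ l =
      if l = 0 then (m : ℂ) else 0 := by
    intro l hl
    have h1 := AddChar.sum_mulShift (l : ZMod m) (ZMod.isPrimitive_stdAddChar m)
    rw [ZMod.card] at h1
    have h2 : ((l : ZMod m) = 0) ↔ l = 0 := by
      rw [ZMod.intCast_zmod_eq_zero_iff_dvd]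
      exact ⟨fun h => Int.eq_zero_of_abs_lt_dvd h hl, fun h => h ▸ dvd_zero _⟩
    simp only [h2] at h1
    refine Eq.trans ?_ (h1.trans (by split_ifs <;> simp))
    refine Finset.sum_congr rfl fun r _ => ?_
    rw [mul_comm, ← zsmul_eq_mul, AddChar.map_zsmul_eq_zpow]
    rfl
  have h3 : ∀ r : ZMod m, (((n : ℝ)⁻¹ * (m : ℝ)⁻¹ *
      ‖∑ i ∈ Finset.range n, ((ZMod.toCircle r : Circle) : ℂ) ^ i‖ ^ 2 : ℝ) : ℂ) *
        ((ZMod.toCircle r : Circle) : ℂ) ^ k = (n : ℂ)⁻¹ * (m : ℂ)⁻¹ * ∑ i ∈ Finset.range n,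
          ∑ j ∈ Finset.range n, ((ZMod.toCircle r : Circle) : ℂ) ^ ((i : ℤ) + k - j) := by
    intro r
    push_cast
    rw [← Complex.mul_conj', map_sum, Finset.sum_mul_sum, mul_assoc _ (Finset.sum _ _),
      Finset.sum_mul]
    congr 1
    refine Finset.sum_congr rfl fun i _ => ?_
    rw [Finset.sum_mul]
    refine Finset.sum_congr rfl fun j _ => ?_
    have h0 : ((ZMod.toCircle r : Circle) : ℂ) ≠ 0 := Circle.coe_ne_zero _
    rw [map_pow, ← Circle.coe_inv_eq_conj, Circle.coe_inv, zpow_sub₀ h0, zpow_add₀ h0,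
      zpow_natCast, zpow_natCast, inv_pow, div_eq_mul_inv]
    ring
  rw [Finset.sum_congr rfl fun r _ => h3 r, ← Finset.mul_sum, Finset.sum_comm, fejer]
  push_cast
  rw [mul_assoc]
  congr 1
  rw [Finset.mul_sum]
  refine Finset.sum_congr rfl fun i hi => ?_
  rw [Finset.sum_comm, Finset.mul_sum]
  refine Finset.sum_congr rfl fun j hj => ?_
  rw [Finset.mem_range] at hi hj
  -- The exponent is `i + k - j` with `|i - j| < n`, so its modulus is below `n + |k| ≤ m`.
  rw [key _ (by rcases abs_cases k with h | h <;> rw [abs_lt] <;> omega)]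
  simp only [sub_eq_zero]
  split_ifs
  · rw [inv_mul_cancel₀ hm, Complex.ofReal_one]
  · rw [mul_zero, Complex.ofReal_zero]

/-! ### Gauge action and Fejér means on the crossed product -/

namespace PartialCrossedProduct

variable {X : Type} [TopologicalSpace X] [T2Space X] {e : OpenPartialHomeomorph X X}

/-- The map `Σ s^k f_k ↦ Σ c_k s^k f_k`. -/
noncomputable def coeffMul (c : ℤ → ℂ) : SymAlg e →ₗ[ℂ] SymAlg e :=
  (DFinsupp.mapRange.linearMap fun k => c k • LinearMap.id :
    (Π₀ k : ℤ, N e k) →ₗ[ℂ] (Π₀ k : ℤ, N e k))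

theorem coeffMul_single (c : ℤ → ℂ) (k : ℤ) (f : N e k) :
    coeffMul c (SymAlg.single k f) = c k • SymAlg.single k f := by
  refine (DFinsupp.mapRange_single (hf := fun k => (c k • LinearMap.id).map_zero)).trans ?_
  exact DFinsupp.single_smul (β := fun k : ℤ => N e k) (c k) f

/-- The coefficient `f_k` of `Σ s^k f_k`. -/
noncomputable def coeff (k : ℤ) : SymAlg e →ₗ[ℂ] N e k :=
  (DFinsupp.lapply k : (Π₀ k : ℤ, N e k) →ₗ[ℂ] N e k)

theorem coeff_single_same (k : ℤ) (f : N e k) : coeff k (SymAlg.single k f) = f :=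
  DFinsupp.single_eq_same

theorem coeff_single_ne {k l : ℤ} (h : l ≠ k) (f : N e k) : coeff l (SymAlg.single k f) = 0 :=
  DFinsupp.single_eq_of_ne h

theorem exists_bound_coeff (x : SymAlg e) : ∃ M : ℕ, ∀ k : ℤ, (M : ℤ) < |k| → coeff k x = 0 := by
  induction x using dfinsupp_induction with
  | zero => exact ⟨0, fun k _ => map_zero _⟩
  | add x y hx hy =>
    obtain ⟨M, hM⟩ := hx
    obtain ⟨M', hM'⟩ := hy
    refine ⟨max M M', fun k hk => ?_⟩
    push_cast at hk
    rw [map_add, hM k (lt_of_le_of_lt (le_max_left _ _) hk),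
      hM' k (lt_of_le_of_lt (le_max_right _ _) hk), add_zero]
  | single l f =>
    refine ⟨l.natAbs, fun k hk => coeff_single_ne ?_ f⟩
    rintro rfl
    rw [Int.natCast_natAbs] at hk
    exact lt_irrefl _ hk

theorem coeffMul_congr {c d : ℤ → ℂ} (x : SymAlg e) (h : ∀ k, coeff k x ≠ 0 → c k = d k) :
    coeffMul c x = coeffMul d x := by
  refine DFinsupp.ext fun k => ?_
  change c k • coeff k x = d k • coeff k x
  by_cases hk : coeff k x = 0
  · rw [hk, smul_zero, smul_zero]
  · rw [h k hk]

theorem coeffMul_sum {ι : Type*} (s : Finset ι) (c : ι → ℤ → ℂ) (x : SymAlg e) :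
    coeffMul (fun k => ∑ i ∈ s, c i k) x = ∑ i ∈ s, coeffMul (c i) x := by
  induction x using dfinsupp_induction with
  | zero => simp
  | add x y hx hy => simp only [map_add, hx, hy, Finset.sum_add_distrib]
  | single k f => simp only [coeffMul_single, Finset.sum_smul]

theorem coeffMul_mul (c : ℂ) (d : ℤ → ℂ) (x : SymAlg e) :
    coeffMul (fun k => c * d k) x = c • coeffMul d x := by
  induction x using dfinsupp_induction with
  | zero => simp
  | add x y hx hy => simp only [map_add, hx, hy, smul_add]
  | single k f => simp only [coeffMul_single, smul_smul]

/-- The representation `s^k f ↦ w^k ρ(s^k f)`. -/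
noncomputable def Rep.gauge (ρ : Rep e) (w : Circle) : Rep e where
  toFun k := ((w : ℂ) ^ k) • ρ.toFun k
  map_mul k l f g := by
    simp only [LinearMap.smul_apply]
    rw [smul_mul_smul_comm, ρ.map_mul, zpow_add₀ (Circle.coe_ne_zero _)]
  map_star k f := by
    simp only [LinearMap.smul_apply]
    rw [star_smul, ρ.map_star, star_zpow₀, zpow_neg, ← inv_zpow, ← Circle.coe_inv,
      Circle.coe_inv_eq_conj]
    rfl

theorem Rep.gauge_sum (ρ : Rep e) (w : Circle) (x : SymAlg e) :
    (ρ.gauge w).sum x = ρ.sum (coeffMul (fun k => (w : ℂ) ^ k) x) := by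
  induction x using dfinsupp_induction with
  | zero => simp
  | add x y hx hy => simp only [map_add, hx, hy]
  | single k f =>
    rw [coeffMul_single, map_smul, Rep.sum_single, Rep.sum_single]; rfl

/-- Twisting a representation by `w^k` in degree `k` gives another representation, which already
takes part in the supremum that defines the norm. -/
theorem norm_gauge_le (w : Circle) (x : SymAlg e) :
    ‖symSum e (coeffMul (fun k => (w : ℂ) ^ k) x)‖ ≤ ‖symSum e x‖ := by
  refine norm_le_of_eval _ (norm_nonneg _) fun ρ => ?_
  rw [Rep.eval_symSum, ← Rep.gauge_sum, ← Rep.eval_symSum]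
  exact Rep.norm_eval_le _ _

/-- The Fejér mean of a finite sum is a convex combination of gauge twists by roots of unity, and
each twist is contractive. -/
theorem norm_fejer_le {n : ℕ} (hn : 0 < n) (x : SymAlg e) :
    ‖symSum e (coeffMul (fun k => fejer n k) x)‖ ≤ ‖symSum e x‖ := by
  obtain ⟨M, hM⟩ := exists_bound_coeff x
  -- With `M` bounding the degrees in `x`, roots of unity of order `n + M` make the quadrature in
  -- `fejer_eq_sum` exact for every degree that occurs.
  have : NeZero (n + M) := ⟨by omega⟩
  let W : ZMod (n + M) → ℝ := fun r => (n : ℝ)⁻¹ * ((n + M : ℕ) : ℝ)⁻¹ *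
      ‖∑ i ∈ Finset.range n, ((ZMod.toCircle r : Circle) : ℂ) ^ i‖ ^ 2
  -- The total weight is the zeroth Fejér coefficient.
  have hW : ∑ r, W r = 1 := by
    have h1 := fejer_eq_sum (n := n) (n + M) (k := 0) (by simp)
    simp only [zpow_zero, mul_one] at h1
    rw [← Complex.ofReal_sum] at h1
    rw [← Complex.ofReal_injective h1]
    refine le_antisymm (fejer_le_one _ _) ?_
    have := one_sub_fejer_le hn 0
    simp only [Int.cast_zero, abs_zero, zero_div] at this
    linarith
  rw [coeffMul_congr x (d := fun k => ∑ r, (W r : ℂ) *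
    ((ZMod.toCircle r : Circle) : ℂ) ^ k) fun k hk => fejer_eq_sum (n + M) ?_]
  · rw [coeffMul_sum, map_sum]
    calc _ ≤ ∑ r, W r * ‖symSum e x‖ := by
          refine norm_sum_le_of_le _ fun r _ => ?_
          rw [coeffMul_mul, map_smul, norm_smul, Complex.norm_real,
            Real.norm_of_nonneg (by positivity)]
          exact mul_le_mul_of_nonneg_left (norm_gauge_le _ _) (by positivity)
      _ = _ := by rw [← Finset.sum_mul, hW, one_mul]
  · have : |k| ≤ M := by by_contra h; exact hk (hM k (not_le.1 h))
    push_cast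
    omega

theorem tendsto_fejer_symSum (x : SymAlg e) :
    Filter.Tendsto (fun n : ℕ => symSum e (coeffMul (fun k => fejer n k) x)) Filter.atTop
      (nhds (symSum e x)) := by
  induction x using dfinsupp_induction with
  | zero => simp
  | add x y hx hy => simpa only [map_add] using hx.add hy
  | single k f =>
    simp only [coeffMul_single, map_smul]
    have h := ((Complex.continuous_ofReal.tendsto _).comp (tendsto_fejer k)).smul_const
      (symSum e (SymAlg.single k f))
    simpa using h

theorem symSum_fejer (n : ℕ) (x : SymAlg e) :
    symSum e (coeffMul (fun k => fejer n k) x) =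
      ∑ k ∈ Finset.Ioo (-(n : ℤ)) n, (fejer n k : ℂ) • sym e k (coeff k x) := by
  induction x using dfinsupp_induction with
  | zero => simp
  | add x y hx hy => simp only [map_add, hx, hy, smul_add, Finset.sum_add_distrib]
  | single l f =>
    rw [coeffMul_single, map_smul, symSum_single, Finset.sum_eq_single l]
    · rw [coeff_single_same]
    · intro k _ hk
      rw [coeff_single_ne hk, map_zero, smul_zero]
    · intro hl
      rw [fejer_eq_zero, Complex.ofReal_zero, zero_smul]
      rw [Finset.mem_Ioo, ← abs_lt] at hl
      exact not_lt.1 hl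

end PartialCrossedProduct

/-! ### The points of `H` and its compact subsets -/

namespace QTri

theorem sqrt_div_eq {q : ℝ} (hq : 0 < q) (j n : ℕ) :
    √(q ^ j / q ^ n) = q ^ j * √(q / q ^ (j + n + 1)) := by
  have h : q ^ j / q ^ n = (q ^ j * √(q / q ^ (j + n + 1))) ^ 2 := by
    rw [mul_pow, Real.sq_sqrt (by positivity), pow_succ, pow_add]
    field_simp
    ring
  rw [h, Real.sqrt_sq (by positivity)]

/-- Write `t = q^(i+1)` and `a = q^j √(q/t)`. The lower end of the interval for `a` says exactly `j
≤ i`, and `n = i - j` gives `a² = q^(2j-i) = q^(j-n)`. The two exponents `j` and `n` are then free,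
which makes the fibre a lattice quadrant. -/
theorem mem_HSet_iff {q : ℝ} (hq : 0 < q) (hq1 : q < 1) (t a : ℝ) :
    (q, t, a) ∈ HSet ↔ ∃ j n : ℕ, t = q ^ (j + n + 1) ∧ a = √(q ^ j / q ^ n) := by
  constructor
  · rintro ⟨h1, h2, h3, h4⟩
    simp only at h1 h2 h3 h4
    rcases h3 with ⟨h, _⟩ | ⟨_, i, hi⟩
    · exact absurd h hq1.ne
    rcases h4 with ⟨h, _⟩ | ⟨_, h6, h7⟩
    · exact absurd h hq1.ne
    rcases h6 with ⟨h, _⟩ | ⟨_, j, hj⟩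
    · exact absurd h hq1.ne
    have hij : j ≤ i := by
      -- If `j = i + m + 1` then `a = q^m · q √(t/q)`, one of the points removed from the interval.
      by_contra hij
      push Not at hij
      obtain ⟨m, rfl⟩ := Nat.exists_eq_add_of_lt hij
      refine h7 (Or.inr ⟨hq1.ne, m, ?_⟩)
      have ht : 0 < t := by rw [hi]; positivity
      have h8 : √(t / q) = q ^ i * √(q / t) := by
        have h9 : t / q = (q ^ i * √(q / t)) ^ 2 := by
          rw [mul_pow, Real.sq_sqrt (by positivity), hi]
          field_simp
        rw [h9, Real.sqrt_sq (by positivity)]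
      rw [h8, hj]; ring
    obtain ⟨n, rfl⟩ := Nat.exists_eq_add_of_le hij
    refine ⟨j, n, by rw [hi, pow_succ], ?_⟩
    rw [sqrt_div_eq hq, hj, hi, pow_succ]
  · rintro ⟨j, n, rfl, rfl⟩
    refine ⟨hq, hq1.le, Or.inr ⟨hq1.ne, j + n, pow_succ _ _⟩,
      Or.inr ⟨hq1.ne, Or.inr ⟨hq1.ne, j, sqrt_div_eq hq j n⟩, ?_⟩⟩
    rintro (⟨h, _⟩ | ⟨_, m, hm⟩)
    · exact hq1.ne h
    · simp only at hm
      have h1 : q ^ j / q ^ n = (q ^ m * (q * √(q ^ (j + n + 1) / q))) ^ 2 := by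
        rw [← hm, Real.sq_sqrt (by positivity)]
      have h2 : q ^ (j + n + 1) / q = q ^ (j + n) := by rw [pow_succ]; field_simp
      rw [h2, mul_pow, mul_pow, Real.sq_sqrt (by positivity), div_eq_iff (by positivity)] at h1
      have h3 : q ^ j = q ^ (m * 2 + 2 + (j + n) + n) := by rw [h1]; ring
      have := pow_right_injective₀ hq hq1.ne h3
      omega

/-- The point of `H_q` with `t = q ^ (j + n + 1)` and `a² = q ^ (j - n)`. -/
noncomputable def pt (q : Base) (j n : ℕ) : H :=
  ⟨(q.1, q.1 ^ (j + n + 1), √(q.1 ^ j / q.1 ^ n)), by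
    rcases q.2.2.lt_or_eq with h | h
    · exact (mem_HSet_iff q.2.1 h _ _).2 ⟨j, n, rfl, rfl⟩
    -- At `q = 1` the point is `(1, 1, 1)`, so that `q ↦ pt q j n` is a continuous section over the
    -- whole base.
    · simp [h, HSet, qIoc, qIcc]⟩

theorem proj_pt (q : Base) (j n : ℕ) : proj (pt q j n) = q := rfl

theorem continuous_pt (j n : ℕ) : Continuous fun q => pt q j n := by
  refine Continuous.subtype_mk ?_ _
  refine (by fun_prop : Continuous fun q : Base => q.1).prodMk
    ((by fun_prop : Continuous fun q : Base => q.1 ^ (j + n + 1)).prodMk ?_)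
  refine Continuous.sqrt (Continuous.div (by fun_prop) (by fun_prop) fun q => ?_)
  exact pow_ne_zero _ q.2.1.ne'

theorem exists_eq_pt {q : Base} (hq : q.1 ≠ 1) (p : H) (hp : proj p = q) :
    ∃ j n, p = pt q j n := by
  subst hp
  obtain ⟨⟨q, t, a⟩, hp⟩ := p
  obtain ⟨j, n, ht, ha⟩ := (mem_HSet_iff hp.1 (lt_of_le_of_ne hp.2.1 hq) t a).1 hp
  exact ⟨j, n, Subtype.ext (Prod.ext rfl (Prod.ext ht ha))⟩

theorem pt_injective {q : Base} (hq : q.1 ≠ 1) :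
    Function.Injective fun x : ℕ × ℕ => pt q x.1 x.2 := by
  rintro ⟨j, n⟩ ⟨j', n'⟩ h
  have hq0 := q.2.1
  have h1 : q.1 ^ (j + n + 1) = q.1 ^ (j' + n' + 1) := congrArg (fun p : H => p.1.2.1) h
  have h2 : √(q.1 ^ j / q.1 ^ n) = √(q.1 ^ j' / q.1 ^ n') := congrArg (fun p : H => p.1.2.2) h
  have h3 := pow_right_injective₀ hq0 hq h1
  rw [Real.sqrt_inj (by positivity) (by positivity),
    div_eq_div_iff (by positivity) (by positivity), ← pow_add, ← pow_add] at h2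
  have h4 := pow_right_injective₀ hq0 hq h2
  simp only [Prod.mk.injEq]
  omega

/-- The points of `H_q`, `q < 1`, are indexed by `ℕ × ℕ`. -/
noncomputable def fibreEquiv {q : Base} (hq : q.1 ≠ 1) : ℕ × ℕ ≃ {p : H // proj p = q} :=
  Equiv.ofBijective (fun x => ⟨pt q x.1 x.2, proj_pt q _ _⟩) ⟨fun x y h =>
    pt_injective hq (congrArg Subtype.val h), fun p => by
      obtain ⟨j, n, h⟩ := exists_eq_pt hq p.1 p.2
      exact ⟨(j, n), Subtype.ext h.symm⟩⟩

theorem pt_a_sq (q : Base) (j n : ℕ) : (pt q j n).1.2.2 ^ 2 = q.1 ^ j / q.1 ^ n :=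
  Real.sq_sqrt (div_nonneg (pow_nonneg q.2.1.le _) (pow_nonneg q.2.1.le _))

/-- For `q < 1` these compare powers of `q` with exponents built from `j, n ≥ 0`; for `q = 1` they
are the defining conditions. Being polynomial and uniform in `q`, they survive limits `q → 1`. -/
theorem H_bounds (p : H) : p.1.2.1 ≤ p.1.1 ∧ p.1.2.1 ≤ p.1.1 * p.1.2.2 ^ 2 ∧
    p.1.2.2 ^ 2 * p.1.2.1 ≤ p.1.1 := by
  by_cases hq : (proj p).1 = 1
  · have ht := t_pos p
    have ha := a_pos p
    obtain ⟨⟨q, t, a⟩, h1, h2, h3, h4⟩ := p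
    obtain rfl : q = 1 := hq
    simp only [qIoc, qIcc, ne_eq, not_true_eq_false, false_and, or_false, true_and, div_one,
      Set.mem_ofPred_eq] at h3 h4 ht ha ⊢
    refine ⟨h3.2, ?_, ?_⟩
    · rw [one_mul]; exact (Real.sqrt_le_left ha.le).1 h4.1
    · exact (le_div_iff₀ ht).1 ((Real.le_sqrt' ha).1 h4.2)
  · obtain ⟨j, n, h⟩ := exists_eq_pt hq p rfl
    have h0 := q_pos p
    have h1 : p.1.1 ≤ 1 := p.2.2.1
    have ht : p.1.2.1 = p.1.1 ^ (j + n + 1) := congrArg (fun p : H => p.1.2.1) h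
    have ha : p.1.2.2 ^ 2 = p.1.1 ^ j / p.1.1 ^ n :=
      (congrArg (fun p : H => p.1.2.2 ^ 2) h).trans (pt_a_sq _ _ _)
    rw [ht, ha]
    refine ⟨pow_le_of_le_one h0.le h1 (by omega), ?_, ?_⟩
    · rw [← mul_div_assoc, le_div_iff₀ (by positivity), ← pow_add, ← pow_succ']
      exact pow_le_pow_of_le_one h0.le h1 (by omega)
    · rw [div_mul_eq_mul_div, div_le_iff₀ (by positivity), ← pow_add, ← pow_succ']
      exact pow_le_pow_of_le_one h0.le h1 (by omega)

theorem mem_HSet_one {t a : ℝ} (ht : 0 < t) (ht1 : t ≤ 1) (ha : 0 ≤ a) (h1 : t ≤ a ^ 2)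
    (h2 : a ^ 2 * t ≤ 1) : ((1 : ℝ), t, a) ∈ HSet := by
  refine ⟨one_pos, le_rfl, Or.inl ⟨rfl, ht, ht1⟩, Or.inl ⟨rfl, ?_, ?_⟩⟩
  · simp only [div_one]; exact (Real.sqrt_le_left ha).2 h1
  · exact Real.le_sqrt_of_sq_le ((le_div_iff₀ ht).2 h2)

/-- A limit point over `q = 1` is in `H` because the inequalities of `H_bounds` pass to the limit. A
limit point over `q < 1` is approached with `q < r < 1`, where `t = q^(j+n+1) ≥ ε` leaves finitely
many pairs `(j, n)`, each contributing a closed curve. -/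
theorem isClosed_tge {ε : ℝ} (hε : 0 < ε) : IsClosed {p : ℝ × ℝ × ℝ | p ∈ HSet ∧ ε ≤ p.2.1} := by
  set S := {p : ℝ × ℝ × ℝ | p ∈ HSet ∧ ε ≤ p.2.1} with hS
  let B : Set (ℝ × ℝ × ℝ) := {p | ε ≤ p.2.1} ∩ {p | p.2.1 ≤ p.1} ∩ {p | p.1 ≤ 1} ∩
    {p | 0 ≤ p.2.2} ∩ {p | p.2.1 ≤ p.1 * p.2.2 ^ 2} ∩ {p | p.2.2 ^ 2 * p.2.1 ≤ p.1}
  have hB : IsClosed B := by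
    refine (((((isClosed_le ?_ ?_).inter (isClosed_le ?_ ?_)).inter (isClosed_le ?_ ?_)).inter
      (isClosed_le ?_ ?_)).inter (isClosed_le ?_ ?_)).inter (isClosed_le ?_ ?_) <;> fun_prop
  have hSB : S ⊆ B := by
    rintro p ⟨hp, ht⟩
    have := H_bounds ⟨p, hp⟩
    exact ⟨⟨⟨⟨⟨ht, this.1⟩, hp.2.1⟩, (a_pos ⟨p, hp⟩).le⟩, this.2.1⟩, this.2.2⟩
  refine isClosed_of_closure_subset fun p hp => ?_
  have hpB : p ∈ B := closure_minimal hSB hB hp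
  obtain ⟨q, t, a⟩ := p
  obtain ⟨⟨⟨⟨⟨h1, h2⟩, h3⟩, h4⟩, h5⟩, h6⟩ := hpB
  simp only [Set.mem_ofPred_eq] at h1 h2 h3 h4 h5 h6
  refine ⟨?_, h1⟩
  rcases h3.eq_or_lt with rfl | h3
  · exact mem_HSet_one (by linarith) h2 h4 (by linarith) h6
  obtain ⟨r, hqr, hr1⟩ := exists_between h3
  have hq0 : 0 < q := by linarith
  obtain ⟨M, hM⟩ := exists_pow_lt_of_lt_one hε hr1
  -- The curve of `(j, n)` is written with polynomial equations, without root or quotient, so that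
  -- it is closed in all of `ℝ³`.
  let G : ℕ × ℕ → Set (ℝ × ℝ × ℝ) := fun x => {p | p.2.1 = p.1 ^ (x.1 + x.2 + 1)} ∩
    {p | p.2.2 ^ 2 * p.1 ^ x.2 = p.1 ^ x.1}
  have hG : ∀ x, IsClosed (G x) := fun x => by
    refine (isClosed_eq ?_ ?_).inter (isClosed_eq ?_ ?_) <;> fun_prop
  have hU : IsOpen {p : ℝ × ℝ × ℝ | p.1 < r} := isOpen_lt (by fun_prop) (by fun_prop)
  have h7 : (q, t, a) ∈ closure ({p : ℝ × ℝ × ℝ | p.1 < r} ∩ S) :=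
    hU.inter_closure ⟨hqr, hp⟩
  have h8 : {p : ℝ × ℝ × ℝ | p.1 < r} ∩ S ⊆
      ⋃ x ∈ Finset.range M ×ˢ Finset.range M, G x := by
    rintro ⟨q', t', a'⟩ ⟨hr', hp', hε'⟩
    simp only [Set.mem_ofPred_eq] at hr' hε'
    have hq' : 0 < q' := hp'.1
    obtain ⟨j, n, ht, ha⟩ := (mem_HSet_iff hq' (by linarith) _ _).1 hp'
    have h9 : j + n + 1 < M := by
      by_contra h
      have h10 : q' ^ (j + n + 1) ≤ r ^ (j + n + 1) := by gcongr
      have h11 : r ^ (j + n + 1) ≤ r ^ M :=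
        pow_le_pow_of_le_one (by linarith) hr1.le (not_lt.1 h)
      linarith
    simp only [Set.mem_iUnion]
    refine ⟨(j, n), ?_, ht, ?_⟩
    · simp only [Finset.mem_product, Finset.mem_range]; omega
    · simp only [Set.mem_ofPred_eq]
      rw [ha, Real.sq_sqrt (by positivity)]
      field_simp
  have h9 := closure_minimal h8 (isClosed_biUnion_finset fun x _ => hG x) h7
  simp only [Set.mem_iUnion] at h9
  obtain ⟨x, -, h10, h11⟩ := h9
  simp only [Set.mem_ofPred_eq] at h10 h11
  rw [mem_HSet_iff hq0 h3]
  refine ⟨x.1, x.2, h10, ?_⟩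
  rw [← h11, mul_div_assoc, div_self (by positivity), mul_one, Real.sqrt_sq h4]

/-- Boundedness comes from `a² ≤ q / t ≤ 1 / ε`. Hence `t → 0` is the only way to infinity in `H`.
-/
theorem isCompact_tge {ε : ℝ} (hε : 0 < ε) : IsCompact {p : H | ε ≤ p.1.2.1} := by
  rw [Subtype.isCompact_iff]
  have h : Subtype.val '' {p : H | ε ≤ p.1.2.1} = {p : ℝ × ℝ × ℝ | p ∈ HSet ∧ ε ≤ p.2.1} := by
    ext p; simp [and_comm]
  rw [h]
  refine Metric.isCompact_of_isClosed_isBounded (isClosed_tge hε) ?_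
  refine (isCompact_Icc (a := (0 : ℝ)) (b := 1)).prod ((isCompact_Icc (a := (0 : ℝ))
    (b := 1)).prod (isCompact_Icc (a := (0 : ℝ)) (b := ε⁻¹ + 1))) |>.isBounded.subset ?_
  rintro p ⟨hp, ht⟩
  have h1 := H_bounds ⟨p, hp⟩
  have h2 := t_pos ⟨p, hp⟩
  have h3 := a_pos ⟨p, hp⟩
  have h4 := hp.2.1
  simp only at h1 h2 h3
  refine ⟨⟨hp.1.le, h4⟩, ⟨h2.le, h1.1.trans h4⟩, h3.le, ?_⟩
  have h5 : p.2.2 ^ 2 ≤ ε⁻¹ := by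
    rw [← one_div, le_div_iff₀ hε]
    nlinarith [sq_nonneg p.2.2]
  nlinarith [sq_nonneg (p.2.2 - 1)]

theorem isCompact_upper {ε : ℝ} (hε : 0 < ε) : IsCompact (upper ε) := by
  have h : upper ε = {p : H | ε ≤ p.1.2.1} ×ˢ Set.univ := by ext; simp [upper]
  rw [h]
  exact (isCompact_tge hε).prod isCompact_univ

/-- The positive function `t` is bounded below on the compact support. With `mkCc` this identifies
`C_c(I)` with the continuous functions vanishing for small `t`, a condition that `θ` respects
because it fixes `t`. -/
theorem exists_t_bound (h : C_c(I, ℂ)) : ∃ ε > 0, ∀ x, x ∉ upper ε → h x = 0 := by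
  obtain ⟨ε, hε, hK⟩ := IsCompact.exists_forall_le' (show IsCompact (tsupport h) from h.2)
    (f := fun x : I => x.1.1.2.1) (by fun_prop) (a := 0) fun x _ => t_pos x.1
  exact ⟨ε, hε, fun x hx => image_eq_zero_of_notMem_tsupport fun h => hx (hK x h)⟩

/-- A continuous function vanishing for small `t` is an element of `C_c(I)`. -/
def mkCc (f : I → ℂ) (hf : Continuous f) (h : ∃ ε > 0, ∀ x, x ∉ upper ε → f x = 0) :
    C_c(I, ℂ) where
  toFun := f
  continuous_toFun := hf
  hasCompactSupport' := by
    obtain ⟨ε, hε, h⟩ := h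
    exact HasCompactSupport.intro (isCompact_upper hε) h

@[simp]
theorem mkCc_apply (f : I → ℂ) (hf : Continuous f)
    (h : ∃ ε > 0, ∀ x, x ∉ upper ε → f x = 0) (x : I) : mkCc f hf h x = f x := rfl

open PartialCrossedProduct

theorem theta_apply {p : H} (hp : p ∈ theta.source) : theta p = ⟨_, plus_mem hp⟩ := dif_pos hp

theorem rel_theta {k : ℤ} {x y : H} (h : Rel theta k x y) :
    y.1 = (x.1.1, x.1.2.1, x.1.1 ^ k * x.1.2.2) := by
  have key : ∀ (n : ℕ) (x y : H), Rel theta n x y →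
      y.1 = (x.1.1, x.1.2.1, x.1.1 ^ n * x.1.2.2) := by
    intro n
    induction n with
    | zero => intro x y h; rw [(rel_zero theta x y).1 h]; simp
    | succ n ih =>
      intro x y h
      obtain ⟨w, hw, hw1, rfl⟩ := (rel_natPow_succ theta n x y).1 h
      rw [theta_apply hw1]
      change (w.1.1, w.1.2.1, w.1.1 * w.1.2.2) = _
      rw [ih x w hw, pow_succ', mul_assoc]
  rcases Int.eq_nat_or_neg k with ⟨n, rfl | rfl⟩
  · rw [zpow_natCast]; exact key n x y h
  · have h1 := h.symm
    rw [neg_neg] at h1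
    have h2 := key n y x h1
    have h3 := q_pos y
    rw [h2, zpow_neg, zpow_natCast, inv_mul_cancel_left₀ (by positivity)]

instance : LocallyCompactSpace H := by
  have : WeaklyLocallyCompactSpace H := ⟨fun p => ⟨{p' : H | p.1.2.1 / 2 ≤ p'.1.2.1},
    isCompact_tge (half_pos (t_pos p)), by
      have h : IsOpen {p' : H | p.1.2.1 / 2 < p'.1.2.1} :=
        isOpen_lt continuous_const (by fun_prop)
      exact Filter.mem_of_superset (h.mem_nhds (half_lt_self (t_pos p)))
        fun x hx => le_of_lt (show p.1.2.1 / 2 < x.1.2.1 from hx)⟩⟩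
  infer_instance

/-! ### The fibre measures and continuity over `q < 1` -/

/-- The weight of a point of `H_q`, `q < 1`. -/
noncomputable def weight (p : H) : ℝ :=
  (1 - p.1.1) ^ 2 * ((p.1.2.1)⁻¹ - p.1.2.1) * p.1.2.2 ^ 2

theorem t_le_one (p : H) : p.1.2.1 ≤ 1 := (H_bounds p).1.trans p.2.2.1

theorem weight_nonneg (p : H) : 0 ≤ weight p := by
  have h1 : p.1.2.1 ≤ (p.1.2.1)⁻¹ := (t_le_one p).trans ((one_le_inv₀ (t_pos p)).2 (t_le_one p))
  exact mul_nonneg (mul_nonneg (sq_nonneg _) (by linarith)) (sq_nonneg _)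

theorem weight_pos {p : H} (hp : (proj p).1 ≠ 1) : 0 < weight p := by
  have h0 := t_pos p
  have h : p.1.1 < 1 := lt_of_le_of_ne p.2.2.1 hp
  have h1 : p.1.2.1 < 1 := (H_bounds p).1.trans_lt h
  have h2 : 1 < (p.1.2.1)⁻¹ := (one_lt_inv₀ h0).2 h1
  have := a_pos p
  exact mul_pos (mul_pos (by nlinarith) (by linarith)) (by positivity)

/-- The measure on `H` whose product with the arc length measure is `mu q`. -/
noncomputable def nu (q : Base) : Measure H :=
  if q.1 = 1 then muHOne
  else Measure.sum fun p : {p : H // proj p = q} => ENNReal.ofReal (weight p.1) • Measure.dirac p.1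

theorem mu_eq_prod (q : Base) : mu q = (nu q).prod circleMeasure := by
  rw [mu, nu]
  split_ifs with h
  · rfl
  · rw [Measure.prod_sum_left]
    congr 1
    funext p
    rw [Measure.prod_smul_left, Measure.dirac_prod, weight]
    have h1 : p.1.1.1 = q.1 := congrArg Subtype.val p.2
    rw [h1]

theorem nu_tge {ε : ℝ} (hε : 0 < ε) (q : Base) : nu q {p | ε ≤ p.1.2.1} < ⊤ := by
  obtain ⟨C, -, hC⟩ := mu_upper_bound hε
  have h : upper ε = {p : H | ε ≤ p.1.2.1} ×ˢ Set.univ := by ext; simp [upper]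
  have h1 := hC q
  rw [h, mu_eq_prod, Measure.prod_prod, measure_univ, mul_one] at h1
  exact h1.trans_lt ENNReal.ofReal_lt_top

instance (q : Base) : IsLocallyFiniteMeasure (nu q) := ⟨fun p => by
  have h : IsOpen {p' : H | p.1.2.1 / 2 < p'.1.2.1} :=
    isOpen_lt continuous_const (by fun_prop)
  exact ⟨_, h.mem_nhds (half_lt_self (t_pos p)), (measure_mono fun x hx =>
    le_of_lt (show p.1.2.1 / 2 < x.1.2.1 from hx)).trans_lt
    (nu_tge (half_pos (t_pos p)) q)⟩⟩

instance (q : Base) : SigmaFinite (mu q) := by rw [mu_eq_prod]; infer_instance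

instance (q : Base) : IsLocallyFiniteMeasure (mu q) := by rw [mu_eq_prod]; infer_instance

/-- `f` vanishes for small `t`. -/
def TSupp {E : Type*} [Zero E] (f : H → E) : Prop :=
  ∃ ε > 0, ∀ p : H, p.1.2.1 < ε → f p = 0

theorem TSupp.hasCompactSupport {E : Type*} [Zero E] {f : H → E} (hf : TSupp f) :
    HasCompactSupport f := by
  obtain ⟨ε, hε, h⟩ := hf
  exact HasCompactSupport.intro (isCompact_tge hε) fun p hp => h p (not_le.1 hp)

theorem TSupp.integrable {E : Type*} [NormedAddCommGroup E] {f : H → E} (hf : TSupp f)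
    (hc : Continuous f) (q : Base) : Integrable f (nu q) :=
  hc.integrable_of_hasCompactSupport hf.hasCompactSupport

theorem integrable_mu (h : C_c(I, ℂ)) (q : Base) : Integrable h (mu q) :=
  h.continuous.integrable_of_hasCompactSupport h.hasCompactSupport

/-- The mean of `h` over the circle. -/
noncomputable def circleMean (h : C_c(I, ℂ)) (p : H) : ℂ := ∫ z, h (p, z) ∂circleMeasure

theorem continuous_circleMean (h : C_c(I, ℂ)) : Continuous (circleMean h) := by
  have := continuous_parametric_integral_of_continuous (μ := circleMeasure)
    (f := fun p z => h (p, z)) h.continuous isCompact_univ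
  simp only [Measure.restrict_univ] at this
  exact this

theorem tSupp_circleMean (h : C_c(I, ℂ)) : TSupp (circleMean h) := by
  obtain ⟨ε, hε, hh⟩ := exists_t_bound h
  refine ⟨ε, hε, fun p hp => ?_⟩
  have : ∀ z, h (p, z) = 0 := fun z => hh _ (not_le.2 hp)
  simp [circleMean, this]

theorem integral_mu (h : C_c(I, ℂ)) (q : Base) :
    ∫ x, h x ∂mu q = ∫ p, circleMean h p ∂nu q := by
  have h1 := integrable_mu h q
  rw [mu_eq_prod] at h1 ⊢
  exact integral_prod _ h1

theorem hasSum_nu {q : Base} (hq : q.1 ≠ 1) {f : H → ℂ} (hf : Integrable f (nu q)) :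
    HasSum (fun p : {p : H // proj p = q} => (weight p.1 : ℂ) * f p.1) (∫ p, f p ∂nu q) := by
  rw [nu, if_neg hq] at hf ⊢
  have h := hasSum_integral_measure hf
  have h1 : ∀ p : {p : H // proj p = q}, (weight p.1 : ℂ) * f p.1 =
      ∫ x, f x ∂(ENNReal.ofReal (weight p.1) • Measure.dirac p.1) := fun p => by
    rw [integral_smul_measure, integral_dirac, ENNReal.toReal_ofReal (weight_nonneg _)]
    simp
  simp only [h1]
  exact h

theorem hasSum_nu_pt {q : Base} (hq : q.1 ≠ 1) {f : H → ℂ} (hf : Integrable f (nu q)) :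
    HasSum (fun x : ℕ × ℕ => (weight (pt q x.1 x.2) : ℂ) * f (pt q x.1 x.2)) (∫ p, f p ∂nu q) :=
  (fibreEquiv hq).hasSum_iff.2 (hasSum_nu hq hf)

/-- For `f` vanishing for `t < ε` only finitely many points of `H_q` matter. -/
theorem eq_zero_of_le {f : H → ℂ} {ε : ℝ} (hf : ∀ p : H, p.1.2.1 < ε → f p = 0)
    {r : ℝ} (hr1 : r ≤ 1) {M : ℕ} (hM : r ^ M < ε) {q : Base} (hq : q.1 ≤ r) {x : ℕ × ℕ}
    (hx : x ∉ Finset.range M ×ˢ Finset.range M) : f (pt q x.1 x.2) = 0 := by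
  refine hf _ ?_
  have h0 := q.2.1
  have h1 : M ≤ x.1 + x.2 + 1 := by
    simp only [Finset.mem_product, Finset.mem_range] at hx
    omega
  calc q.1 ^ (x.1 + x.2 + 1) ≤ r ^ (x.1 + x.2 + 1) := by gcongr
    _ ≤ r ^ M := pow_le_pow_of_le_one (h0.le.trans hq) hr1 h1
    _ < ε := hM

theorem integral_nu_eq_sum {f : H → ℂ} (hc : Continuous f) {ε : ℝ} (hε : 0 < ε)
    (hf : ∀ p : H, p.1.2.1 < ε → f p = 0)
    {r : ℝ} (hr1 : r ≤ 1) {M : ℕ} (hM : r ^ M < ε) {q : Base} (hq : q.1 ≤ r) (hq1 : q.1 ≠ 1) :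
    ∫ p, f p ∂nu q = ∑ x ∈ Finset.range M ×ˢ Finset.range M,
      (weight (pt q x.1 x.2) : ℂ) * f (pt q x.1 x.2) := by
  refine (hasSum_nu_pt hq1 (TSupp.integrable ⟨ε, hε, hf⟩ hc q)).unique ?_
  refine hasSum_sum_of_ne_finset_zero fun x hx => ?_
  rw [eq_zero_of_le hf hr1 hM hq hx, mul_zero]

theorem continuous_weight : Continuous weight := by
  have h : Continuous fun p : H => (p.1.2.1)⁻¹ :=
    Continuous.inv₀ (by fun_prop) fun p => (t_pos p).ne'
  unfold weight
  fun_prop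

/-- For all `q ≤ r < 1` the points with `t ≥ ε` belong to one fixed finite set of indices `(j, n)`,
so the integral is a finite sum of continuous functions of `q`. -/
theorem continuousAt_integral_nu {f : H → ℂ} (hc : Continuous f) (hf : TSupp f) {q : Base}
    (hq : q.1 ≠ 1) : ContinuousAt (fun q => ∫ p, f p ∂nu q) q := by
  obtain ⟨ε, hε, hf⟩ := hf
  obtain ⟨r, hqr, hr1⟩ := exists_between (lt_of_le_of_ne q.2.2 hq)
  obtain ⟨M, hM⟩ := exists_pow_lt_of_lt_one hε hr1
  have h1 : ContinuousAt (fun q => ∑ x ∈ Finset.range M ×ˢ Finset.range M,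
      (weight (pt q x.1 x.2) : ℂ) * f (pt q x.1 x.2)) q := by
    refine Continuous.continuousAt (continuous_finsetSum _ fun x _ => ?_)
    exact (Complex.continuous_ofReal.comp (continuous_weight.comp (continuous_pt _ _))).mul
      (hc.comp (continuous_pt _ _))
  refine h1.congr ?_
  have h2 : IsOpen {q : Base | q.1 < r} := isOpen_lt (by fun_prop) (by fun_prop)
  filter_upwards [h2.mem_nhds hqr] with q' hq'
  exact (integral_nu_eq_sum hc hε hf hr1.le hM (le_of_lt hq')
    (lt_trans hq' hr1).ne).symm

end QTri

/-! ### Riemann sums over the quadrant and the limit `q → 1` -/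

/-- The closed quadrant. -/
def quadrant : Set (ℝ × ℝ) := Set.Ici 0 ×ˢ Set.Ici 0

theorem measurableSet_quadrant : MeasurableSet quadrant :=
  measurableSet_Ici.prod measurableSet_Ici

/-- The integrand is constant on the squares of side `c`, each of area `c²`. This turns sums over
`(j, n)` into integrals over a domain that does not depend on `q`. -/
theorem setIntegral_quadrant_floor {c : ℝ} (hc : 0 < c) (g : ℕ × ℕ → ℂ) (F : Finset (ℕ × ℕ))
    (hg : ∀ z ∉ F, g z = 0) :
    ∫ p in quadrant, g (⌊p.1 / c⌋₊, ⌊p.2 / c⌋₊) = (c : ℂ) ^ 2 * ∑ z ∈ F, g z := by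
  let cell : ℕ × ℕ → Set (ℝ × ℝ) := fun z =>
    Set.Ico (z.1 * c) ((z.1 + 1) * c) ×ˢ Set.Ico (z.2 * c) ((z.2 + 1) * c)
  -- Membership in the quadrant cannot be dropped: the natural floor sends negative numbers to `0`.
  have hmem : ∀ z p, p ∈ cell z ↔ p ∈ quadrant ∧ (⌊p.1 / c⌋₊, ⌊p.2 / c⌋₊) = z := by
    have h1 : ∀ (n : ℕ) (x : ℝ), x ∈ Set.Ico (n * c) ((n + 1) * c) ↔ 0 ≤ x ∧ ⌊x / c⌋₊ = n := by
      intro n x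
      constructor
      · rintro ⟨h1, h2⟩
        have h0 : 0 ≤ x := le_trans (by positivity) h1
        refine ⟨h0, (Nat.floor_eq_iff (by positivity)).2 ⟨?_, ?_⟩⟩
        · rwa [le_div_iff₀ hc]
        · rwa [div_lt_iff₀ hc]
      · rintro ⟨h0, h1⟩
        rw [Nat.floor_eq_iff (by positivity), le_div_iff₀ hc, div_lt_iff₀ hc] at h1
        exact h1
    intro z p
    simp only [cell, quadrant, Set.mem_prod, h1, Set.mem_Ici, Prod.ext_iff]
    tauto
  have hmeas : ∀ z, MeasurableSet (cell z) := fun z => measurableSet_Ico.prod measurableSet_Ico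
  have hvol : ∀ z, volume.real (cell z) = c ^ 2 := fun z => by
    rw [Measure.real, Measure.volume_eq_prod, Measure.prod_prod, Real.volume_Ico, Real.volume_Ico,
      ← ENNReal.ofReal_mul (by nlinarith), ENNReal.toReal_ofReal (by nlinarith)]
    ring
  have hfin : ∀ z, volume (cell z) ≠ ⊤ := fun z => by
    rw [Measure.volume_eq_prod, Measure.prod_prod, Real.volume_Ico, Real.volume_Ico]
    exact ENNReal.mul_ne_top ENNReal.ofReal_ne_top ENNReal.ofReal_ne_top
  have hsum : quadrant.indicator (fun p => g (⌊p.1 / c⌋₊, ⌊p.2 / c⌋₊)) =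
      fun p => ∑ z ∈ F, (cell z).indicator (fun _ => g z) p := by
    funext p
    by_cases hp : p ∈ quadrant
    · rw [Set.indicator_of_mem hp]
      by_cases hF : (⌊p.1 / c⌋₊, ⌊p.2 / c⌋₊) ∈ F
      · rw [Finset.sum_eq_single_of_mem _ hF, Set.indicator_of_mem ((hmem _ _).2 ⟨hp, rfl⟩)]
        intro z _ hz
        exact Set.indicator_of_notMem (fun h => hz ((hmem _ _).1 h).2.symm) _
      · rw [hg _ hF, Finset.sum_eq_zero]
        intro z hz
        refine Set.indicator_of_notMem (fun h => hF ?_) _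
        rw [((hmem _ _).1 h).2]; exact hz
    · rw [Set.indicator_of_notMem hp, Finset.sum_eq_zero]
      intro z _
      exact Set.indicator_of_notMem (fun h => hp ((hmem _ _).1 h).1) _
  rw [← integral_indicator measurableSet_quadrant, hsum, integral_finsetSum, Finset.mul_sum]
  · refine Finset.sum_congr rfl fun z _ => ?_
    rw [integral_indicator_const _ (hmeas z), hvol]
    simp
  · intro z _
    exact (integrable_indicator_iff (hmeas z)).2 (integrableOn_const (hfin z))

/-- With `c = -log q` the power is `exp (-c ⌊x/c⌋)`, and `c ⌊x/c⌋` differs from `x` by less than `c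
→ 0`. -/
theorem tendsto_pow_floor {ι : Type*} {l : Filter ι} {q : ι → ℝ}
    (hq : Filter.Tendsto q l (nhdsWithin 1 (Set.Iio 1))) {x : ℝ} (hx : 0 ≤ x) :
    Filter.Tendsto (fun i => q i ^ ⌊x / -Real.log (q i)⌋₊) l (nhds (Real.exp (-x))) := by
  have h1 : Filter.Tendsto (fun i => -Real.log (q i)) l (nhds 0) := by
    have h2 : Filter.Tendsto q l (nhds 1) := hq.mono_right nhdsWithin_le_nhds
    have := ((Real.continuousAt_log one_ne_zero).tendsto.comp h2).neg
    simpa using this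
  have h0 : ∀ᶠ i in l, 0 < q i ∧ q i < 1 := by
    have h2 : ∀ᶠ r : ℝ in nhdsWithin 1 (Set.Iio 1), 0 < r ∧ r < 1 := by
      filter_upwards [self_mem_nhdsWithin,
        nhdsWithin_le_nhds (lt_mem_nhds (show (0 : ℝ) < 1 from one_pos))] with r h3 h4
      exact ⟨h4, h3⟩
    exact hq.eventually h2
  have h3 : Filter.Tendsto (fun i => (⌊x / -Real.log (q i)⌋₊ : ℝ) * -Real.log (q i)) l
      (nhds x) := by
    have h4 : Filter.Tendsto (fun i => x - -Real.log (q i)) l (nhds x) := by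
      simpa using h1.const_sub x
    refine tendsto_of_tendsto_of_tendsto_of_le_of_le' h4 tendsto_const_nhds ?_ ?_
    · filter_upwards [h0] with i hi
      have h5 : 0 < -Real.log (q i) := neg_pos.2 (Real.log_neg hi.1 hi.2)
      have h6 := Nat.lt_floor_add_one (x / -Real.log (q i))
      rw [div_lt_iff₀ h5] at h6
      linarith
    · filter_upwards [h0] with i hi
      have h5 : 0 < -Real.log (q i) := neg_pos.2 (Real.log_neg hi.1 hi.2)
      exact (le_div_iff₀ h5).1 (Nat.floor_le (by positivity))
  refine ((Real.continuous_exp.tendsto _).comp h3.neg).congr' ?_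
  filter_upwards [h0] with i hi
  simp only [Function.comp_apply]
  rw [mul_neg, neg_neg, Real.exp_nat_mul, Real.exp_log hi.1]

/-- This is the inverse of the difference quotient of `log` at `1`, where the derivative is `1`. -/
theorem tendsto_one_sub_div_log {ι : Type*} {l : Filter ι} {q : ι → ℝ}
    (hq : Filter.Tendsto q l (nhdsWithin 1 (Set.Iio 1))) :
    Filter.Tendsto (fun i => (1 - q i) / -Real.log (q i)) l (nhds 1) := by
  have h := hasDerivAt_iff_tendsto_slope.1 (Real.hasDerivAt_log one_ne_zero)
  have h1 := h.comp (hq.mono_right (nhdsWithin_mono 1 fun x hx => (ne_of_lt hx : x ≠ 1)))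
  have h2 := h1.inv₀ (by norm_num)
  simp only [inv_one] at h2
  refine h2.congr fun i => ?_
  simp only [Function.comp_apply, slope, vsub_eq_sub, smul_eq_mul, Real.log_one, sub_zero, mul_inv,
    inv_inv]
  rw [← neg_sub (q i) 1, neg_div_neg_eq, div_eq_mul_inv]

namespace QTri

open PartialCrossedProduct

/-- The parametrisation of `H_1` by the quadrant. -/
noncomputable def limPt (p : ℝ × ℝ) : H :=
  -- Truncation at `0` only serves to make the map total and continuous on the plane; on the
  -- quadrant it has no effect.
  ⟨(1, Real.exp (-(max p.1 0 + max p.2 0)), Real.exp ((max p.2 0 - max p.1 0) / 2)), by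
    have h1 := le_max_right p.1 0
    have h2 := le_max_right p.2 0
    refine mem_HSet_one (Real.exp_pos _) (Real.exp_le_one_iff.2 (by linarith))
      (Real.exp_pos _).le ?_ ?_
    · rw [← Real.exp_nat_mul, Real.exp_le_exp]; push_cast; linarith
    · rw [← Real.exp_nat_mul, ← Real.exp_add, Real.exp_le_one_iff]; push_cast; linarith⟩

/-- The point of `H_q` close to `limPt p`. -/
noncomputable def stepPt (q : Base) (p : ℝ × ℝ) : H :=
  pt q ⌊p.1 / -Real.log q.1⌋₊ ⌊p.2 / -Real.log q.1⌋₊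

theorem tendsto_coe_base : Filter.Tendsto (fun q : Base => q.1)
    (nhdsWithin ⟨1, one_pos, le_rfl⟩ {⟨1, one_pos, le_rfl⟩}ᶜ) (nhdsWithin 1 (Set.Iio 1)) := by
  refine tendsto_nhdsWithin_iff.2 ⟨?_, ?_⟩
  · exact (continuous_subtype_val.tendsto (⟨1, one_pos, le_rfl⟩ : Base)).mono_left
      nhdsWithin_le_nhds
  · filter_upwards [self_mem_nhdsWithin] with q hq
    exact lt_of_le_of_ne q.2.2 fun h => hq (Subtype.ext h)

theorem tendsto_stepPt {p : ℝ × ℝ} (hp : p ∈ quadrant) :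
    Filter.Tendsto (fun q => stepPt q p)
      (nhdsWithin ⟨1, one_pos, le_rfl⟩ {⟨1, one_pos, le_rfl⟩}ᶜ) (nhds (limPt p)) := by
  have h := tendsto_coe_base
  have h0 := h.mono_right nhdsWithin_le_nhds
  have h1 := tendsto_pow_floor h (x := p.1) hp.1
  have h2 := tendsto_pow_floor h (x := p.2) hp.2
  rw [tendsto_subtype_rng]
  refine h0.prodMk_nhds (Filter.Tendsto.prodMk_nhds ?_ ?_)
  · have h3 := (h1.mul h2).mul h0
    rw [← Real.exp_add, mul_one, ← neg_add] at h3
    rw [max_eq_left (show 0 ≤ p.1 from hp.1), max_eq_left (show 0 ≤ p.2 from hp.2)]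
    refine h3.congr fun q => ?_
    rw [← pow_add, ← pow_succ]
  · have h3 := (h1.div h2 (Real.exp_pos _).ne').sqrt
    rw [max_eq_left (show 0 ≤ p.1 from hp.1), max_eq_left (show 0 ≤ p.2 from hp.2)]
    have h4 : √(Real.exp (-p.1) / Real.exp (-p.2)) = Real.exp ((p.2 - p.1) / 2) := by
      rw [← Real.exp_sub, ← Real.exp_half]; congr 1; ring
    rw [h4] at h3
    exact h3

/-- The density `(t⁻¹ - t) a²`. -/
noncomputable def dens (p : H) : ℝ := ((p.1.2.1)⁻¹ - p.1.2.1) * p.1.2.2 ^ 2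

theorem weight_eq (p : H) : weight p = (1 - p.1.1) ^ 2 * dens p := mul_assoc _ _ _

theorem continuous_dens : Continuous dens := by
  have h : Continuous fun p : H => (p.1.2.1)⁻¹ :=
    Continuous.inv₀ (by fun_prop) fun p => (t_pos p).ne'
  unfold dens
  fun_prop

theorem dens_nonneg (p : H) : 0 ≤ dens p := by
  have h1 : p.1.2.1 ≤ (p.1.2.1)⁻¹ := (t_le_one p).trans ((one_le_inv₀ (t_pos p)).2 (t_le_one p))
  exact mul_nonneg (by linarith) (sq_nonneg _)

theorem dens_le {ε : ℝ} (hε : 0 < ε) {p : H} (hp : ε ≤ p.1.2.1) : dens p ≤ ε⁻¹ * ε⁻¹ := by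
  have h1 : (p.1.2.1)⁻¹ - p.1.2.1 ≤ ε⁻¹ := by
    have := inv_anti₀ hε hp
    linarith [t_pos p]
  have h2 : p.1.2.2 ^ 2 ≤ ε⁻¹ := by
    rw [← one_div, le_div_iff₀ hε]
    have := (H_bounds p).2.2
    have := p.2.2.1
    nlinarith [sq_nonneg p.1.2.2]
  exact mul_le_mul h1 h2 (sq_nonneg _) (by positivity)

theorem neg_log_pos {q : Base} (hq : q.1 ≠ 1) : 0 < -Real.log q.1 :=
  neg_pos.2 (Real.log_neg q.2.1 (lt_of_le_of_ne q.2.2 hq))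

/-- The index `(j, n)` is spread over a square of side `-log q`. The weight carries `(1-q)²` and the
square has area `(log q)²`, hence the ratio in the integrand. -/
theorem integral_nu_eq_setIntegral {f : H → ℂ} (hc : Continuous f) (hf : TSupp f) {q : Base}
    (hq : q.1 ≠ 1) : ∫ p, f p ∂nu q = ∫ p in quadrant,
      ((((1 - q.1) / -Real.log q.1) ^ 2 * dens (stepPt q p) : ℝ) : ℂ) * f (stepPt q p) := by
  obtain ⟨ε, hε, hf⟩ := hf
  obtain ⟨M, hM⟩ := exists_pow_lt_of_lt_one hε (lt_of_le_of_ne q.2.2 hq)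
  have h0 := neg_log_pos hq
  rw [integral_nu_eq_sum hc hε hf q.2.2 hM le_rfl hq]
  have h1 := setIntegral_quadrant_floor h0 (fun z => ((((1 - q.1) / -Real.log q.1) ^ 2 *
    dens (pt q z.1 z.2) : ℝ) : ℂ) * f (pt q z.1 z.2)) (Finset.range M ×ˢ Finset.range M)
    fun z hz => by rw [eq_zero_of_le hf q.2.2 hM le_rfl hz, mul_zero]
  refine Eq.trans ?_ h1.symm
  rw [Finset.mul_sum]
  refine Finset.sum_congr rfl fun z _ => ?_
  have h2 : weight (pt q z.1 z.2) = (-Real.log q.1) ^ 2 *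
      (((1 - q.1) / -Real.log q.1) ^ 2 * dens (pt q z.1 z.2)) := by
    rw [weight_eq, div_pow, ← mul_assoc, mul_div_cancel₀ _ (by positivity)]; rfl
  rw [h2]
  push_cast
  ring

/-- Dominated convergence: `f` vanishes for `t < ε`, which confines the integrands to the square of
side `-log ε`, and there the density is at most `ε⁻²`. -/
theorem tendsto_setIntegral_step {f : H → ℂ} (hc : Continuous f) (hf : TSupp f) :
    Filter.Tendsto (fun q : Base => ∫ p in quadrant,
      ((((1 - q.1) / -Real.log q.1) ^ 2 * dens (stepPt q p) : ℝ) : ℂ) * f (stepPt q p))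
      (nhdsWithin ⟨1, one_pos, le_rfl⟩ {⟨1, one_pos, le_rfl⟩}ᶜ)
      (nhds (∫ p in quadrant, (dens (limPt p) : ℂ) * f (limPt p))) := by
  obtain ⟨C, hC⟩ := hf.hasCompactSupport.exists_bound_of_continuous hc
  obtain ⟨ε, hε, hf⟩ := hf
  have hC0 : 0 ≤ C := (norm_nonneg _).trans (hC (limPt 0))
  set S : Set (ℝ × ℝ) := Set.Icc 0 (-Real.log ε) ×ˢ Set.Icc 0 (-Real.log ε) with hS
  have hSm : MeasurableSet S := measurableSet_Icc.prod measurableSet_Icc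
  refine tendsto_integral_filter_of_dominated_convergence
    (S.indicator fun _ => ε⁻¹ * ε⁻¹ * C) ?_ ?_ ?_ ?_
  · refine Filter.Eventually.of_forall fun q => ?_
    have h1 : Measurable fun p : ℝ × ℝ => (⌊p.1 / -Real.log q.1⌋₊, ⌊p.2 / -Real.log q.1⌋₊) :=
      (Nat.measurable_floor.comp (measurable_fst.div_const _)).prodMk
        (Nat.measurable_floor.comp (measurable_snd.div_const _))
    have h2 : Measurable fun z : ℕ × ℕ => ((((1 - q.1) / -Real.log q.1) ^ 2 *
      dens (pt q z.1 z.2) : ℝ) : ℂ) * f (pt q z.1 z.2) := Measurable.of_discrete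
    exact (h2.comp h1).aestronglyMeasurable
  · filter_upwards [self_mem_nhdsWithin] with q hq
    have hq1 : q.1 ≠ 1 := fun h => hq (Subtype.ext h)
    refine ae_restrict_of_forall_mem measurableSet_quadrant fun p hp => ?_
    by_cases ht : (stepPt q p).1.2.1 < ε
    · rw [hf _ ht, mul_zero, norm_zero]
      exact Set.indicator_nonneg (fun _ _ => by positivity) _
    have ht := not_lt.1 ht
    have h0 := neg_log_pos hq1
    -- From `t = q^(j+n+1) ≥ ε`, `(j+n+1)(-log q) ≤ -log ε`, while `p.1 < (j+1)(-log q)` and `p.2 <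
    -- (n+1)(-log q)`. The `+1` in the exponent of `t` absorbs the rounding.
    have h1 : p ∈ S := by
      have h2 := Real.log_le_log hε ht
      simp only [stepPt, pt] at h2
      rw [Real.log_pow] at h2
      push_cast at h2
      have h3 := Nat.lt_floor_add_one (p.1 / -Real.log q.1)
      have h4 := Nat.lt_floor_add_one (p.2 / -Real.log q.1)
      rw [div_lt_iff₀ h0] at h3 h4
      have h5 : 0 ≤ (⌊p.1 / -Real.log q.1⌋₊ : ℝ) * -Real.log q.1 := by positivity
      have h6 : 0 ≤ (⌊p.2 / -Real.log q.1⌋₊ : ℝ) * -Real.log q.1 := by positivity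
      exact ⟨⟨hp.1, by nlinarith⟩, ⟨hp.2, by nlinarith⟩⟩
    rw [Set.indicator_of_mem h1, norm_mul, Complex.norm_real, Real.norm_of_nonneg
      (mul_nonneg (sq_nonneg _) (dens_nonneg _))]
    refine mul_le_mul ?_ (hC _) (norm_nonneg _) (by positivity)
    -- By `log q ≤ q - 1`.
    have h2 : ((1 - q.1) / -Real.log q.1) ^ 2 ≤ 1 := by
      refine pow_le_one₀ (div_nonneg (by linarith [q.2.2]) h0.le) ?_
      rw [div_le_one h0]
      have := Real.log_le_sub_one_of_pos q.2.1
      linarith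
    calc _ ≤ 1 * (ε⁻¹ * ε⁻¹) := mul_le_mul h2 (dens_le hε ht) (dens_nonneg _) zero_le_one
      _ = _ := one_mul _
  · refine Integrable.mono_measure ?_ Measure.restrict_le_self
    refine (integrable_indicator_iff hSm).2 (integrableOn_const ?_)
    rw [hS, Measure.volume_eq_prod, Measure.prod_prod, Real.volume_Icc]
    exact ENNReal.mul_ne_top ENNReal.ofReal_ne_top ENNReal.ofReal_ne_top
  · refine ae_restrict_of_forall_mem measurableSet_quadrant fun p hp => ?_
    have h1 := tendsto_stepPt hp
    have h2 := (tendsto_one_sub_div_log tendsto_coe_base).pow 2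
    have h3 := h2.mul ((continuous_dens.tendsto _).comp h1)
    rw [one_pow, one_mul] at h3
    exact ((Complex.continuous_ofReal.tendsto _).comp h3).mul ((hc.tendsto _).comp h1)

/-- The inverse is `x = -(log t)/2 - log a`, `y = -(log t)/2 + log a`; then `x ≥ 0` says `a² t ≤ 1`
and `y ≥ 0` says `t ≤ a²`. -/
theorem image_quadrant : (fun p : ℝ × ℝ => (Real.exp (-(p.1 + p.2)),
    Real.exp ((p.2 - p.1) / 2))) '' quadrant = HOne := by
  ext ⟨t, a⟩
  constructor
  · rintro ⟨p, hp, h⟩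
    have h1 := (limPt p).2
    rw [limPt] at h1
    simp only [max_eq_left (show 0 ≤ p.1 from hp.1), max_eq_left (show 0 ≤ p.2 from hp.2)] at h1
    rw [← h]; exact h1
  · intro h
    have h1 := H_bounds ⟨(1, t, a), h⟩
    have ht := t_pos ⟨(1, t, a), h⟩
    have ha := a_pos ⟨(1, t, a), h⟩
    simp only [one_mul] at h1 ht ha
    refine ⟨(-Real.log t / 2 - Real.log a, -Real.log t / 2 + Real.log a), ⟨?_, ?_⟩, ?_⟩
    · have := Real.log_le_log (by positivity) h1.2.2
      rw [Real.log_mul (by positivity) ht.ne', Real.log_pow, Real.log_one] at this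
      push_cast at this
      simp only [Set.mem_Ici]; linarith
    · have := Real.log_le_log ht h1.2.1
      rw [Real.log_pow] at this
      push_cast at this
      simp only [Set.mem_Ici]; linarith
    · refine Prod.ext ?_ ?_
      · simp only
        rw [show -(-Real.log t / 2 - Real.log a + (-Real.log t / 2 + Real.log a)) = Real.log t by
          ring, Real.exp_log ht]
      · simp only
        rw [show (-Real.log t / 2 + Real.log a - (-Real.log t / 2 - Real.log a)) / 2 = Real.log a by
          ring, Real.exp_log ha]

theorem setIntegral_HOne (g : ℝ × ℝ → ℂ) : ∫ p in HOne, g p = ∫ p in quadrant,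
    (Real.exp (-(p.1 + p.2)) * Real.exp ((p.2 - p.1) / 2)) •
      g (Real.exp (-(p.1 + p.2)), Real.exp ((p.2 - p.1) / 2)) := by
  let f' : ℝ × ℝ → ℝ × ℝ →L[ℝ] ℝ × ℝ := fun p =>
    (Matrix.toLin (Module.Basis.finTwoProd ℝ) (Module.Basis.finTwoProd ℝ)
      !![-Real.exp (-(p.1 + p.2)), -Real.exp (-(p.1 + p.2));
        -Real.exp ((p.2 - p.1) / 2) / 2, Real.exp ((p.2 - p.1) / 2) / 2]).toContinuousLinearMap
  have hf' : ∀ p, HasFDerivAt (fun p : ℝ × ℝ => (Real.exp (-(p.1 + p.2)),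
      Real.exp ((p.2 - p.1) / 2))) (f' p) p := by
    intro p
    simp only [f']
    rw [Matrix.toLin_finTwoProd_toContinuousLinearMap]
    have h1 := ((hasFDerivAt_fst (𝕜 := ℝ) (p := p)).add hasFDerivAt_snd).neg.exp
    have h2 := (((hasFDerivAt_snd (𝕜 := ℝ) (p := p)).sub hasFDerivAt_fst).mul_const
      (1 / 2 : ℝ)).exp
    refine HasFDerivAt.congr_fderiv (h1.prodMk (h2.congr_of_eventuallyEq
      (Filter.Eventually.of_forall fun x => ?_))) ?_
    · simp [div_eq_mul_inv]
    · ext <;> simp [div_eq_mul_inv]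
  have hdet : ∀ p, |(f' p).det| = Real.exp (-(p.1 + p.2)) * Real.exp ((p.2 - p.1) / 2) := by
    intro p
    simp only [f', LinearMap.det_toContinuousLinearMap, LinearMap.det_toLin,
      Matrix.det_fin_two_of]
    rw [show -Real.exp (-(p.1 + p.2)) * (Real.exp ((p.2 - p.1) / 2) / 2) -
      -Real.exp (-(p.1 + p.2)) * (-Real.exp ((p.2 - p.1) / 2) / 2) =
      -(Real.exp (-(p.1 + p.2)) * Real.exp ((p.2 - p.1) / 2)) by ring, abs_neg,
      abs_of_pos (by positivity)]
  have hinj : Set.InjOn (fun p : ℝ × ℝ => (Real.exp (-(p.1 + p.2)),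
      Real.exp ((p.2 - p.1) / 2))) quadrant := by
    intro p _ p' _ h
    simp only [Prod.mk.injEq, Real.exp_eq_exp] at h
    exact Prod.ext (by linarith) (by linarith)
  rw [← image_quadrant, integral_image_eq_integral_abs_det_fderiv_smul volume
    measurableSet_quadrant (fun p _ => (hf' p).hasFDerivWithinAt) hinj]
  simp only [hdet]

theorem measurable_HOne_to_H : Measurable fun p : HOne => (⟨((1 : ℝ), p.1), p.2⟩ : H) := by
  refine Measurable.subtype_mk ?_
  fun_prop

open Classical in
-- The Jacobian of the exponential coordinates is `t a`, and `(t⁻² - 1) a · t a = (t⁻¹ - t) a²`. So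
-- the limit of the Riemann sums is the prescribed measure on `H_1`.
theorem integral_muHOne {f : H → ℂ} (hc : Continuous f) :
    ∫ p, f p ∂muHOne = ∫ p in quadrant, (dens (limPt p) : ℂ) * f (limPt p) := by
  rw [muHOne, integral_map measurable_HOne_to_H.aemeasurable hc.aestronglyMeasurable,
    integral_withDensity_eq_integral_toReal_smul (by fun_prop)
      (Filter.Eventually.of_forall fun _ => ENNReal.ofReal_lt_top)]
  -- Extension by zero to the plane, where the change of variables takes place; the value off `HOne`
  -- is irrelevant.
  let g : ℝ × ℝ → ℂ := fun p => if h : p ∈ HOne then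
    (ENNReal.ofReal (((p.1 ^ 2)⁻¹ - 1) * p.2)).toReal • f ⟨(1, p), h⟩ else 0
  have h1 := integral_subtype_comap (μ := volume) measurableSet_HOne g
  refine Eq.trans (integral_congr_ae (Filter.Eventually.of_forall fun p => ?_)) (h1.trans ?_)
  · simp only [g]; rw [dif_pos p.2]
  rw [setIntegral_HOne]
  refine setIntegral_congr_fun measurableSet_quadrant fun p hp => ?_
  have h2 : limPt p = ⟨(1, Real.exp (-(p.1 + p.2)), Real.exp ((p.2 - p.1) / 2)),
      by have : _ ∈ HOne := image_quadrant.subset ⟨p, hp, rfl⟩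
         exact this⟩ := by
    refine Subtype.ext ?_
    simp only [limPt, max_eq_left (show 0 ≤ p.1 from hp.1), max_eq_left (show 0 ≤ p.2 from hp.2)]
  have h3 : (Real.exp (-(p.1 + p.2)), Real.exp ((p.2 - p.1) / 2)) ∈ HOne :=
    image_quadrant.subset ⟨p, hp, rfl⟩
  simp only [g]
  rw [dif_pos h3, h2, dens]
  simp only
  have h4 : Real.exp (-(p.1 + p.2)) ≤ 1 := ((mem_HOne _).1 h3).1.2
  have h5 := Real.exp_pos (-(p.1 + p.2))
  have h6 := Real.exp_pos ((p.2 - p.1) / 2)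
  rw [ENNReal.toReal_ofReal (mul_nonneg (sub_nonneg.2 ((one_le_inv₀ (by positivity)).2
    (pow_le_one₀ h5.le h4))) h6.le), smul_smul, Complex.real_smul]
  congr 2
  field_simp

theorem continuous_integral_nu {f : H → ℂ} (hc : Continuous f) (hf : TSupp f) :
    Continuous fun q => ∫ p, f p ∂nu q := by
  rw [continuous_iff_continuousAt]
  intro q
  by_cases hq : q.1 = 1
  · obtain rfl : q = ⟨1, one_pos, le_rfl⟩ := Subtype.ext hq
    -- The sum formula for the fibre measure holds only off `q = 1`, so the limit is taken along the
    -- punctured neighbourhood.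
    rw [continuousAt_iff_punctured_nhds]
    have h1 : ∫ p, f p ∂nu ⟨1, one_pos, le_rfl⟩ =
        ∫ p in quadrant, (dens (limPt p) : ℂ) * f (limPt p) := by
      rw [← integral_muHOne hc, nu, if_pos rfl]
    rw [h1]
    refine (tendsto_setIntegral_step hc hf).congr' ?_
    filter_upwards [self_mem_nhdsWithin] with q hq
    exact (integral_nu_eq_setIntegral hc hf fun h => hq (Subtype.ext h)).symm
  · exact continuousAt_integral_nu hc hf hq

/-! ### Full support of the fibre measures -/

theorem continuous_limPt : Continuous limPt :=
  Continuous.subtype_mk (by fun_prop) _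

theorem exists_quadrant {p : H} (hp : (proj p).1 = 1) : ∃ x ∈ quadrant, limPt x = p := by
  have h : (p.1.2.1, p.1.2.2) ∈ HOne := by
    have h1 := p.2
    rw [show p.1 = (1, p.1.2) from Prod.ext hp rfl] at h1
    exact h1
  rw [← image_quadrant] at h
  obtain ⟨x, hx, h⟩ := h
  refine ⟨x, hx, Subtype.ext (Prod.ext (Eq.symm hp) ?_)⟩
  simp only [limPt, max_eq_left (show 0 ≤ x.1 from hx.1), max_eq_left (show 0 ≤ x.2 from hx.2)]
  exact h

/-- A point of `H_1` may be on the boundary or have `t = 1`, where the density vanishes. A small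
move inside `U` reaches the interior, where the density is positive. -/
theorem muHOne_pos {U : Set H} (hU : IsOpen U) {p : H} (hp : p ∈ U) (hq : (proj p).1 = 1) :
    muHOne U ≠ 0 := by
  intro h0
  have hdm : Measurable fun p : HOne => ENNReal.ofReal (((p.1.1 ^ 2)⁻¹ - 1) * p.1.2) := by
    fun_prop
  rw [muHOne, Measure.map_apply measurable_HOne_to_H hU.measurableSet,
    withDensity_apply_eq_zero hdm, comap_subtype_coe_apply measurableSet_HOne] at h0
  obtain ⟨x, hx, rfl⟩ := exists_quadrant hq
  obtain ⟨V, hV, rfl⟩ := isOpen_induced_iff.1 hU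
  let O : Set (ℝ × ℝ) := {p | 0 < p.1} ∩ {p | p.1 < 1} ∩ {p | 0 < p.2} ∩ {p | p.1 < p.2 ^ 2} ∩
    {p | p.2 ^ 2 * p.1 < 1} ∩ {p | ((1 : ℝ), p) ∈ V}
  have hO : IsOpen O := by
    refine (((((isOpen_lt ?_ ?_).inter (isOpen_lt ?_ ?_)).inter (isOpen_lt ?_ ?_)).inter
      (isOpen_lt ?_ ?_)).inter (isOpen_lt ?_ ?_)).inter (hV.preimage ?_) <;> fun_prop
  have hne : O.Nonempty := by
    -- Adding `(d, d)` with `d > 0` enters the open quadrant, so all inequalities defining `H_1`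
    -- become strict.
    have h1 : ContinuousAt (fun d : ℝ => limPt (x.1 + d, x.2 + d)) 0 :=
      (continuous_limPt.comp (by fun_prop)).continuousAt
    have h2 : ∀ᶠ d in nhds (0 : ℝ), limPt (x.1 + d, x.2 + d) ∈ Subtype.val ⁻¹' V :=
      h1.eventually (hU.mem_nhds (by simpa using hp))
    have h3 : ∀ᶠ d in nhdsWithin (0 : ℝ) (Set.Ioi 0), limPt (x.1 + d, x.2 + d) ∈
      Subtype.val ⁻¹' V := nhdsWithin_le_nhds h2
    obtain ⟨d, hd, hd0⟩ := (h3.and self_mem_nhdsWithin).exists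
    have hd0 : 0 < d := hd0
    have hx1 : 0 < x.1 + d := add_pos_of_nonneg_of_pos hx.1 hd0
    have hx2 : 0 < x.2 + d := add_pos_of_nonneg_of_pos hx.2 hd0
    refine ⟨(limPt (x.1 + d, x.2 + d)).1.2, ⟨⟨⟨⟨Real.exp_pos _, ?_⟩, Real.exp_pos _⟩, ?_⟩, ?_⟩, hd⟩
    all_goals simp only [limPt, Set.mem_ofPred_eq, max_eq_left hx1.le, max_eq_left hx2.le]
    · rw [Real.exp_lt_one_iff]; linarith
    · rw [← Real.exp_nat_mul, Real.exp_lt_exp]; push_cast; linarith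
    · rw [← Real.exp_nat_mul, ← Real.exp_add, Real.exp_lt_one_iff]; push_cast; linarith
  refine (hO.measure_pos volume hne).ne' (measure_mono_null ?_ h0)
  rintro p ⟨⟨⟨⟨⟨h1, h2⟩, h3⟩, h4⟩, h5⟩, h6⟩
  simp only [Set.mem_ofPred_eq] at h1 h2 h3 h4 h5
  have h7 : p ∈ HOne := mem_HSet_one h1 h2.le h3.le h4.le h5.le
  refine ⟨⟨p, h7⟩, ⟨?_, h6⟩, rfl⟩
  have h8 : 1 < (p.1 ^ 2)⁻¹ := (one_lt_inv₀ (by positivity)).2 (by nlinarith)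
  exact (ENNReal.ofReal_pos.2 (mul_pos (by linarith) h3)).ne'

theorem nu_pos {U : Set H} (hU : IsOpen U) {p : H} (hp : p ∈ U) : nu (proj p) U ≠ 0 := by
  by_cases hq : (proj p).1 = 1
  · rw [nu, if_pos hq]; exact muHOne_pos hU hp hq
  · rw [nu, if_neg hq]
    rw [Measure.sum_apply _ hU.measurableSet]
    intro h0
    have h1 := ENNReal.tsum_eq_zero.1 h0 ⟨p, rfl⟩
    rw [Measure.smul_apply, Measure.dirac_apply_of_mem hp, smul_eq_mul, mul_one] at h1
    exact (ENNReal.ofReal_pos.2 (weight_pos hq)).ne' h1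

/-- Recovers pointwise information on `H_q` from `L²` norms: a continuous function vanishing almost
everywhere vanishes on the support of the measure. -/
theorem eq_zero_of_integral_nu {g : H → ℝ} (hc : Continuous g) (hg : TSupp g)
    (h0 : ∀ p, 0 ≤ g p) {q : Base} (hi : ∫ p, g p ∂nu q = 0) {p : H} (hp : proj p = q) :
    g p = 0 := by
  rw [integral_eq_zero_iff_of_nonneg h0 (hg.integrable hc q)] at hi
  subst hp
  by_contra h
  exact nu_pos (U := {p | g p ≠ 0}) (isOpen_ne_fun hc continuous_const) h (ae_iff.1 hi)

theorem ae_proj_eq (q : Base) : ∀ᵐ p ∂nu q, proj p = q := by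
  have hm : MeasurableSet {p : H | proj p = q} :=
    (isClosed_eq proj.continuous continuous_const).measurableSet
  by_cases hq : q.1 = 1
  · rw [nu, if_pos hq, muHOne, ae_map_iff measurable_HOne_to_H.aemeasurable hm]
    exact Filter.Eventually.of_forall fun p => Subtype.ext hq.symm
  · rw [nu, if_neg hq, Measure.ae_sum_iff' hm]
    intro p
    refine Measure.ae_smul_measure ?_ _
    rw [ae_dirac_iff hm]
    exact p.2

/-! ### Covariance of the measures under `θ` -/

theorem rel_theta_proj {k : ℤ} {x y : H} (h : Rel theta k x y) : proj y = proj x :=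
  Subtype.ext (by
    have h1 := congrArg Prod.fst (rel_theta h)
    exact h1)

theorem rel_theta_one {k : ℤ} {x y : H} (h : Rel theta k x y) (hx : (proj x).1 = 1) : y = x := by
  have h1 := rel_theta h
  rw [show x.1.1 = 1 from hx, one_zpow, one_mul] at h1
  exact Subtype.ext (h1.trans (Prod.ext (Eq.symm hx) rfl))

/-- The weight is quadratic in `a`, and `θ^k` fixes `q` and `t` and multiplies `a` by `q^k`. -/
theorem rel_theta_weight {k : ℤ} {x y : H} (h : Rel theta k x y) :
    weight y = x.1.1 ^ (2 * k) * weight x := by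
  have h1 := rel_theta h
  have h2 := q_pos x
  rw [weight, h1, weight]
  simp only
  rw [two_mul, zpow_add₀ h2.ne']
  ring

open Classical in
-- For `q < 1` substitute `x = θ^k(y)`: the weight contributes `q^{2k}`, which turns `q^{-k}` into
-- `q^k`. For `q = 1` the map `θ^k` is the identity on its domain and the integrands agree on the
-- fibre.
theorem integral_nu_invariant (G : H → ℂ) (k : ℤ) (q : Base)
    (hA : Integrable (fun x => if x ∈ (zPow theta (-k)).source then
      (x.1.1 : ℂ) ^ (-k) * G (zPow theta (-k) x) else 0) (nu q))
    (hB : Integrable (fun y => if y ∈ (zPow theta k).source then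
      (y.1.1 : ℂ) ^ k * G y else 0) (nu q)) :
    ∫ x, (if x ∈ (zPow theta (-k)).source then
      (x.1.1 : ℂ) ^ (-k) * G (zPow theta (-k) x) else 0) ∂nu q =
    ∫ y, (if y ∈ (zPow theta k).source then (y.1.1 : ℂ) ^ k * G y else 0) ∂nu q := by
  by_cases hq : q.1 = 1
  · refine integral_congr_ae ?_
    filter_upwards [ae_proj_eq q] with p hp
    have hp1 : (proj p).1 = 1 := by rw [hp, hq]
    have h3 : p.1.1 = 1 := hp1
    by_cases h : p ∈ (zPow theta k).source
    · have h1 : Rel theta k p p := ⟨h, rel_theta_one ⟨h, rfl⟩ hp1⟩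
      have h2 := h1.symm
      rw [if_pos h, if_pos h2.1, h2.2, h3]
      simp
    · rw [if_neg h, if_neg]
      intro h1
      have h2 : Rel theta (-k) p p := ⟨h1, rel_theta_one ⟨h1, rfl⟩ hp1⟩
      have h4 := h2.symm
      rw [neg_neg] at h4
      exact h h4.1
  · refine (hasSum_nu hq hA).unique ?_
    -- The bijection of supports is `y ↦ θ^k(y)`. The alternative value `y` only makes it total; on
    -- the support, `y` is always in the domain.
    refine (hasSum_iff_hasSum_of_ne_zero_bij (fun y : Function.support
      (fun p : {p : H // proj p = q} => (weight p.1 : ℂ) *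
        (if p.1 ∈ (zPow theta k).source then (p.1.1.1 : ℂ) ^ k * G p.1 else 0)) =>
        (⟨if y.1.1 ∈ (zPow theta k).source then zPow theta k y.1.1 else y.1.1, ?_⟩ :
          {p : H // proj p = q})) ?_ ?_ ?_).2 (hasSum_nu hq hB)
    · split_ifs with h
      · exact (rel_theta_proj ⟨h, rfl⟩).trans y.1.2
      · exact y.1.2
    · have hs : ∀ y : Function.support (fun p : {p : H // proj p = q} => (weight p.1 : ℂ) *
        (if p.1 ∈ (zPow theta k).source then (p.1.1.1 : ℂ) ^ k * G p.1 else 0)),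
        y.1.1 ∈ (zPow theta k).source := fun y => by
        by_contra h
        exact y.2 (by simp only [if_neg h, mul_zero])
      intro y y' h
      have h1 := congrArg Subtype.val h
      simp only [if_pos (hs _)] at h1
      refine Subtype.ext (Subtype.ext ?_)
      exact Rel.inj_left (⟨hs y, rfl⟩ : Rel theta k _ _) ⟨hs y', h1.symm⟩
    · intro x hx
      have h1 : x.1 ∈ (zPow theta (-k)).source := by
        by_contra h
        exact hx (by simp only [if_neg h, mul_zero])
      have h2 : Rel theta (-k) x.1 _ := ⟨h1, rfl⟩
      have h3 := h2.symm
      rw [neg_neg] at h3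
      have h0 : (0 : ℝ) < (zPow theta (-k) x.1).1.1 := q_pos _
      refine ⟨⟨⟨zPow theta (-k) x.1, (rel_theta_proj h2).trans x.2⟩, ?_⟩, ?_⟩
      · rw [Function.mem_support] at hx ⊢
        simp only [if_pos h1, if_pos h3.1] at hx ⊢
        have hG : G (zPow theta (-k) x.1) ≠ 0 := fun h => hx (by rw [h, mul_zero, mul_zero])
        refine mul_ne_zero ?_ (mul_ne_zero (zpow_ne_zero _ ?_) hG)
        · refine Complex.ofReal_ne_zero.2 (weight_pos ?_).ne'
          rw [rel_theta_proj h2, x.2]; exact hq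
        · exact Complex.ofReal_ne_zero.2 h0.ne'
      · refine Subtype.ext ?_
        simp only [if_pos h3.1]
        exact h3.2
    · intro y
      have h1 : y.1.1 ∈ (zPow theta k).source := by
        by_contra h
        exact y.2 (by simp only [if_neg h, mul_zero])
      have h2 : Rel theta k y.1.1 _ := ⟨h1, rfl⟩
      have h3 := h2.symm
      have h4 : (zPow theta k y.1.1).1.1 = y.1.1.1.1 := by
        have h6 := congrArg Prod.fst (rel_theta h2)
        exact h6
      have h5 : ((y.1.1.1.1 : ℝ) : ℂ) ≠ 0 := Complex.ofReal_ne_zero.2 (q_pos y.1.1).ne'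
      simp only [if_pos h1, if_pos h3.1, h3.2, rel_theta_weight h2, h4]
      push_cast
      rw [two_mul, zpow_add₀ h5, zpow_neg]
      field_simp

theorem integral_circle_zpow {m : ℤ} (hm : m ≠ 0) :
    ∫ z : Circle, ((z : ℂ) ^ m) ∂circleMeasure = 0 := by
  have hz : Continuous fun z : Circle => (z : ℂ) ^ m :=
    Continuous.zpow₀ continuous_subtype_val m fun z => Or.inl (Circle.coe_ne_zero z)
  rw [circleMeasure, integral_smul_measure, integral_map
    Circle.exp.continuous.measurable.aemeasurable hz.aestronglyMeasurable,
    ← intervalIntegral.integral_of_le (by positivity)]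
  have hc : (m : ℂ) * Complex.I ≠ 0 := mul_ne_zero (Int.cast_ne_zero.2 hm) Complex.I_ne_zero
  have h : ∀ x : ℝ, ((Circle.exp x : Circle) : ℂ) ^ m = Complex.exp ((m : ℂ) * Complex.I * x) := by
    intro x
    rw [Circle.coe_exp, ← Complex.exp_int_mul]; congr 1; ring
  simp only [h]
  rw [integral_exp_mul_complex hc]
  have h2 : Complex.exp ((m : ℂ) * Complex.I * ((2 * Real.pi : ℝ) : ℂ)) = 1 := by
    rw [Complex.exp_eq_one_iff]; exact ⟨m, by push_cast; ring⟩
  rw [h2]; simp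

theorem integral_mu_eq_zero (h : C_c(I, ℂ)) (u : H → ℂ) {m : ℤ} (hm : m ≠ 0)
    (hu : ∀ p z, h (p, z) = u p * (z : ℂ) ^ m) (q : Base) : ∫ x, h x ∂mu q = 0 := by
  rw [integral_mu]
  have h1 : ∀ p, circleMean h p = 0 := fun p => by
    simp only [circleMean, hu, integral_const_mul, integral_circle_zpow hm, mul_zero]
  simp [h1]

end QTri

/-! ### The action of `s^k f` on `C_c(I)` -/

namespace PartialCrossedProduct

variable {X : Type} [TopologicalSpace X] [T2Space X] {e : OpenPartialHomeomorph X X}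

theorem mulN_of_rel {k l : ℤ} (f : N e k) (g : N e l) {x y : X} (h : Rel e l x y) :
    (mulN f g : C₀(X, ℂ)) x = (f : C₀(X, ℂ)) y * (g : C₀(X, ℂ)) x := by
  rw [mulN_apply, if_pos h.1, h.2]

theorem mulN_of_not_rel {k l : ℤ} (f : N e k) (g : N e l) {x : X} (h : ∀ y, ¬ Rel e l x y) :
    (mulN f g : C₀(X, ℂ)) x = 0 := by
  rw [mulN_apply, if_neg fun h1 => h _ ⟨h1, rfl⟩]

theorem starN_of_rel {k : ℤ} (f : N e k) {x y : X} (h : Rel e k x y) :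
    (starN f : C₀(X, ℂ)) y = star ((f : C₀(X, ℂ)) x) := by
  rw [starN_apply, if_pos h.symm.1, h.symm.2]

theorem rel_refl {k : ℤ} (hk : k = 0) (x : X) : Rel e k x x := by
  subst hk; exact (rel_zero e x x).2 rfl

end PartialCrossedProduct

namespace QTri

open PartialCrossedProduct

/-- The partial homeomorphism `θ ^ k × id` of `I`. -/
noncomputable def zPowI (k : ℤ) : OpenPartialHomeomorph I I :=
  (zPow theta k).prod (OpenPartialHomeomorph.refl Circle)

/-- The product `f h` as an element of `C₀(I)`. -/
noncomputable def mulC0 (f : C₀(H, ℂ)) (h : C_c(I, ℂ)) : C₀(I, ℂ) where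
  toFun x := f x.1 * h x
  continuous_toFun := by fun_prop
  zero_at_infty' := HasCompactSupport.is_zero_at_infty (h.hasCompactSupport.mul_left)

theorem mulC0_apply (f : C₀(H, ℂ)) (h : C_c(I, ℂ)) (x : I) : mulC0 f h x = f x.1 * h x := rfl

theorem mulC0_vanish {k : ℤ} (f : N theta k) (h : C_c(I, ℂ)) :
    ∀ x, x ∉ (zPowI (-k)).target → mulC0 (f : C₀(H, ℂ)) h x = 0 := fun x hx => by
  rw [mulC0_apply, f.2 x.1 fun h1 => hx ⟨by rwa [zPow_neg_target], trivial⟩, zero_mul]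

open Classical in
theorem pull_mulC0_apply {k : ℤ} (f : N theta k) (h : C_c(I, ℂ)) (x : I) :
    pull (zPowI (-k)) (mulC0 f h) (mulC0_vanish f h) x =
      if x.1 ∈ (zPow theta (-k)).source then
        (f : C₀(H, ℂ)) (zPow theta (-k) x.1) * h (zPow theta (-k) x.1, x.2) else 0 := by
  have : x ∈ (zPowI (-k)).source ↔ x.1 ∈ (zPow theta (-k)).source :=
    ⟨fun h => h.1, fun h => ⟨h, trivial⟩⟩
  rw [pull_apply]
  simp only [this]
  rfl

theorem continuous_qz (k : ℤ) : Continuous fun x : I => (x.1.1.1 : ℂ) ^ (-k) * (x.2 : ℂ) ^ k := by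
  refine Continuous.mul ?_ ?_
  · exact Continuous.zpow₀ (by fun_prop) _ fun x =>
      Or.inl (Complex.ofReal_ne_zero.2 (q_pos x.1).ne')
  · exact Continuous.zpow₀ (by fun_prop) _ fun x => Or.inl (Circle.coe_ne_zero x.2)

/-- The operator `h ↦ Q^{-k} Z^k θ^{-k}(f h)` of `s^k f` on `C_c(I)`. -/
noncomputable def opT (k : ℤ) (f : N theta k) (h : C_c(I, ℂ)) : C_c(I, ℂ) :=
  mkCc (fun x => ((x.1.1.1 : ℂ) ^ (-k) * (x.2 : ℂ) ^ k) *
    pull (zPowI (-k)) (mulC0 f h) (mulC0_vanish f h) x)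
    ((continuous_qz k).mul (ContinuousMapClass.map_continuous _)) (by
      obtain ⟨ε, hε, hh⟩ := exists_t_bound h
      refine ⟨ε, hε, fun x hx => ?_⟩
      rw [pull_mulC0_apply]
      split_ifs with h1
      · have h2 := congrArg (fun r : ℝ × ℝ × ℝ => r.2.1)
          (rel_theta (⟨h1, rfl⟩ : Rel theta (-k) x.1 _))
        have h3 : (zPow theta (-k) x.1, x.2) ∉ upper ε := fun h4 => hx (by
          simp only [upper, Set.mem_ofPred_eq] at h2 h4 ⊢
          rwa [h2] at h4)
        rw [hh _ h3, mul_zero, mul_zero]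
      · rw [mul_zero])

theorem opT_of_rel {k : ℤ} (f : N theta k) (h : C_c(I, ℂ)) {x y : H} (hxy : Rel theta k y x)
    (z : Circle) : opT k f h (x, z) =
      (x.1.1 : ℂ) ^ (-k) * (z : ℂ) ^ k * ((f : C₀(H, ℂ)) y * h (y, z)) := by
  rw [opT, mkCc_apply, pull_mulC0_apply, if_pos hxy.symm.1, hxy.symm.2]

theorem opT_of_not_rel {k : ℤ} (f : N theta k) (h : C_c(I, ℂ)) {x : H}
    (hx : ∀ y, ¬ Rel theta k y x) (z : Circle) : opT k f h (x, z) = 0 := by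
  rw [opT, mkCc_apply, pull_mulC0_apply, if_neg, mul_zero]
  intro h1
  have h2 := Rel.symm (⟨h1, rfl⟩ : Rel theta (-k) x _)
  rw [neg_neg] at h2
  exact hx _ h2

/-- The action of `⊕_k N_k` on `C_c(I)`. -/
noncomputable def preRep : PreRep theta C_c(I, ℂ) where
  toFun k :=
    { toFun := fun f =>
        { toFun := opT k f
          map_add' := fun h h' => by
            ext ⟨x, z⟩
            rw [CompactlySupportedContinuousMap.add_apply]
            by_cases hx : ∃ y, Rel theta k y x
            · obtain ⟨y, hy⟩ := hx
              simp only [opT_of_rel _ _ hy, CompactlySupportedContinuousMap.add_apply]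
              ring
            · push Not at hx
              simp only [opT_of_not_rel _ _ hx, add_zero]
          map_smul' := fun c h => by
            ext ⟨x, z⟩
            rw [RingHom.id_apply, CompactlySupportedContinuousMap.smul_apply]
            by_cases hx : ∃ y, Rel theta k y x
            · obtain ⟨y, hy⟩ := hx
              simp only [opT_of_rel _ _ hy, CompactlySupportedContinuousMap.smul_apply, smul_eq_mul]
              ring
            · push Not at hx
              simp only [opT_of_not_rel _ _ hx, smul_zero] }
      map_add' := fun f g => by
        refine LinearMap.ext fun h => ?_
        ext ⟨x, z⟩
        change opT k (f + g) h (x, z) = opT k f h (x, z) + opT k g h (x, z)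
        by_cases hx : ∃ y, Rel theta k y x
        · obtain ⟨y, hy⟩ := hx
          simp only [opT_of_rel _ _ hy, Submodule.coe_add, ZeroAtInftyContinuousMap.add_apply]
          ring
        · push Not at hx
          simp only [opT_of_not_rel _ _ hx, add_zero]
      map_smul' := fun c f => by
        refine LinearMap.ext fun h => ?_
        ext ⟨x, z⟩
        change opT k (c • f) h (x, z) = c * opT k f h (x, z)
        by_cases hx : ∃ y, Rel theta k y x
        · obtain ⟨y, hy⟩ := hx
          simp only [opT_of_rel _ _ hy, Submodule.coe_smul, ZeroAtInftyContinuousMap.smul_apply,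
            smul_eq_mul]
          ring
        · push Not at hx
          simp only [opT_of_not_rel _ _ hx, mul_zero] }
  map_mul k l f g h := by
    ext ⟨x, z⟩
    change opT k f (opT l g h) (x, z) = opT (k + l) (mulN f g) h (x, z)
    have hz : (z : ℂ) ≠ 0 := Circle.coe_ne_zero z
    have hq : (x.1.1 : ℂ) ≠ 0 := Complex.ofReal_ne_zero.2 (q_pos x).ne'
    by_cases hw : ∃ w, Rel theta (k + l) w x
    · obtain ⟨w, hw⟩ := hw
      rw [opT_of_rel _ _ hw]
      by_cases hy : ∃ y, Rel theta l w y
      · obtain ⟨y, hy⟩ := hy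
        have h1 : Rel theta k y x := by
          have := hy.symm.add hw
          rwa [show -l + (k + l) = k by ring] at this
        have h2 : y.1.1 = x.1.1 := (congrArg Subtype.val (rel_theta_proj h1)).symm
        rw [opT_of_rel _ _ h1, opT_of_rel _ _ hy, mulN_of_rel _ _ hy, h2, neg_add,
          zpow_add₀ hq, zpow_add₀ hz]
        ring
      -- Here `w` is outside the domain of `θ^l`, so the product symbol vanishes at `w`. The left
      -- side vanishes too: any `w'` with `θ^l(w')` defined and sent to `x` by `θ^k` would equal `w`
      -- by injectivity.
      · push Not at hy
        rw [mulN_of_not_rel _ _ hy, zero_mul, mul_zero]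
        by_cases h1 : ∃ y, Rel theta k y x
        · obtain ⟨y, h1⟩ := h1
          rw [opT_of_rel _ _ h1, opT_of_not_rel, mul_zero, mul_zero]
          intro w' hw'
          have h2 := hw'.add h1
          rw [add_comm] at h2
          exact hy y (h2.inj_left hw ▸ hw')
        · push Not at h1
          rw [opT_of_not_rel _ _ h1]
    · push Not at hw
      rw [opT_of_not_rel _ _ hw]
      by_cases h1 : ∃ y, Rel theta k y x
      · obtain ⟨y, h1⟩ := h1
        rw [opT_of_rel _ _ h1, opT_of_not_rel, mul_zero, mul_zero]
        intro w' hw'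
        have h2 := hw'.add h1
        rw [add_comm] at h2
        exact hw w' h2
      · push Not at h1
        rw [opT_of_not_rel _ _ h1]

theorem preRep_apply (k : ℤ) (f : N theta k) (h : C_c(I, ℂ)) :
    preRep.toFun k f h = opT k f h := rfl

/-- The map `C_c(I) → L²(I_q)`. -/
noncomputable def toL2 (q : Base) : C_c(I, ℂ) →ₗ[ℂ] L2 q where
  toFun h := toSections h q
  map_add' h h' := by rw [map_add]; rfl
  map_smul' c h := by rw [map_smul]; rfl

/-- The function `ū v`. -/
noncomputable def conjMul (u v : C_c(I, ℂ)) : C_c(I, ℂ) :=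
  mkCc (fun x => star (u x) * v x) (by fun_prop) (by
    obtain ⟨ε, hε, hh⟩ := exists_t_bound v
    exact ⟨ε, hε, fun x hx => by rw [hh x hx, mul_zero]⟩)

theorem conjMul_apply (u v : C_c(I, ℂ)) (x : I) : conjMul u v x = star (u x) * v x := rfl

theorem inner_toL2 (q : Base) (u v : C_c(I, ℂ)) :
    inner ℂ (toL2 q u) (toL2 q v) = ∫ x, conjMul u v x ∂mu q := by
  rw [L2.inner_def]
  refine integral_congr_ae ?_
  filter_upwards [(memLp_of_compact u q).coeFn_toLp, (memLp_of_compact v q).coeFn_toLp]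
    with x hu hv
  change inner ℂ ((memLp_of_compact u q).toLp u x) ((memLp_of_compact v q).toLp v x) = _
  rw [hu, hv, RCLike.inner_apply, mul_comm]
  rfl

open Classical in
-- After integration over the circle, the two sides are those of `integral_nu_invariant` for one
-- function `G`; on the circle the conjugate of `z^k` is `z^{-k}`.
theorem inner_opT (q : Base) (k : ℤ) (f : N theta k) (v w : C_c(I, ℂ)) :
    inner ℂ (toL2 q (opT k f v)) (toL2 q w) =
      inner ℂ (toL2 q v) (toL2 q (opT (-k) (starN f) w)) := by
  rw [inner_toL2, inner_toL2, integral_mu, integral_mu]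
  let G : H → ℂ := fun y => ∫ z : Circle, (z : ℂ) ^ (-k) * (star ((f : C₀(H, ℂ)) y) *
    star (v (y, z)) * w (zPow theta k y, z)) ∂circleMeasure
  have hA : circleMean (conjMul (opT k f v) w) = fun x =>
      if x ∈ (zPow theta (-k)).source then
        (x.1.1 : ℂ) ^ (-k) * G (zPow theta (-k) x) else 0 := by
    funext x
    split_ifs with h
    · have h1 := Rel.symm (⟨h, rfl⟩ : Rel theta (-k) x _)
      rw [neg_neg] at h1
      simp only [G, circleMean, ← integral_const_mul, conjMul_apply]
      congr 1
      funext z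
      rw [opT_of_rel _ _ h1, h1.2, star_mul, star_mul, star_mul, star_zpow₀, star_zpow₀,
        zpow_neg (z : ℂ), ← inv_zpow (z : ℂ), ← Circle.coe_inv, Circle.coe_inv_eq_conj]
      simp only [Complex.star_def, Complex.conj_ofReal]
      ring
    · have h1 : ∀ y, ¬ Rel theta k y x := fun y hy => h hy.symm.1
      simp [circleMean, conjMul_apply, opT_of_not_rel _ _ h1]
  have hB : circleMean (conjMul v (opT (-k) (starN f) w)) = fun y =>
      if y ∈ (zPow theta k).source then (y.1.1 : ℂ) ^ k * G y else 0 := by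
    funext y
    split_ifs with h
    · have h1 : Rel theta k y _ := ⟨h, rfl⟩
      simp only [G, circleMean, ← integral_const_mul, conjMul_apply]
      congr 1
      funext z
      rw [opT_of_rel _ _ h1.symm, starN_of_rel _ h1, neg_neg]
      ring
    · have h1 : ∀ x, ¬ Rel theta (-k) x y := fun x hx => h (by
        have := hx.symm
        rw [neg_neg] at this
        exact this.1)
      simp [circleMean, conjMul_apply, opT_of_not_rel _ _ h1]
  have hiA := (tSupp_circleMean (conjMul (opT k f v) w)).integrable (continuous_circleMean _) q
  have hiB := (tSupp_circleMean (conjMul v (opT (-k) (starN f) w))).integrable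
    (continuous_circleMean _) q
  rw [hA] at hiA ⊢
  rw [hB] at hiB ⊢
  exact integral_nu_invariant G k q hiA hiB

theorem norm_sq_toL2 (q : Base) (u : C_c(I, ℂ)) :
    ‖toL2 q u‖ ^ 2 = ∫ x, ‖u x‖ ^ 2 ∂mu q := by
  have h : ((‖toL2 q u‖ ^ 2 : ℝ) : ℂ) = ((∫ x, ‖u x‖ ^ 2 ∂mu q : ℝ) : ℂ) := by
    rw [← integral_complex_ofReal, Complex.ofReal_pow]
    refine (inner_self_eq_norm_sq_to_K (𝕜 := ℂ) (toL2 q u)).symm.trans ?_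
    rw [inner_toL2]
    refine integral_congr_ae (Filter.Eventually.of_forall fun x => ?_)
    simp only [conjMul_apply, Complex.star_def, Complex.conj_mul']
    push_cast; rfl
  exact_mod_cast h

/-- The product `f h`. -/
noncomputable def mulCc (f : C₀(H, ℂ)) (h : C_c(I, ℂ)) : C_c(I, ℂ) :=
  mkCc (fun x => f x.1 * h x) (by fun_prop) (by
    obtain ⟨ε, hε, hh⟩ := exists_t_bound h
    exact ⟨ε, hε, fun x hx => by rw [hh x hx, mul_zero]⟩)

theorem mulCc_apply (f : C₀(H, ℂ)) (h : C_c(I, ℂ)) (x : I) : mulCc f h x = f x.1 * h x := rfl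

/-- Because `(s^k f)^* (s^k f) = |f|²` has degree zero. Norms in any degree thus reduce to
multiplication operators. -/
theorem norm_opT (q : Base) (k : ℤ) (f : N theta k) (v : C_c(I, ℂ)) :
    ‖toL2 q (opT k f v)‖ = ‖toL2 q (mulCc f v)‖ := by
  have h1 : inner ℂ (toL2 q (opT k f v)) (toL2 q (opT k f v)) =
      inner ℂ (toL2 q (mulCc f v)) (toL2 q (mulCc f v)) := by
    rw [inner_opT, ← preRep_apply (-k), ← preRep_apply k, preRep.map_mul, inner_toL2, inner_toL2]
    refine integral_congr_ae (Filter.Eventually.of_forall fun x => ?_)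
    simp only [conjMul_apply, mulCc_apply]
    obtain ⟨x, z⟩ := x
    rw [preRep_apply, opT_of_rel _ _ (rel_refl (neg_add_cancel k) x), mulN_starN_apply,
      neg_add_cancel, neg_zero, zpow_zero, zpow_zero, star_mul]
    ring
  rw [inner_self_eq_norm_sq_to_K, inner_self_eq_norm_sq_to_K] at h1
  have h2 : ‖toL2 q (opT k f v)‖ ^ 2 = ‖toL2 q (mulCc f v)‖ ^ 2 := by exact_mod_cast h1
  exact (sq_eq_sq₀ (norm_nonneg _) (norm_nonneg _)).1 h2

theorem integrable_norm_sq (q : Base) (u : C_c(I, ℂ)) :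
    Integrable (fun x => ‖u x‖ ^ 2) (mu q) := by
  refine Continuous.integrable_of_hasCompactSupport (by fun_prop) ?_
  obtain ⟨ε, hε, hh⟩ := exists_t_bound u
  exact HasCompactSupport.intro (isCompact_upper hε) fun x hx => by rw [hh x hx]; simp

theorem norm_toL2_le (q : Base) (u v : C_c(I, ℂ)) {C : ℝ} (hC : 0 ≤ C)
    (h : ∀ x, ‖u x‖ ≤ C * ‖v x‖) : ‖toL2 q u‖ ≤ C * ‖toL2 q v‖ := by
  refine abs_le_of_sq_le_sq' ?_ (by positivity) |>.2
  rw [mul_pow, norm_sq_toL2, norm_sq_toL2, ← integral_const_mul]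
  refine integral_mono (integrable_norm_sq q u) ((integrable_norm_sq q v).const_mul _) fun x => ?_
  simp only
  rw [← mul_pow]
  exact pow_le_pow_left₀ (norm_nonneg _) (h x) 2

theorem norm_opT_le (q : Base) (k : ℤ) (f : N theta k) (v : C_c(I, ℂ)) :
    ‖toL2 q (opT k f v)‖ ≤ ‖f‖ * ‖toL2 q v‖ := by
  rw [norm_opT]
  refine norm_toL2_le q _ _ (norm_nonneg (f : C₀(H, ℂ))) fun x => ?_
  rw [mulCc_apply, norm_mul]
  refine mul_le_mul_of_nonneg_right ?_ (norm_nonneg _)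
  exact (f : C₀(H, ℂ)).toBCF.norm_coe_le_norm x.1

theorem isStar_preRep (q : Base) : preRep.IsStar (toL2 q) :=
  ⟨fun k f v w => inner_opT q k f v w, fun k f v => norm_opT_le q k f v⟩

/-- `L²(I_q)` is second countable, so the universal norm controls the action on it. -/
theorem norm_preRep_sum_le (q : Base) (x : SymAlg theta) (v : C_c(I, ℂ)) :
    ‖toL2 q (preRep.sum x v)‖ ≤ ‖symSum theta x‖ * ‖toL2 q v‖ := by
  have : Fact ((2 : ℝ≥0∞) ≠ ∞) := ⟨by norm_num⟩
  have : SecondCountableTopology (L2 q) := inferInstance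
  exact preRep.norm_sum_le (isStar_preRep q) x v

end QTri

/-! ### The Hilbert module and the representation on it -/

theorem exists_zeroAtInfty_of_approx {Y : Type*} [TopologicalSpace Y] (F : Y → ℂ)
    (h : ∀ ε > 0, ∃ φ : C₀(Y, ℂ), ∀ y, ‖φ y - F y‖ ≤ ε) : ∃ φ : C₀(Y, ℂ), ∀ y, φ y = F y := by
  have hc : Continuous F := by
    refine continuous_of_uniform_approx_of_continuous fun u hu => ?_
    obtain ⟨ε, hε, hεu⟩ := Metric.mem_uniformity_dist.1 hu
    obtain ⟨φ, hφ⟩ := h (ε / 2) (half_pos hε)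
    refine ⟨φ, φ.continuous, fun y => hεu ?_⟩
    rw [dist_comm, dist_eq_norm]
    exact (hφ y).trans_lt (half_lt_self hε)
  refine ⟨⟨⟨F, hc⟩, ?_⟩, fun y => rfl⟩
  rw [Metric.tendsto_nhds]
  intro ε hε
  obtain ⟨φ, hφ⟩ := h (ε / 2) (half_pos hε)
  filter_upwards [Metric.tendsto_nhds.1 φ.zero_at_infty' (ε / 2) (half_pos hε)] with y hy
  have h1 := hφ y
  rw [norm_sub_rev, ← dist_eq_norm] at h1
  calc dist (F y) 0 ≤ dist (F y) (φ y) + dist (φ y) 0 := dist_triangle _ _ _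
    _ < ε / 2 + ε / 2 := add_lt_add_of_le_of_lt h1 hy
    _ = ε := add_halves ε

namespace PartialCrossedProduct
variable {X : Type} [TopologicalSpace X] [T2Space X] {e : OpenPartialHomeomorph X X}
variable {F : Type*} [NormedAddCommGroup F] [NormedSpace ℂ F] [CompleteSpace F]

/-- The extension of a contractive linear map on `⊕_k N_k` to the crossed product. -/
noncomputable def extendSym (S : SymAlg e →ₗ[ℂ] F) : CrossedProduct e →L[ℂ] F :=
  LinearMap.extendOfNorm S (symSum e)

theorem extendSym_symSum {S : SymAlg e →ₗ[ℂ] F} (hS : ∀ x, ‖S x‖ ≤ ‖symSum e x‖) (x : SymAlg e) :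
    extendSym S (symSum e x) = S x :=
  LinearMap.extendOfNorm_eq (denseRange_symSum e) ⟨1, fun x => by rw [one_mul]; exact hS x⟩ x

end PartialCrossedProduct

namespace QTri

open PartialCrossedProduct HilbertField

/-- The canonical map `C_c(I) → 𝓘` as a linear map. -/
noncomputable def toHilb : C_c(I, ℂ) →ₗ[ℂ] HilbI :=
  toSections.codRestrict HilbI fun h => Submodule.le_topologicalClosure _ ⟨h, rfl⟩

theorem denseRange_toHilb : DenseRange toHilb := by
  intro y
  refine Metric.mem_closure_iff.2 fun ε hε => ?_
  obtain ⟨_, ⟨v, rfl⟩, hv⟩ := Metric.mem_closure_iff.1 (show (y : Sections) ∈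
    closure (LinearMap.range toSections : Set Sections) from y.2) ε hε
  exact ⟨_, ⟨v, rfl⟩, hv⟩

instance : CompleteSpace HilbI := Submodule.topologicalClosure.completeSpace _

/-- The localisation map `ξ ↦ ξ_q`. -/
noncomputable def evalAt (q : Base) : HilbI →L[ℂ] L2 q :=
  LinearMap.mkContinuous
    { toFun := fun ξ => ξ.1 q
      map_add' := fun _ _ => rfl
      map_smul' := fun _ _ => rfl } 1 fun ξ => by
    rw [one_mul]; exact lp.norm_apply_le_norm ENNReal.top_ne_zero ξ.1 q

theorem evalAt_toHilb (q : Base) (h : C_c(I, ℂ)) : evalAt q (toHilb h) = toL2 q h := rfl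

theorem norm_evalAt_le (q : Base) (ξ : HilbI) : ‖evalAt q ξ‖ ≤ ‖ξ‖ :=
  lp.norm_apply_le_norm ENNReal.top_ne_zero ξ.1 q

theorem norm_le_of_evalAt {ξ : HilbI} {C : ℝ} (hC : 0 ≤ C) (h : ∀ q, ‖evalAt q ξ‖ ≤ C) :
    ‖ξ‖ ≤ C :=
  lp.norm_le_of_forall_le (E := fun q : Base => L2 q) hC h

theorem hilb_ext {ξ η : HilbI} (h : ∀ q, evalAt q ξ = evalAt q η) : ξ = η :=
  Subtype.ext (lp.ext (funext h))

theorem ae_mu_proj_eq (q : Base) : ∀ᵐ x ∂mu q, proj x.1 = q := by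
  rw [mu_eq_prod]
  exact Measure.quasiMeasurePreserving_fst.ae (ae_proj_eq q)

theorem isCompact_base {ε : ℝ} (hε : 0 < ε) : IsCompact {q : Base | ε ≤ q.1} := by
  rw [Subtype.isCompact_iff]
  have h : Subtype.val '' {q : Base | ε ≤ q.1} = Set.Icc ε 1 := by
    ext r
    simp only [Set.mem_image, Set.mem_ofPred_eq, Set.mem_Icc]
    constructor
    · rintro ⟨q, h, rfl⟩; exact ⟨h, q.2.2⟩
    · rintro ⟨h1, h2⟩; exact ⟨⟨r, hε.trans_le h1, h2⟩, h1, rfl⟩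
  rw [h]; exact isCompact_Icc

/-- The function `q ↦ ψ(h)(q)`. -/
noncomputable def integralC0 (h : C_c(I, ℂ)) : C₀(Base, ℂ) where
  toFun q := ∫ x, h x ∂mu q
  continuous_toFun := by
    simp only [integral_mu]
    exact continuous_integral_nu (continuous_circleMean h) (tSupp_circleMean h)
  zero_at_infty' := by
    -- Since `t ≤ q` on `H`, a function that vanishes for `t < ε` has integral zero over every fibre
    -- with `q < ε`.
    obtain ⟨ε, hε, hh⟩ := tSupp_circleMean h
    refine HasCompactSupport.is_zero_at_infty (HasCompactSupport.intro (isCompact_base hε)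
      fun q hq => ?_)
    rw [integral_mu]
    refine integral_eq_zero_of_ae ?_
    filter_upwards [ae_proj_eq q] with p hp
    refine hh p ((H_bounds p).1.trans_lt ?_)
    rw [show p.1.1 = q.1 from congrArg Subtype.val hp]
    exact not_le.1 hq

theorem exists_toHilb_near (ξ : HilbI) {ε : ℝ} (hε : 0 < ε) : ∃ h, ‖ξ - toHilb h‖ < ε := by
  obtain ⟨_, ⟨h, rfl⟩, hh⟩ := Metric.mem_closure_iff.1 (denseRange_toHilb ξ) ε hε
  exact ⟨h, by rwa [dist_eq_norm] at hh⟩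

/-- For `u, v ∈ C_c(I)` the inner product is `ψ(ū v)`. By Cauchy–Schwarz, approximating first one
argument and then the other gives uniform convergence in `q`. -/
theorem exists_inner_C0 (ξ η : HilbI) :
    ∃ φ : C₀(Base, ℂ), ∀ q, φ q = inner ℂ (evalAt q ξ) (evalAt q η) := by
  have h1 : ∀ (v : C_c(I, ℂ)) (ξ : HilbI), ∃ φ : C₀(Base, ℂ), ∀ q,
      φ q = inner ℂ (evalAt q ξ) (evalAt q (toHilb v)) := by
    intro v ξ
    refine exists_zeroAtInfty_of_approx _ fun ε hε => ?_
    obtain ⟨u, hu⟩ := exists_toHilb_near ξ (show 0 < ε / (‖toHilb v‖ + 1) by positivity)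
    refine ⟨integralC0 (conjMul u v), fun q => ?_⟩
    have h2 : integralC0 (conjMul u v) q = inner ℂ (evalAt q (toHilb u)) (evalAt q (toHilb v)) :=
      (inner_toL2 q u v).symm
    rw [h2, ← inner_sub_left, ← map_sub]
    refine (norm_inner_le_norm _ _).trans ?_
    have h3 := (norm_evalAt_le q (toHilb u - ξ)).trans (norm_sub_rev _ _).le
    have h4 := norm_evalAt_le q (toHilb v)
    calc _ ≤ ε / (‖toHilb v‖ + 1) * (‖toHilb v‖ + 1) :=
          mul_le_mul (h3.trans hu.le) (by linarith) (norm_nonneg _) (by positivity)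
      _ = ε := div_mul_cancel₀ _ (by positivity)
  refine exists_zeroAtInfty_of_approx _ fun ε hε => ?_
  obtain ⟨v, hv⟩ := exists_toHilb_near η (show 0 < ε / (‖ξ‖ + 1) by positivity)
  obtain ⟨φ, hφ⟩ := h1 v ξ
  refine ⟨φ, fun q => ?_⟩
  rw [hφ, ← inner_sub_right, ← map_sub]
  refine (norm_inner_le_norm _ _).trans ?_
  have h3 := (norm_evalAt_le q (toHilb v - η)).trans (norm_sub_rev _ _).le
  have h4 := norm_evalAt_le q ξ
  calc _ ≤ (‖ξ‖ + 1) * (ε / (‖ξ‖ + 1)) :=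
        mul_le_mul (by linarith) (h3.trans hv.le) (norm_nonneg _) (by positivity)
    _ = ε := mul_div_cancel₀ _ (by positivity)

/-- The product of `h` and the function `φ(q)`. -/
noncomputable def baseMul (φ : C₀(Base, ℂ)) (h : C_c(I, ℂ)) : C_c(I, ℂ) :=
  mkCc (fun x => φ (proj x.1) * h x) (by fun_prop) (by
    obtain ⟨ε, hε, hh⟩ := exists_t_bound h
    exact ⟨ε, hε, fun x hx => by rw [hh x hx, mul_zero]⟩)

/-- The measure over `q` is carried by the fibre over `q`, so `φ ∘ proj` is almost everywhere the
constant `φ q`. -/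
theorem toL2_baseMul (φ : C₀(Base, ℂ)) (h : C_c(I, ℂ)) (q : Base) :
    toL2 q (baseMul φ h) = φ q • toL2 q h := by
  change (memLp_of_compact _ q).toLp _ = φ q • (memLp_of_compact h q).toLp _
  rw [← MemLp.toLp_const_smul, MemLp.toLp_eq_toLp_iff]
  filter_upwards [ae_mu_proj_eq q] with x hx
  change φ (proj x.1) * h x = φ q * h x
  rw [hx]

theorem norm_C0_apply_le {Y : Type*} [TopologicalSpace Y] (φ : C₀(Y, ℂ)) (y : Y) :
    ‖φ y‖ ≤ ‖φ‖ := φ.toBCF.norm_coe_le_norm y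

theorem exists_smul (φ : C₀(Base, ℂ)) (ξ : HilbI) :
    ∃ η : HilbI, ∀ q, evalAt q η = φ q • evalAt q ξ := by
  have hb : ∀ q, ‖φ q • evalAt q ξ‖ ≤ ‖φ‖ * ‖ξ‖ := fun q => by
    rw [norm_smul]
    exact mul_le_mul (norm_C0_apply_le φ q) (norm_evalAt_le q ξ) (norm_nonneg _) (norm_nonneg _)
  let η : Sections := ⟨fun q => φ q • evalAt q ξ, memℓp_infty ⟨‖φ‖ * ‖ξ‖, by
    rintro _ ⟨q, rfl⟩; exact hb q⟩⟩
  refine ⟨⟨η, ?_⟩, fun q => rfl⟩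
  refine Metric.mem_closure_iff.2 fun ε hε => ?_
  obtain ⟨h, hh⟩ := exists_toHilb_near ξ (show 0 < ε / 2 / (‖φ‖ + 1) by positivity)
  refine ⟨_, ⟨baseMul φ h, rfl⟩, ?_⟩
  rw [dist_eq_norm]
  refine lt_of_le_of_lt (lp.norm_le_of_forall_le (half_pos hε).le fun q => ?_) (half_lt_self hε)
  have h1 : (η - toSections (baseMul φ h)) q = φ q • evalAt q (ξ - toHilb h) := by
    rw [map_sub, smul_sub, evalAt_toHilb, ← toL2_baseMul]; rfl
  rw [h1, norm_smul]
  calc _ ≤ (‖φ‖ + 1) * (ε / 2 / (‖φ‖ + 1)) :=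
        mul_le_mul ((norm_C0_apply_le φ q).trans (by linarith))
          ((norm_evalAt_le q _).trans hh.le) (norm_nonneg _) (by positivity)
    _ = ε / 2 := mul_div_cancel₀ _ (by positivity)

theorem isHilbertModule : IsHilbertModule HilbI where
  isClosed := Submodule.isClosed_topologicalClosure _
  smul_mem φ ξ hξ := by
    obtain ⟨η, hη⟩ := exists_smul φ ⟨ξ, hξ⟩
    exact ⟨η.1, η.2, hη⟩
  inner_mem ξ hξ η hη := exists_inner_C0 ⟨ξ, hξ⟩ ⟨η, hη⟩

theorem norm_toHilb_sum_le (x : SymAlg theta) (h : C_c(I, ℂ)) :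
    ‖toHilb (preRep.sum x h)‖ ≤ ‖symSum theta x‖ * ‖toHilb h‖ := by
  refine norm_le_of_evalAt (by positivity) fun q => ?_
  rw [evalAt_toHilb]
  refine (norm_preRep_sum_le q x h).trans (mul_le_mul_of_nonneg_left ?_ (norm_nonneg _))
  exact norm_evalAt_le q (toHilb h)

/-- The operator of an element of `⊕_k N_k` on `𝓘`. -/
noncomputable def symOp (x : SymAlg theta) : HilbI →L[ℂ] HilbI :=
  LinearMap.extendOfNorm (toHilb ∘ₗ preRep.sum x) toHilb

theorem symOp_toHilb (x : SymAlg theta) (h : C_c(I, ℂ)) :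
    symOp x (toHilb h) = toHilb (preRep.sum x h) :=
  LinearMap.extendOfNorm_eq denseRange_toHilb ⟨_, norm_toHilb_sum_le x⟩ h

theorem norm_symOp_le (x : SymAlg theta) : ‖symOp x‖ ≤ ‖symSum theta x‖ :=
  LinearMap.opNorm_extendOfNorm_le denseRange_toHilb (norm_nonneg _) (norm_toHilb_sum_le x)

theorem op_ext {S T : HilbI →L[ℂ] HilbI} (h : ∀ v, S (toHilb v) = T (toHilb v)) : S = T := by
  ext1 ξ
  exact denseRange_toHilb.induction_on ξ (isClosed_eq S.continuous T.continuous) h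

/-- `symOp` as a linear map. -/
noncomputable def symOpL : SymAlg theta →ₗ[ℂ] (HilbI →L[ℂ] HilbI) where
  toFun := symOp
  map_add' x y := op_ext fun v => by
    rw [add_apply]
    simp only [symOp_toHilb, map_add, LinearMap.add_apply]
  map_smul' c x := op_ext fun v => by
    simp only [RingHom.id_apply, smul_apply, symOp_toHilb, map_smul,
      LinearMap.smul_apply]

theorem symOpL_apply (x : SymAlg theta) : symOpL x = symOp x := rfl

theorem norm_symOpL_le (x : SymAlg theta) : ‖symOpL x‖ ≤ ‖symSum theta x‖ := by
  rw [symOpL_apply]; exact norm_symOp_le x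

/-- The underlying linear map of the representation of `C₀(G)` on `𝓘`. -/
noncomputable def piL : CrossedProduct theta →L[ℂ] (HilbI →L[ℂ] HilbI) :=
  extendSym (F := HilbI →L[ℂ] HilbI) symOpL

theorem piL_symSum (x : SymAlg theta) : piL (symSum theta x) = symOp x := by
  rw [← symOpL_apply]
  have h := extendSym_symSum (F := HilbI →L[ℂ] HilbI) norm_symOpL_le x
  exact h

theorem piL_sym (k : ℤ) (f : N theta k) (h : C_c(I, ℂ)) :
    piL (sym theta k f) (toHilb h) = toHilb (opT k f h) := by
  rw [← symSum_single, piL_symSum, symOp_toHilb, PreRep.sum_single]; rfl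

theorem piL_mul (a b : CrossedProduct theta) (ξ : HilbI) : piL (a * b) ξ = piL a (piL b ξ) := by
  refine denseRange_toHilb.induction_on ξ (isClosed_eq (by fun_prop) (by fun_prop)) fun v => ?_
  induction a using crossedProduct_induction with
  | closed => exact isClosed_eq (by fun_prop) (by fun_prop)
  | zero => simp
  | add a a' h h' => rw [add_mul, map_add, map_add, add_apply, add_apply, h, h']
  | gen k f =>
    induction b using crossedProduct_induction with
    | closed => exact isClosed_eq (by fun_prop) (by fun_prop)
    | zero => simp
    | add a a' h h' => rw [mul_add, map_add, map_add, add_apply, add_apply, map_add, h, h']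
    | gen l g =>
      rw [sym_mul, piL_sym, piL_sym, piL_sym]
      exact congrArg toHilb (preRep.map_mul k l f g v).symm

/-- The representation of `C₀(G)` on `𝓘`. -/
noncomputable def piHom : CrossedProduct theta →ₙₐ[ℂ] (HilbI →L[ℂ] HilbI) where
  toFun := piL
  map_smul' c a := map_smul piL c a
  map_zero' := map_zero piL
  map_add' := map_add piL
  map_mul' a b := ContinuousLinearMap.ext (piL_mul a b)

theorem inner_piL (a : CrossedProduct theta) (ξ η : HilbI) (q : Base) :
    inner ℂ (evalAt q (piL a ξ)) (evalAt q η) =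
      inner ℂ (evalAt q ξ) (evalAt q (piL (star a) η)) := by
  refine denseRange_toHilb.induction_on ξ (isClosed_eq (by fun_prop) (by fun_prop)) fun v => ?_
  refine denseRange_toHilb.induction_on η (isClosed_eq (by fun_prop) (by fun_prop)) fun w => ?_
  induction a using crossedProduct_induction with
  | closed => exact isClosed_eq (by fun_prop) (by fun_prop)
  | zero => simp
  | add a a' h h' =>
    simp only [map_add, star_add, add_apply, inner_add_left,
      inner_add_right, h, h']
  | gen k f =>
    rw [star_sym, piL_sym, piL_sym]
    exact inner_opT q k f v w

theorem isAdjointPair_piHom (a : CrossedProduct theta) :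
    IsAdjointPair HilbI (piHom a) (piHom (star a)) := fun ξ η q => inner_piL a ξ η q

/-- `θ` preserves `q`, so functions of `q` commute with the shift; this is the source of
`C₀((0,1])`-linearity. -/
theorem opT_bmul (φ : C₀(Base, ℂ)) (k : ℤ) (f : N theta k) (h : C_c(I, ℂ)) :
    opT k (bmul (baseFun proj φ) k f) h = baseMul φ (opT k f h) := by
  ext ⟨x, z⟩
  change _ = φ (proj x) * _
  by_cases hx : ∃ y, Rel theta k y x
  · obtain ⟨y, hy⟩ := hx
    rw [opT_of_rel _ _ hy, opT_of_rel _ _ hy, bmul_apply, rel_theta_proj hy]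
    change _ * (φ (proj y) * _ * _) = _
    ring
  · push Not at hx
    rw [opT_of_not_rel _ _ hx, opT_of_not_rel _ _ hx, mul_zero]

theorem piL_baseAct (φ : C₀(Base, ℂ)) (a : CrossedProduct theta) (ξ : HilbI) (q : Base) :
    evalAt q (piL (baseAct theta proj φ a) ξ) = φ q • evalAt q (piL a ξ) := by
  refine denseRange_toHilb.induction_on ξ (isClosed_eq (by fun_prop) (by fun_prop)) fun v => ?_
  induction a using crossedProduct_induction with
  | closed => exact isClosed_eq (by fun_prop) (by fun_prop)
  | zero => simp
  | add a a' h h' =>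
    simp only [map_add, add_apply, smul_add, h, h']
  | gen k f =>
    rw [baseAct_sym theta proj proj_theta, piL_sym, piL_sym, opT_bmul, evalAt_toHilb,
      evalAt_toHilb, toL2_baseMul]

end QTri

/-! ### Elements of the kernel of a localisation -/

namespace PartialCrossedProduct

variable {X : Type} [TopologicalSpace X] [T2Space X] {e : OpenPartialHomeomorph X X}

theorem norm_sym_le {k : ℤ} (f : N e k) {C : ℝ} (hC : 0 ≤ C)
    (h : ∀ x, ‖(f : C₀(X, ℂ)) x‖ ≤ C) : ‖sym e k f‖ ≤ C := by
  have h1 : ‖(f : C₀(X, ℂ))‖ ≤ C := by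
    rw [← ZeroAtInftyContinuousMap.norm_toBCF_eq_norm, BoundedContinuousFunction.norm_le hC]
    exact h
  refine norm_le_of_eval _ hC fun ρ => ?_
  rw [← symSum_single, Rep.eval_symSum, Rep.sum_single]
  exact (ρ.norm_le k f).trans h1

variable {Y : Type} [TopologicalSpace Y] [T2Space Y] [LocallyCompactSpace Y]

/-- The set where `|f| ≥ ε/2` is compact and its image in `Y` misses `y`. A Urysohn function `φ`,
equal to `1` on that image and to `0` at `y`, changes `f` by at most `ε/2`. -/
theorem sym_mem_localIdeal (p : C(X, Y)) (hp : ∀ x ∈ e.source, p (e x) = p x) {k : ℤ}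
    (f : N e k) {y : Y} (hf : ∀ x, p x = y → (f : C₀(X, ℂ)) x = 0) :
    sym e k f ∈ HilbertField.localIdeal (fun φ a => baseAct e p φ a) y := by
  refine Metric.mem_closure_iff.2 fun ε hε => ?_
  set K := p '' {x | ε / 2 ≤ ‖(f : C₀(X, ℂ)) x‖} with hK
  have hKc : IsCompact K := (isCompact_le_norm (f : C₀(X, ℂ)) (half_pos hε)).image p.continuous
  have hyK : y ∉ K := by
    rintro ⟨x, hx, hxy⟩
    simp only [Set.mem_ofPred_eq] at hx
    rw [hf x hxy, norm_zero] at hx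
    linarith
  obtain ⟨φ, h1, h2, h3, h4⟩ := exists_continuous_one_zero_of_isCompact hKc
    (isClosed_singleton (x := y)) (Set.disjoint_singleton_right.2 hyK)
  let φ' : C₀(Y, ℂ) := ⟨⟨fun y => (φ y : ℂ), by fun_prop⟩,
    HasCompactSupport.is_zero_at_infty (h3.comp_left (g := fun r : ℝ => (r : ℂ)) (by simp))⟩
  have hφ' : ∀ y, φ' y = (φ y : ℂ) := fun _ => rfl
  refine ⟨baseAct e p φ' (sym e k f), Submodule.subset_span ⟨φ', sym e k f, ?_, rfl⟩, ?_⟩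
  · rw [hφ', h2 rfl]; simp
  rw [baseAct_sym e p hp, dist_eq_norm, ← map_sub]
  refine (norm_sym_le _ (half_pos hε).le fun x => ?_).trans_lt (half_lt_self hε)
  have h5 : ((f - bmul (baseFun p φ') k f : N e k) : C₀(X, ℂ)) x =
      ((1 - φ (p x) : ℝ) : ℂ) * (f : C₀(X, ℂ)) x := by
    change (f : C₀(X, ℂ)) x - φ' (p x) * (f : C₀(X, ℂ)) x = _
    rw [hφ']; push_cast; ring
  rw [h5, norm_mul, Complex.norm_real]
  by_cases hx : ε / 2 ≤ ‖(f : C₀(X, ℂ)) x‖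
  · rw [h1 ⟨x, hx, rfl⟩]; simp; positivity
  · have h6 := h4 (p x)
    rw [Real.norm_of_nonneg (by linarith [h6.2])]
    calc _ ≤ 1 * ‖(f : C₀(X, ℂ)) x‖ :=
          mul_le_mul_of_nonneg_right (by linarith [h6.1]) (norm_nonneg _)
      _ ≤ ε / 2 := by rw [one_mul]; exact (not_le.1 hx).le

/-- If `f` is bounded by `δ` on the fibre over `y`, then `s^k f` has distance at most `δ` from the
kernel of the localisation at `y`. -/
theorem exists_localIdeal_near (p : C(X, Y)) (hp : ∀ x ∈ e.source, p (e x) = p x) {k : ℤ}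
    (f : N e k) {y : Y} {δ : ℝ} (hδ : 0 < δ) (hf : ∀ x, p x = y → ‖(f : C₀(X, ℂ)) x‖ ≤ δ) :
    ∃ b ∈ HilbertField.localIdeal (fun φ a => baseAct e p φ a) y, ‖sym e k f - b‖ ≤ δ := by
  have hpos : ∀ x, 0 < max δ ‖(f : C₀(X, ℂ)) x‖ := fun x => lt_max_of_lt_left hδ
  have hle : ∀ x, δ / max δ ‖(f : C₀(X, ℂ)) x‖ ≤ 1 := fun x =>
    (div_le_one (hpos x)).2 (le_max_left _ _)
  have hcont : Continuous fun x => δ / max δ ‖(f : C₀(X, ℂ)) x‖ :=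
    Continuous.div continuous_const (by fun_prop) fun x => (hpos x).ne'
  -- Chosen so that `f - c f = δ f / max(δ, |f|)` is the truncation of `f` to modulus at most `δ`,
  -- while `c f` vanishes wherever `|f| ≤ δ`.
  let c : BoundedContinuousFunction X ℂ := BoundedContinuousFunction.ofNormedAddCommGroup
    (fun x => ((1 - δ / max δ ‖(f : C₀(X, ℂ)) x‖ : ℝ) : ℂ)) (by fun_prop) 1 (fun x => by
      rw [Complex.norm_real, Real.norm_of_nonneg (by linarith [hle x])]
      have : 0 ≤ δ / max δ ‖(f : C₀(X, ℂ)) x‖ := div_nonneg hδ.le (hpos x).le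
      linarith)
  have hc : ∀ x, c x = ((1 - δ / max δ ‖(f : C₀(X, ℂ)) x‖ : ℝ) : ℂ) := fun _ => rfl
  refine ⟨sym e k (bmul c k f), sym_mem_localIdeal p hp _ fun x hx => ?_, ?_⟩
  · rw [bmul_apply, hc, max_eq_left (hf x hx), div_self hδ.ne']; simp
  · rw [← map_sub]
    refine norm_sym_le _ hδ.le fun x => ?_
    have h5 : ((f - bmul c k f : N e k) : C₀(X, ℂ)) x =
        ((δ / max δ ‖(f : C₀(X, ℂ)) x‖ : ℝ) : ℂ) * (f : C₀(X, ℂ)) x := by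
      change (f : C₀(X, ℂ)) x - c x * (f : C₀(X, ℂ)) x = _
      rw [hc]; push_cast; ring
    rw [h5, norm_mul, Complex.norm_real, Real.norm_of_nonneg (div_nonneg hδ.le (hpos x).le),
      div_mul_eq_mul_div, div_le_iff₀ (hpos x)]
    exact mul_le_mul_of_nonneg_left (le_max_right _ _) hδ.le

end PartialCrossedProduct

/-! ### Nondegeneracy -/

namespace QTri

open PartialCrossedProduct HilbertField

/-- The bound involves only the norm of `ξ` at `q`; in particular the value of `π(a) ξ` at `q`
depends on `ξ` only through its value there. -/
theorem norm_evalAt_piL_le (q : Base) (a : CrossedProduct theta) (ξ : HilbI) :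
    ‖evalAt q (piL a ξ)‖ ≤ ‖a‖ * ‖evalAt q ξ‖ := by
  refine denseRange_toHilb.induction_on ξ (isClosed_le (by fun_prop) (by fun_prop)) fun v => ?_
  refine (denseRange_symSum theta).induction_on a (isClosed_le (by fun_prop) (by fun_prop))
    fun x => ?_
  rw [piL_symSum, symOp_toHilb, evalAt_toHilb, evalAt_toHilb]
  exact norm_preRep_sum_le q x v

theorem exists_rankOne (ξ η : HilbI) : ∃ T : HilbI →L[ℂ] HilbI, ∀ ζ q,
    evalAt q (T ζ) = inner ℂ (evalAt q η) (evalAt q ζ) • evalAt q ξ := by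
  have h : ∀ ζ, ∃ θ : HilbI, ∀ q,
      evalAt q θ = inner ℂ (evalAt q η) (evalAt q ζ) • evalAt q ξ := fun ζ => by
    obtain ⟨φ, hφ⟩ := exists_inner_C0 η ζ
    obtain ⟨θ, hθ⟩ := exists_smul φ ξ
    exact ⟨θ, fun q => by rw [hθ, hφ]⟩
  choose T hT using h
  refine ⟨LinearMap.mkContinuous
    { toFun := T
      map_add' := fun ζ ζ' => hilb_ext fun q => by
        rw [map_add, hT, hT, hT, map_add, inner_add_right, add_smul]
      map_smul' := fun c ζ => hilb_ext fun q => by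
        rw [RingHom.id_apply, map_smul, hT, hT, map_smul, inner_smul_right, mul_smul] }
    (‖ξ‖ * ‖η‖) fun ζ => ?_, hT⟩
  refine norm_le_of_evalAt (by positivity) fun q => ?_
  change ‖evalAt q (T ζ)‖ ≤ _
  rw [hT, norm_smul]
  have h1 := norm_inner_le_norm (𝕜 := ℂ) (evalAt q η) (evalAt q ζ)
  have h2 : ‖evalAt q η‖ * ‖evalAt q ζ‖ ≤ ‖η‖ * ‖ζ‖ :=
    mul_le_mul (norm_evalAt_le _ _) (norm_evalAt_le _ _) (norm_nonneg _) (norm_nonneg _)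
  calc _ ≤ (‖η‖ * ‖ζ‖) * ‖ξ‖ :=
        mul_le_mul (h1.trans h2) (norm_evalAt_le _ _) (norm_nonneg _) (by positivity)
    _ = _ := by ring

theorem opT_toN0 (f : C₀(H, ℂ)) (h : C_c(I, ℂ)) : opT 0 (toN0 theta f) h = mulCc f h := by
  ext ⟨x, z⟩
  rw [opT_of_rel _ _ (rel_refl rfl x), mulCc_apply]
  simp [toN0]

/-- A local unit: a function of `t` that is `0` for `t ≤ ε/2`, `1` for `t ≥ ε` and linear in
between. -/
theorem exists_cutoff (h : C_c(I, ℂ)) : ∃ f : C₀(H, ℂ), mulCc f h = h := by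
  obtain ⟨ε, hε, hh⟩ := exists_t_bound h
  let u : H → ℂ := fun p => ((max 0 (min 1 (2 * p.1.2.1 / ε - 1)) : ℝ) : ℂ)
  have hu : TSupp u := ⟨ε / 2, half_pos hε, fun p hp => by
    have h1 : 2 * p.1.2.1 / ε - 1 ≤ 0 := by
      rw [sub_nonpos, div_le_one hε]; linarith
    simp only [u]
    rw [max_eq_left ((min_le_right _ _).trans h1), Complex.ofReal_zero]⟩
  refine ⟨⟨⟨u, by fun_prop⟩, hu.hasCompactSupport.is_zero_at_infty⟩, ?_⟩
  ext x
  rw [mulCc_apply]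
  change u x.1 * h x = h x
  by_cases hx : x ∈ upper ε
  · have h1 : 1 ≤ 2 * x.1.1.2.1 / ε - 1 := by
      have hx : ε ≤ x.1.1.2.1 := hx
      rw [le_sub_iff_add_le, le_div_iff₀ hε]; linarith
    simp only [u]
    rw [min_eq_left h1, max_eq_right zero_le_one, Complex.ofReal_one, one_mul]
  · rw [hh x hx, mul_zero]

theorem isRankOne_iff (T : HilbI →L[ℂ] HilbI) : IsRankOne HilbI T ↔ ∃ ξ η : HilbI,
    ∀ (ζ : HilbI) (q : Base),
      evalAt q (T ζ) = inner ℂ (evalAt q η) (evalAt q ζ) • evalAt q ξ := Iff.rfl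

theorem isRankOne_comp (a : CrossedProduct theta) {T : HilbI →L[ℂ] HilbI}
    (hT : IsRankOne HilbI T) : IsRankOne HilbI ((piL a).comp T) := by
  rw [isRankOne_iff] at hT ⊢
  obtain ⟨ξ, η, h⟩ := hT
  refine ⟨piL a ξ, η, fun ζ q => ?_⟩
  -- With `q` fixed, the inner product is a constant scalar. The difference vanishes at `q`, and the
  -- fibrewise bound carries this through `π(a)`.
  have h1 : evalAt q (T ζ - inner ℂ (evalAt q η) (evalAt q ζ) • ξ) = 0 := by
    rw [map_sub, map_smul, h, sub_self]
  have h2 := norm_evalAt_piL_le q a (T ζ - inner ℂ (evalAt q η) (evalAt q ζ) • ξ)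
  rw [h1, norm_zero, mul_zero, norm_le_zero_iff, map_sub, map_sub, map_smul, map_smul,
    sub_eq_zero] at h2
  exact h2

/-- Applying `π(a)` to a rank one operator gives a rank one operator, so compacts are preserved.
Conversely, approximate the vector `ξ` of a rank one operator by some `v ∈ C_c(I)`; a local unit for
`v` then factors the approximant through `π`. -/
theorem nondegenerate_piHom : closure (Submodule.span ℂ
    {T | ∃ (a : CrossedProduct theta), ∃ S ∈ compacts HilbI, T = piHom a * S} :
      Set (HilbI →L[ℂ] HilbI)) = compacts HilbI := by
  refine Set.Subset.antisymm (closure_minimal ?_ isClosed_closure) (closure_minimal ?_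
    isClosed_closure)
  · change ((Submodule.span ℂ _ : Submodule ℂ (HilbI →L[ℂ] HilbI)) : Set (HilbI →L[ℂ] HilbI)) ⊆
      ((Submodule.span ℂ {T | IsRankOne HilbI T}).topologicalClosure : Set (HilbI →L[ℂ] HilbI))
    refine Submodule.span_le.2 ?_
    rintro _ ⟨a, S, hS, rfl⟩
    have hc : Continuous fun S : HilbI →L[ℂ] HilbI => (piL a).comp S :=
      continuous_const.clm_comp continuous_id
    have key : ∀ T ∈ Submodule.span ℂ {T | IsRankOne HilbI T},
        (piL a).comp T ∈ Submodule.span ℂ {T | IsRankOne HilbI T} := fun T hT => by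
      induction hT using Submodule.span_induction with
      | mem T hT => exact Submodule.subset_span (isRankOne_comp a hT)
      | zero => rw [ContinuousLinearMap.comp_zero]; exact Submodule.zero_mem _
      | add T T' _ _ h h' => rw [ContinuousLinearMap.comp_add]; exact Submodule.add_mem _ h h'
      | smul c T _ h => rw [ContinuousLinearMap.comp_smul]; exact Submodule.smul_mem _ _ h
    exact map_mem_closure hc hS key
  · change ((Submodule.span ℂ _ : Submodule ℂ (HilbI →L[ℂ] HilbI)) : Set (HilbI →L[ℂ] HilbI)) ⊆
      ((Submodule.span ℂ {T | ∃ (a : CrossedProduct theta), ∃ S ∈ compacts HilbI,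
        T = piHom a * S}).topologicalClosure : Set (HilbI →L[ℂ] HilbI))
    refine Submodule.span_le.2 ?_
    intro T hT
    obtain ⟨ξ, η, hT⟩ := (isRankOne_iff T).1 hT
    refine (Metric.mem_closure_iff (α := HilbI →L[ℂ] HilbI)).2 fun ε hε => ?_
    obtain ⟨v, hv⟩ := exists_toHilb_near ξ (show 0 < ε / 2 / (‖η‖ + 1) by positivity)
    obtain ⟨T', hT'⟩ := exists_rankOne (toHilb v) η
    obtain ⟨f, hf⟩ := exists_cutoff v
    refine ⟨T', Submodule.subset_span ⟨sym theta 0 (toN0 theta f), T',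
      subset_closure (Submodule.subset_span ⟨toHilb v, η, hT'⟩), ?_⟩, ?_⟩
    · ext1 ζ
      refine hilb_ext fun q => ?_
      change _ = evalAt q (piL (sym theta 0 (toN0 theta f)) (T' ζ))
      have h1 : evalAt q (T' ζ - inner ℂ (evalAt q η) (evalAt q ζ) • toHilb v) = 0 := by
        rw [map_sub, map_smul, hT', sub_self]
      have h2 := norm_evalAt_piL_le q (sym theta 0 (toN0 theta f))
        (T' ζ - inner ℂ (evalAt q η) (evalAt q ζ) • toHilb v)
      rw [h1, norm_zero, mul_zero, norm_le_zero_iff, map_sub, map_sub, map_smul, map_smul,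
        sub_eq_zero, piL_sym, opT_toN0, hf] at h2
      rw [h2, hT']
    · refine (dist_eq_norm T T').trans_lt ?_
      refine lt_of_le_of_lt (ContinuousLinearMap.opNorm_le_bound _ (half_pos hε).le fun ζ => ?_)
        (half_lt_self hε)
      refine norm_le_of_evalAt (by positivity) fun q => ?_
      rw [sub_apply, map_sub, hT, hT', ← smul_sub, ← map_sub, norm_smul]
      have h1 := norm_inner_le_norm (𝕜 := ℂ) (evalAt q η) (evalAt q ζ)
      have h2 : ‖evalAt q η‖ * ‖evalAt q ζ‖ ≤ (‖η‖ + 1) * ‖ζ‖ :=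
        mul_le_mul ((norm_evalAt_le _ _).trans (by linarith)) (norm_evalAt_le _ _)
          (norm_nonneg _) (by positivity)
      calc _ ≤ ((‖η‖ + 1) * ‖ζ‖) * (ε / 2 / (‖η‖ + 1)) :=
            mul_le_mul (h1.trans h2) ((norm_evalAt_le _ _).trans hv.le) (norm_nonneg _)
              (by positivity)
        _ = _ := by field_simp

/-! ### Faithfulness on the fibres -/

theorem opT_of_const {k : ℤ} (f : N theta k) {h : C_c(I, ℂ)} (hh : ∀ p z, h (p, z) = h (p, 1))
    (p : H) (z : Circle) : opT k f h (p, z) = opT k f h (p, 1) * (z : ℂ) ^ k := by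
  by_cases hx : ∃ y, Rel theta k y p
  · obtain ⟨y, hy⟩ := hx
    rw [opT_of_rel _ _ hy, opT_of_rel _ _ hy, hh y z, Circle.coe_one, one_zpow]
    ring
  · push Not at hx
    rw [opT_of_not_rel _ _ hx, opT_of_not_rel _ _ hx, zero_mul]

/-- On functions constant along the circle, degree `l` produces multiples of `z^l`, and distinct
powers of `z` are orthogonal. The circle factor of `I` exists for this purpose. -/
theorem inner_opT_sum {k : ℤ} (f : N theta k) {h : C_c(I, ℂ)}
    (hh : ∀ p z, h (p, z) = h (p, 1)) (q : Base) (x : SymAlg theta) :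
    inner ℂ (toL2 q (opT k f h)) (toL2 q (preRep.sum x h)) =
      inner ℂ (toL2 q (opT k f h)) (toL2 q (opT k (coeff k x) h)) := by
  simp only [← preRep_apply]
  induction x using dfinsupp_induction with
  | zero => simp
  | add x y hx hy =>
    simp only [map_add, LinearMap.add_apply, inner_add_right, hx, hy]
  | single l g =>
    rw [PreRep.sum_single]
    by_cases hl : l = k
    · subst hl; rw [coeff_single_same]
    · rw [coeff_single_ne (Ne.symm hl)]
      simp only [map_zero, LinearMap.zero_apply, inner_zero_right]
      rw [inner_toL2]
      refine integral_mu_eq_zero _ (fun p => star (opT k f h (p, 1)) * opT l g h (p, 1))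
        (sub_ne_zero.2 hl) (fun p z => ?_) q
      have hz : (z : ℂ) ≠ 0 := Circle.coe_ne_zero z
      rw [conjMul_apply, preRep_apply, preRep_apply, opT_of_const f hh, opT_of_const g hh,
        star_mul, star_zpow₀, Complex.star_def, ← Circle.coe_inv_eq_conj, Circle.coe_inv, inv_zpow,
        zpow_sub₀ hz, div_eq_mul_inv]
      ring

/-- For `v` the degree `k` component, orthogonality gives `‖v‖² = ⟨v, x h⟩`, and Cauchy–Schwarz
bounds `‖v‖` by the norm of `x h`. -/
theorem norm_opT_coeff_le (k : ℤ) {h : C_c(I, ℂ)}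
    (hh : ∀ p z, h (p, z) = h (p, 1)) (q : Base) (x : SymAlg theta) :
    ‖toL2 q (mulCc (coeff k x : C₀(H, ℂ)) h)‖ ≤ ‖toL2 q (preRep.sum x h)‖ := by
  rw [← norm_opT]
  set v := toL2 q (opT k (coeff k x) h) with hv
  have h1 := inner_opT_sum (coeff k x) hh q x
  rw [← hv, inner_self_eq_norm_sq_to_K] at h1
  have h2 := norm_inner_le_norm (𝕜 := ℂ) v (toL2 q (preRep.sum x h))
  rw [h1, norm_pow, RCLike.norm_ofReal, abs_norm, sq] at h2
  rcases (norm_nonneg v).eq_or_lt with h3 | h3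
  · rw [← h3]; exact norm_nonneg _
  · exact le_of_mul_le_mul_left h2 h3

/-- If `|f_k(p)| > c > C`, test on `u = (|f_k| - c)₊`, which vanishes for small `t` because `f_k ∈
C₀(H)`. On the support of `u` one has `|f_k| ≥ c`, so `c ‖u‖ ≤ ‖f_k u‖ ≤ C ‖u‖`. This forces `u = 0`
on `H_q` by full support, against `u(p) > 0`. -/
theorem norm_coeff_le {q : Base} {x : SymAlg theta} {C : ℝ} (hC : 0 ≤ C)
    (hx : ∀ h, ‖toL2 q (preRep.sum x h)‖ ≤ C * ‖toL2 q h‖) (k : ℤ) {p : H} (hp : proj p = q) :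
    ‖(coeff k x : C₀(H, ℂ)) p‖ ≤ C := by
  by_contra hlt
  obtain ⟨c, hCc, hc⟩ := exists_between (not_le.1 hlt)
  have hc0 : 0 < c := hC.trans_lt hCc
  set f : C₀(H, ℂ) := (coeff k x : C₀(H, ℂ)) with hf
  let u : H → ℝ := fun p => max 0 (‖f p‖ - c)
  have hu : TSupp u := by
    obtain ⟨ε, hε, hK⟩ := (isCompact_le_norm f hc0).exists_forall_le'
      (f := fun p : H => p.1.2.1) (by fun_prop) (a := 0) fun p _ => t_pos p
    refine ⟨ε, hε, fun p hp => max_eq_left ?_⟩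
    by_contra h
    exact absurd (hK p (show c ≤ ‖f p‖ by linarith)) (not_le.2 hp)
  have huc : Continuous u := by fun_prop
  let h : C_c(I, ℂ) := mkCc (fun x => (u x.1 : ℂ)) (by fun_prop) (by
    obtain ⟨ε, hε, hh⟩ := hu
    exact ⟨ε, hε, fun x hx => by rw [hh x.1 (not_le.1 hx), Complex.ofReal_zero]⟩)
  have hh : ∀ x, h x = (u x.1 : ℂ) := fun _ => rfl
  have h1 : ‖toL2 q h‖ ≤ c⁻¹ * ‖toL2 q (mulCc f h)‖ := by
    refine norm_toL2_le q _ _ (by positivity) fun x => ?_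
    rw [mulCc_apply, norm_mul, ← mul_assoc]
    by_cases hx : c ≤ ‖f x.1‖
    · refine le_mul_of_one_le_left (norm_nonneg _) ?_
      rw [inv_mul_eq_div, one_le_div hc0]; exact hx
    · have : u x.1 = 0 := max_eq_left (by linarith)
      rw [hh, this]; simp
  have h2 : ‖toL2 q h‖ ≤ c⁻¹ * C * ‖toL2 q h‖ := by
    refine h1.trans ?_
    rw [mul_assoc]
    refine mul_le_mul_of_nonneg_left ?_ (by positivity)
    exact (norm_opT_coeff_le k (fun _ _ => rfl) q x).trans (hx h)
  have h3 : ‖toL2 q h‖ = 0 := by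
    have h4 : c⁻¹ * C < 1 := by rw [inv_mul_eq_div, div_lt_one hc0]; exact hCc
    nlinarith [norm_nonneg (toL2 q h)]
  have h5 := norm_sq_toL2 q h
  rw [h3, mu_eq_prod] at h5
  have h6 : ∫ p, u p ^ 2 ∂nu q = 0 := by
    have h7 := integral_prod_mul (μ := nu q) (ν := circleMeasure) (fun p => u p ^ 2)
      (fun _ => (1 : ℝ))
    simp only [mul_one, integral_const, smul_eq_mul, probReal_univ] at h7
    rw [← h7]
    refine Eq.trans ?_ (h5.symm.trans (by norm_num))
    refine integral_congr_ae (Filter.Eventually.of_forall fun x => ?_)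
    simp only [hh, Complex.norm_real, Real.norm_eq_abs, sq_abs]
  have h8 := eq_zero_of_integral_nu (g := fun p => u p ^ 2) (by fun_prop) (by
    obtain ⟨ε, hε, hu0⟩ := hu
    exact ⟨ε, hε, fun p hp => by simp [hu0 p hp]⟩) (fun p => sq_nonneg _) h6 hp
  have h9 : u p = 0 := by simpa using h8
  have h10 : ‖f p‖ - c ≤ u p := le_max_right _ _
  linarith

instance : LocallyCompactSpace Base :=
  (isLocallyClosed_Ioc (a := (0 : ℝ)) (b := 1)).locallyCompactSpace

/-- If `π_q(a) = 0` and `x` is a finite sum within `δ` of `a`, all coefficients of `x` are at most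
`δ` on `H_q`. To add up their distances to the ideal, the number of terms must be bounded
independently of `δ`, and a Fejér mean of fixed order achieves this. -/
theorem mem_localIdeal_of_piL_eq_zero {q : Base} {a : CrossedProduct theta}
    (ha : ∀ ξ, evalAt q (piL a ξ) = 0) :
    a ∈ localIdeal (fun φ a => baseAct theta proj φ a) q := by
  refine (Submodule.isClosed_topologicalClosure _).closure_subset
    (Metric.mem_closure_iff.2 fun ε hε => ?_)
  have near : ∀ δ > 0, ∃ x, ‖a - symSum theta x‖ < δ := fun δ hδ => by
    obtain ⟨_, ⟨x, rfl⟩, hx⟩ := Metric.mem_closure_iff.1 (denseRange_symSum theta a) δ hδ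
    exact ⟨x, by rwa [dist_eq_norm] at hx⟩
  have hε6 : 0 < ε / 6 := by positivity
  obtain ⟨x₀, hx₀⟩ := near _ hε6
  -- The order `n` is settled by the rough approximation `x₀`, before the finer one is chosen.
  obtain ⟨n, hn, hn0⟩ := ((Metric.tendsto_nhds.1 (tendsto_fejer_symSum x₀) _ hε6).and
    (Filter.eventually_gt_atTop 0)).exists
  rw [dist_eq_norm] at hn
  set δ := ε / 6 / (2 * n + 1) with hδ
  have hδ0 : 0 < δ := by positivity
  -- The Fejér mean of `x` has at most `2n + 1` terms, each at distance at most `δ` from the ideal,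
  -- for a total of at most `ε/6`.
  obtain ⟨x, hx⟩ := near δ hδ0
  have hcoeff : ∀ k p, proj p = q → ‖(coeff k x : C₀(H, ℂ)) p‖ ≤ δ := fun k p hp => by
    refine norm_coeff_le hδ0.le (fun h => ?_) k hp
    have h1 : toL2 q (preRep.sum x h) = - evalAt q (piL (a - symSum theta x) (toHilb h)) := by
      rw [map_sub, sub_apply, map_sub, ha, zero_sub, neg_neg, piL_symSum, symOp_toHilb,
        evalAt_toHilb]
    rw [h1, norm_neg]
    refine (norm_evalAt_piL_le _ _ _).trans ?_
    exact mul_le_mul_of_nonneg_right hx.le (norm_nonneg _)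
  choose b hb hbδ using fun k => exists_localIdeal_near (e := theta) proj proj_theta (coeff k x)
    (y := q) hδ0 (hcoeff k)
  refine ⟨∑ k ∈ Finset.Ioo (-(n : ℤ)) n, (fejer n k : ℂ) • b k, ?_, ?_⟩
  · exact Submodule.sum_mem _ fun k _ => Submodule.smul_mem _ _ (hb k)
  have h1 : ‖symSum theta (coeffMul (fun k => fejer n k) x) -
      ∑ k ∈ Finset.Ioo (-(n : ℤ)) n, (fejer n k : ℂ) • b k‖ ≤ ε / 6 := by
    rw [symSum_fejer, ← Finset.sum_sub_distrib]
    calc _ ≤ ∑ k ∈ Finset.Ioo (-(n : ℤ)) n, δ := by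
          refine norm_sum_le_of_le _ fun k _ => ?_
          rw [← smul_sub, norm_smul, Complex.norm_real, Real.norm_of_nonneg (fejer_nonneg n k)]
          calc _ ≤ 1 * δ := mul_le_mul (fejer_le_one n k) (hbδ k) (norm_nonneg _) zero_le_one
            _ = δ := one_mul _
      _ ≤ (2 * n + 1) * δ := by
          rw [Finset.sum_const, nsmul_eq_mul, Int.card_Ioo]
          refine mul_le_mul_of_nonneg_right ?_ hδ0.le
          have : ((n : ℤ) - -(n : ℤ) - 1).toNat ≤ 2 * n + 1 := by omega
          exact_mod_cast this
      _ = ε / 6 := mul_div_cancel₀ _ (by positivity)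
  have h2 : ‖symSum theta (coeffMul (fun k => fejer n k) x₀) -
      symSum theta (coeffMul (fun k => fejer n k) x)‖ ≤ ε / 6 + ε / 6 := by
    rw [← map_sub, ← map_sub]
    refine (norm_fejer_le hn0 _).trans ?_
    rw [map_sub, show symSum theta x₀ - symSum theta x =
      (a - symSum theta x) - (a - symSum theta x₀) by abel]
    refine (norm_sub_le _ _).trans (add_le_add (hx.le.trans ?_) hx₀.le)
    exact div_le_self hε6.le (by linarith [Nat.cast_nonneg (α := ℝ) n])
  -- The path is `a`, `x₀`, the Fejér mean of `x₀`, that of `x`, the element of the ideal.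
  -- Contractivity of Fejér means bounds the third step by `2ε/6`, and the total is below `5ε/6`.
  rw [dist_eq_norm, show a - ∑ k ∈ Finset.Ioo (-(n : ℤ)) n, (fejer n k : ℂ) • b k =
    (a - symSum theta x₀) + (symSum theta x₀ - symSum theta (coeffMul (fun k => fejer n k) x₀)) +
    (symSum theta (coeffMul (fun k => fejer n k) x₀) -
      symSum theta (coeffMul (fun k => fejer n k) x)) +
    (symSum theta (coeffMul (fun k => fejer n k) x) -
      ∑ k ∈ Finset.Ioo (-(n : ℤ)) n, (fejer n k : ℂ) • b k) by abel]
  rw [norm_sub_rev] at hn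
  refine ((norm_add₃_le).trans (add_le_add (add_le_add (norm_add_le _ _) h2) h1)).trans_lt ?_
  linarith

theorem isFieldOfFaithfulReps :
    IsFieldOfFaithfulReps HilbI (fun φ a => baseAct theta proj φ a) piHom where
  adjoint := isAdjointPair_piHom
  nondegenerate := nondegenerate_piHom
  linear φ a ξ q := piL_baseAct φ a ξ q
  faithful q a := by
    refine ⟨fun h ξ => ?_, fun h => ?_⟩
    -- The map `a ↦ (π(a) ξ)_q` is continuous and kills `φ a` whenever `φ(q) = 0`, hence the closed
    -- span of such products.
    · let L : CrossedProduct theta →L[ℂ] L2 q :=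
        (evalAt q).comp ((ContinuousLinearMap.apply ℂ HilbI ξ).comp piL)
      have h1 : localIdeal (fun φ a => baseAct theta proj φ a) q ≤ LinearMap.ker L.toLinearMap := by
        refine Submodule.topologicalClosure_minimal _ (Submodule.span_le.2 ?_) L.isClosed_ker
        rintro _ ⟨φ, a, hφ, rfl⟩
        change evalAt q (piL (baseAct theta proj φ a) ξ) = 0
        rw [piL_baseAct, hφ, zero_smul]
      exact h1 h
    · exact mem_localIdeal_of_piL_eq_zero h

theorem opT_one_apply (g : C₀(H, ℂ)) (hg : ∀ x, x ∉ theta.source → g x = 0) (h : C_c(I, ℂ))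
    (x : I) : opT 1 (toN1 theta g hg) h x =
      (Qfun x)⁻¹ * (Zfun x * thetaInv (fun y => g y.1 * h y) x) := by
  obtain ⟨p, z⟩ := x
  by_cases hp : p ∈ theta.target
  · have hr : Rel theta 1 (theta.symm p) p :=
      (rel_one _ _ _).2 ⟨theta.map_target hp, theta.right_inv hp⟩
    have ht : ((p, z) : I) ∈ thetaI.target := ⟨hp, trivial⟩
    rw [opT_of_rel _ _ hr, thetaInv, if_pos ht]
    change _ = (p.1.1 : ℂ)⁻¹ * ((z : ℂ) * (g (theta.symm p) * h (theta.symm p, z)))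
    simp only [zpow_neg, zpow_one, toN1]
    ring
  · have ht : ((p, z) : I) ∉ thetaI.target := fun h => hp h.1
    rw [opT_of_not_rel, thetaInv, if_neg ht, mul_zero, mul_zero]
    intro y hy
    obtain ⟨h1, rfl⟩ := (rel_one _ _ _).1 hy
    exact hp (theta.map_source h1)

end QTri

theorem mainTheorem10 :
    HilbertField.IsHilbertModule QTri.HilbI ∧
    ∃ π : PartialCrossedProduct.CrossedProduct QTri.theta →ₙₐ[ℂ] (QTri.HilbI →L[ℂ] QTri.HilbI),
      HilbertField.IsFieldOfFaithfulReps QTri.HilbI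
        (fun φ a => PartialCrossedProduct.baseAct QTri.theta QTri.proj φ a) π ∧
      (∀ (f : C₀(QTri.H, ℂ)) (h : C_c(QTri.I, ℂ)), ∃ k : C_c(QTri.I, ℂ),
        (∀ x, k x = f x.1 * h x) ∧
        π (PartialCrossedProduct.sym QTri.theta 0 (PartialCrossedProduct.toN0 QTri.theta f))
          (QTri.toHilbI h) = QTri.toHilbI k) ∧
      (∀ (g : C₀(QTri.H, ℂ)) (hg : ∀ x, x ∉ QTri.theta.source → g x = 0) (h : C_c(QTri.I, ℂ)),
        ∃ k : C_c(QTri.I, ℂ),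
        (∀ x, k x = (QTri.Qfun x)⁻¹ *
          (QTri.Zfun x * QTri.thetaInv (fun y => g y.1 * h y) x)) ∧
        π (PartialCrossedProduct.sym QTri.theta 1 (PartialCrossedProduct.toN1 QTri.theta g hg))
          (QTri.toHilbI h) = QTri.toHilbI k) := by
  refine ⟨QTri.isHilbertModule, QTri.piHom, QTri.isFieldOfFaithfulReps, fun f h => ?_,
    fun g hg h => ?_⟩
  · refine ⟨QTri.mulCc f h, fun _ => rfl, ?_⟩
    rw [← QTri.opT_toN0]
    exact QTri.piL_sym 0 _ h
  · exact ⟨QTri.opT 1 (PartialCrossedProduct.toN1 QTri.theta g hg) h,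
      QTri.opT_one_apply g hg h, QTri.piL_sym 1 _ h⟩
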